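/- **Setting.** For $\omega\in\mathbb R^3$ let $\omega^\times$ be the skew-symmetric matrix with $\omega^\times x=\omega\times x$. Let $g\in\mathbb R^3$, let $\Omega,a:[0,\infty)\to\mathbb R^3$, and let $R(t)\in SO(3)$, $v(t)\in\mathbb R^3$ satisfy, for all $t\ge 0$, $$\dot R=R\,\Omega^\times,\qquad \dot v=Ra+g .$$ For gains $k,c>0$ consider the observer with states $\hat R\in SO(3)$, $\hat v\in\mathbb R^3$ and auxiliary state $z\in\mathbb R^3$, $$\dot{\hat R}=\hat R\,\Omega^\times+\Omega_\Delta^\times\hat R,\qquad \dot{\hat v}=\hat Ra+g+\Omega_\Delta\times\hat v+u_\Delta,\qquad \dot z=g+u_\Gamma,$$ $$\Omega_\Delta=c\,(\hat v-z)\times(v-z),\qquad u_\Delta=k(v-\hat v)-c\big((\hat v-z)\times(v-z)\big)\times z,\qquad u_\Gamma=k(v-z),$$ and the error $$\bar E=\big(R\hat R^\top,\; v-z-R\hat R^\top(\hat v-z)\big)\in SO(3)\times\mathbb R^3 .$$ Put $\bar E_s=\{(I,0)\}$ and $\bar E_u=\{(Q,0): Q\in SO(3),\ \operatorname{tr}Q=-1\}$.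 **Theorem.** Assume that $v$ is bounded on $[0,\infty)$ and that $Ra$ is uniformly continuous on $[0,\infty)$ and persistently exciting: there are $\mu,\delta>0$ such that for every unit vector $b$ and every $t\ge0$ there is $\tau\in[t,t+\delta)$ with $|b\times R(\tau)a(\tau)|\ge\mu$. Then the equation for $z$ has a solution on $[0,\infty)$ for every $z(0)$. Fix any such solution $z$; it determines, together with $(R,v)$, a time-varying error system. For every initial time $t_0\ge0$ and every initial value in $SO(3)\times\mathbb R^3$ of $(\hat R,\hat v)$ at $t_0$ there is a solution $(\hat R,\hat v)$ on $[t_0,\infty)$, and the following hold for all $t_0\ge 0$ (in particular $t_0=0$). 1. $z$ is uniformly continuous on $[0,\infty)$, and along every solution $\bar E(t)$ converges, as $t\to\infty$, to the set $\bar E_s\cup\bar E_u$. 2. $\bar E_u$ is invariant under the error dynamics (if $\bar E(t_0)\in\bar E_u$ then $\bar E(t)\in\bar E_u$ for all $t\ge t_0$), and each of its points is unstable: every neighbourhood of every point of $\bar E_u$ contains an initial error $\bar E(t_0)$ from which $\bar E(t)\to(I,0)$. 3. $(I,0)$ is almost-globally asymptotically stable for the error dynamics, that is, it is Lyapunov stable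 (uniformly in $t_0$) and, for each $t_0$, $\bar E(t)\to(I,0)$ from almost every initial error $\bar E(t_0)$ with respect to Haar measure on $SO(3)$ times Lebesgue measure on $\mathbb R^3$. It is locally exponentially stable: there are $r,C,\lambda>0$, independent of $t_0$, such that $d(\bar E(t_0),(I,0))<r$ implies $d(\bar E(t),(I,0))\le Ce^{-\lambda(t-t_0)}d(\bar E(t_0),(I,0))$ for all $t\ge t_0$, where $d$ is the (maximum) product metric of the Frobenius metric on $SO(3)$ and the Euclidean metric on $\mathbb R^3$. Moreover $\bar E=(I,0)$ if and only if $\hat R=R$ and $\hat v=v$. -/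

import Mathlib

open Set Filter Topology MeasureTheory
open scoped Matrix Matrix.Norms.Frobenius

namespace VelocityAided

/-- Euclidean three-space. -/
abbrev E3 : Type := EuclideanSpace ℝ (Fin 3)

/-- Real three by three matrices (with the Frobenius norm). -/
abbrev M3 : Type := Matrix (Fin 3) (Fin 3) ℝ

/-- The rotation group, with the metric inherited from the Frobenius norm. -/
abbrev SO3 : Type := Matrix.specialOrthogonalGroup (Fin 3) ℝ

/-- The vector cross product. -/
def cross (x y : E3) : E3 := WithLp.toLp 2 (crossProduct (WithLp.ofLp x) (WithLp.ofLp y))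

/-- The matrix acting on vectors. -/
def act (M : M3) (x : E3) : E3 := WithLp.toLp 2 (M *ᵥ WithLp.ofLp x)

/-- The skew-symmetric matrix of a vector. -/
def skew (w : E3) : M3 :=
  !![0, -w 2, w 1;
     w 2, 0, -w 0;
     -w 1, w 0, 0]

theorem act_skew (w x : E3) : act (skew w) x = cross w x := by
  ext i
  fin_cases i <;>
    simp [act, skew, cross, dotProduct, Fin.sum_univ_three, cross_apply] <;> ring

/-! ### The measure on the rotation group -/

instance : MeasurableSpace SO3 := borel SO3

instance : BorelSpace SO3 := ⟨rfl⟩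

instance : IsTopologicalGroup SO3 where
  continuous_mul := continuous_induced_rng.2
    ((continuous_subtype_val.comp continuous_fst).mul (continuous_subtype_val.comp continuous_snd))
  continuous_inv := continuous_induced_rng.2 continuous_subtype_val.star

instance : CompactSpace SO3 := by
  have hset : {A : M3 | A ∈ Matrix.specialOrthogonalGroup (Fin 3) ℝ}
      = {A : M3 | star A * A = 1} ∩ {A : M3 | A.det = 1} := by
    ext A
    rw [Set.mem_ofPred_eq, Matrix.mem_specialOrthogonalGroup_iff, Matrix.mem_orthogonalGroup_iff']
    rfl
  have hcl : IsClosed {A : M3 | A ∈ Matrix.specialOrthogonalGroup (Fin 3) ℝ} := by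
    rw [hset]
    exact (isClosed_eq (continuous_star.mul continuous_id) continuous_const).inter
      (isClosed_eq continuous_id.matrix_det continuous_const)
  have hsub : {A : M3 | A ∈ Matrix.specialOrthogonalGroup (Fin 3) ℝ}
      ⊆ Set.univ.pi fun _ => Set.univ.pi fun _ => Set.Icc (-1 : ℝ) 1 := by
    intro A hA i _ j _
    have h := entry_norm_bound_of_unitary (𝕜 := ℝ)
      (Matrix.specialUnitaryGroup_le_unitaryGroup hA) i j
    exact abs_le.1 h
  have hK : IsCompact (Set.univ.pi fun _ => Set.univ.pi fun _ => Set.Icc (-1 : ℝ) 1 :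
      Set (Fin 3 → Fin 3 → ℝ)) :=
    isCompact_univ_pi fun _ => isCompact_univ_pi fun _ => isCompact_Icc
  exact isCompact_iff_compactSpace.1 (IsCompact.of_isClosed_subset hK hcl hsub)

/-- Haar measure on the rotation group times Lebesgue measure. -/
noncomputable def errorMeasure : Measure (SO3 × E3) :=
  (Measure.haar : Measure SO3).prod volume

/-! ### The vehicle -/

/-- `(R, v)` solves `R' = R Ω^×`, `v' = R a + g` for `t ≥ 0` (one-sided derivatives at `0`). -/
structure IsVehicleTrajectory (g : E3) (Ω a : ℝ → E3) (R : ℝ → SO3) (v : ℝ → E3) : Prop where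
  rot : ∀ t, 0 ≤ t →
    HasDerivWithinAt (fun s => (R s : M3)) ((R t : M3) * skew (Ω t)) (Ici 0) t
  vel : ∀ t, 0 ≤ t → HasDerivWithinAt v (act (R t) (a t) + g) (Ici 0) t

/-- In every time window of a fixed length, and for every unit vector `b`, the signal is at some
time uniformly far from being parallel to `b`. -/
def PersistentlyExciting (x : ℝ → E3) : Prop :=
  ∃ μ > (0 : ℝ), ∃ δ > (0 : ℝ), ∀ b : E3, ‖b‖ = 1 → ∀ t, 0 ≤ t →
    ∃ τ ∈ Ico t (t + δ), μ ≤ ‖cross b (x τ)‖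

/-! ### The observer -/

/-- Innovation term `Ω_Δ`. -/
noncomputable def omegaDelta (c : ℝ) (v vh z : E3) : E3 := c • cross (vh - z) (v - z)

/-- Innovation term `u_Δ`. -/
noncomputable def uDelta (c k : ℝ) (v vh z : E3) : E3 :=
  k • (v - vh) - c • cross (cross (vh - z) (v - z)) z

/-- Innovation term `u_Γ`. -/
noncomputable def uGamma (k : ℝ) (v z : E3) : E3 := k • (v - z)

/-- The auxiliary state: `z' = g + u_Γ` for `t ≥ 0`. -/
def IsAuxiliary (g : E3) (k : ℝ) (v z : ℝ → E3) : Prop :=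
  ∀ t, 0 ≤ t → HasDerivWithinAt z (g + uGamma k (v t) (z t)) (Ici 0) t

/-- The attitude and velocity estimates `(Rh, vh)`, started at time `t₀` (`t₀ = 0` is the observer
started together with the auxiliary state). -/
structure IsEstimate (g : E3) (c k : ℝ) (Ω a : ℝ → E3) (v z : ℝ → E3)
    (t₀ : ℝ) (Rh : ℝ → SO3) (vh : ℝ → E3) : Prop where
  rot : ∀ t, t₀ ≤ t → HasDerivWithinAt (fun s => (Rh s : M3))
    ((Rh t : M3) * skew (Ω t) + skew (omegaDelta c (v t) (vh t) (z t)) * (Rh t : M3)) (Ici t₀) t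
  vel : ∀ t, t₀ ≤ t → HasDerivWithinAt vh
    (act (Rh t) (a t) + g + cross (omegaDelta c (v t) (vh t) (z t)) (vh t)
      + uDelta c k (v t) (vh t) (z t)) (Ici t₀) t

/-! ### The error -/

/-- The error `(R Rhᵀ, v - z - R Rhᵀ (vh - z))`; the inverse in the rotation group is the
transpose. -/
def err (R : SO3) (v : E3) (Rh : SO3) (vh z : E3) : SO3 × E3 :=
  (R * Rh⁻¹, v - z - act ((R : M3) * (Rh : M3)ᵀ) (vh - z))

theorem coe_err_fst (R : SO3) (v : E3) (Rh : SO3) (vh z : E3) :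
    ((err R v Rh vh z).1 : M3) = (R : M3) * (Rh : M3)ᵀ := by
  change (R : M3) * star (Rh : M3) = _
  rw [Matrix.star_eq_conjTranspose, Matrix.conjTranspose_eq_transpose_of_trivial]

/-- `E` is a motion of the error from time `t₀` on, i.e. the error of some observer run. -/
def IsErrorMotion (g : E3) (c k : ℝ) (Ω a : ℝ → E3) (R : ℝ → SO3) (v z : ℝ → E3)
    (t₀ : ℝ) (E : ℝ → SO3 × E3) : Prop :=
  ∃ Rh vh, IsEstimate g c k Ω a v z t₀ Rh vh ∧
    ∀ t, t₀ ≤ t → E t = err (R t) (v t) (Rh t) (vh t) (z t)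

/-- The desired error. -/
def stableSet : Set (SO3 × E3) := {(1, 0)}

/-- Half-turns with zero velocity component. -/
def unstableSet : Set (SO3 × E3) := {e | (e.1 : M3).trace = -1 ∧ e.2 = 0}

/-! ### Stability notions for a time-varying family of motions

`M t₀ E` says that `E` is a motion from the initial time `t₀ ≥ 0` on. -/

section Stability

variable {X : Type*} [PseudoMetricSpace X]

/-- Lyapunov stability, uniform in the initial time. -/
def IsStablePoint (M : ℝ → (ℝ → X) → Prop) (x : X) : Prop :=
  ∀ ε > (0 : ℝ), ∃ δ > (0 : ℝ), ∀ t₀, 0 ≤ t₀ → ∀ E, M t₀ E → dist (E t₀) x < δ →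
    ∀ t, t₀ ≤ t → dist (E t) x < ε

/-- Stable, and attracting from almost every initial state. -/
def IsAlmostGloballyAsymptoticallyStable [MeasurableSpace X] (μ : Measure X)
    (M : ℝ → (ℝ → X) → Prop) (x : X) : Prop :=
  IsStablePoint M x ∧
    ∀ t₀, 0 ≤ t₀ → ∀ᵐ x₀ ∂μ, ∀ E, M t₀ E → E t₀ = x₀ → Tendsto E atTop (𝓝 x)

/-- Local exponential stability, uniform in the initial time. -/
def IsLocallyExponentiallyStable (M : ℝ → (ℝ → X) → Prop) (x : X) : Prop :=
  ∃ r > (0 : ℝ), ∃ C > (0 : ℝ), ∃ lam > (0 : ℝ), ∀ t₀, 0 ≤ t₀ → ∀ E, M t₀ E →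
    dist (E t₀) x < r → ∀ t, t₀ ≤ t →
      dist (E t) x ≤ C * Real.exp (-lam * (t - t₀)) * dist (E t₀) x

/-- The set `S` is invariant under the motions. -/
def IsInvariantSet (M : ℝ → (ℝ → X) → Prop) (S : Set X) : Prop :=
  ∀ t₀, 0 ≤ t₀ → ∀ E, M t₀ E → E t₀ ∈ S → ∀ t, t₀ ≤ t → E t ∈ S

/-- Every neighbourhood of `p` contains an initial state (for every initial time) whose motion
exists and converges to `x`. -/
def EscapesTo (M : ℝ → (ℝ → X) → Prop) (p x : X) : Prop :=
  ∀ t₀, 0 ≤ t₀ → ∀ U ∈ 𝓝 p, ∃ x₀ ∈ U, (∃ E, M t₀ E ∧ E t₀ = x₀) ∧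
    ∀ E, M t₀ E → E t₀ = x₀ → Tendsto E atTop (𝓝 x)

end Stability

end VelocityAided

namespace VelocityAided

/-! ### Differential equations on a half-line -/

section HalfLine

/-! Write `x = v - z` and let `(Q, e)` be the error. Gravity and the body rate cancel: `x' = Ra - k
x`, `e' = -k e`, and `Q' = (c (Qx) × (x - e))^× Q`. Thus `e` decays explicitly, and only the
attitude equation, a quadratic equation in `Q` perturbed by `e`, needs an argument.

The key is that this equation becomes linear on unnormalized quaternions `y = (η, ε)`: up to a
multiple of `y`, which does not change the rotation, its lift is `η' = 0`, `ε' = c x × (x × ε)` plus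
`(c/2) e y x` (`normSq_smul_liftField`, `hasDerivWithinAt_normalized_rotM`,
`IsErrorMotion.exists_lift`). The perturbation is integrable in time, so `η` has a limit `l`
(`IsLift.exists_tendsto_fst`). Persistent excitation of `Ra` passes to `x`, and a Lyapunov function
built from a filtered version of `-(x ×)²` makes `ε` decay exponentially, uniformly in `t₀`
(`exists_excitationFilter`, `IsLift.exists_decay`).

If `l ≠ 0`, then `ε/η → 0` and `Q → I`. If `l = 0`, then `η` is at most a decaying exponential times
the norm of `y`, so `Q` approaches the half-turns. For `e = 0` the scalar part is constant, which
gives invariance of the half-turns and escape from each of them.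

For fixed `t₀` and `e₀`, the limit `l` is a linear functional of `y(t₀)`, represented by a
quaternion `n(e₀)` which is nonzero and continuous in `e₀` (`exists_limit_functional`). The
exceptional attitudes are those whose quaternions are orthogonal to `n(e₀)`, a translate of the set
of half-turns. That set is Haar-null, because translates of it along a moment curve overlap at most
three times (`haar_halfTurns`); Fubini then gives almost-global attraction. Near the identity `η`
stays away from zero, so the decay of `ε` gives local exponential stability. -/

theorem le_of_hasDerivWithinAt_le {f f' B B' : ℝ → ℝ} {t₀ : ℝ}
    (hf : ∀ t, t₀ ≤ t → HasDerivWithinAt f (f' t) (Ici t₀) t)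
    (hB : ∀ t, t₀ ≤ t → HasDerivWithinAt B (B' t) (Ici t₀) t)
    (h₀ : f t₀ ≤ B t₀) (h : ∀ t, t₀ ≤ t → f' t ≤ B' t) : ∀ t, t₀ ≤ t → f t ≤ B t := by
  intro t ht
  refine image_le_of_deriv_right_le_deriv_boundary (a := t₀) (b := t)
    (fun s hs => (hf s hs.1).continuousWithinAt.mono Icc_subset_Ici_self)
    (fun s hs => (hf s hs.1).mono (Ici_subset_Ici.2 hs.1)) h₀
    (fun s hs => (hB s hs.1).continuousWithinAt.mono Icc_subset_Ici_self)
    (fun s hs => (hB s hs.1).mono (Ici_subset_Ici.2 hs.1)) (fun s hs => h s hs.1)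
    (right_mem_Icc.2 ht)

theorem norm_le_of_hasDerivWithinAt_le {E : Type*} [NormedAddCommGroup E] [NormedSpace ℝ E]
    {f f' : ℝ → E} {B B' : ℝ → ℝ} {t₀ : ℝ}
    (hf : ∀ t, t₀ ≤ t → HasDerivWithinAt f (f' t) (Ici t₀) t)
    (hB : ∀ t, t₀ ≤ t → HasDerivWithinAt B (B' t) (Ici t₀) t)
    (h₀ : ‖f t₀‖ ≤ B t₀) (h : ∀ t, t₀ ≤ t → ‖f' t‖ ≤ B' t) : ∀ t, t₀ ≤ t → ‖f t‖ ≤ B t := by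
  intro t ht
  refine image_norm_le_of_norm_deriv_right_le_deriv_boundary' (a := t₀) (b := t)
    (fun s hs => (hf s hs.1).continuousWithinAt.mono Icc_subset_Ici_self)
    (fun s hs => (hf s hs.1).mono (Ici_subset_Ici.2 hs.1)) h₀
    (fun s hs => (hB s hs.1).continuousWithinAt.mono Icc_subset_Ici_self)
    (fun s hs => (hB s hs.1).mono (Ici_subset_Ici.2 hs.1)) (fun s hs => h s hs.1)
    (right_mem_Icc.2 ht)

theorem eq_of_hasDerivWithinAt_zero {E : Type*} [NormedAddCommGroup E] [NormedSpace ℝ E]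
    {f : ℝ → E} {t₀ : ℝ} (hf : ∀ t, t₀ ≤ t → HasDerivWithinAt f 0 (Ici t₀) t) :
    ∀ t, t₀ ≤ t → f t = f t₀ := by
  intro t ht
  exact constant_of_has_deriv_right_zero (a := t₀) (b := t)
    (fun s hs => (hf s hs.1).continuousWithinAt.mono Icc_subset_Ici_self)
    (fun s hs => (hf s hs.1).mono (Ici_subset_Ici.2 hs.1)) t (right_mem_Icc.2 ht)

theorem norm_sub_le_of_norm_deriv_le {E : Type*} [NormedAddCommGroup E] [NormedSpace ℝ E]
    {f f' : ℝ → E} {C t₀ s t : ℝ} (hf : ∀ t, t₀ ≤ t → HasDerivWithinAt f (f' t) (Ici t₀) t)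
    (hs : t₀ ≤ s) (hst : s ≤ t) (h : ∀ r, s ≤ r → r ≤ t → ‖f' r‖ ≤ C) :
    ‖f t - f s‖ ≤ C * (t - s) :=
  norm_image_sub_le_of_norm_deriv_right_le_segment
    (fun r hr => (hf r (hs.trans hr.1)).continuousWithinAt.mono
      (Icc_subset_Ici_self.trans (Ici_subset_Ici.2 hs)))
    (fun r hr => (hf r (hs.trans hr.1)).mono (Ici_subset_Ici.2 (hs.trans hr.1)))
    (fun r hr => h r hr.1 hr.2.le) t (right_mem_Icc.2 hst)

theorem hasDerivAt_exp_mul_sub (m t₀ t : ℝ) :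
    HasDerivAt (fun s => Real.exp (m * (s - t₀))) (Real.exp (m * (t - t₀)) * m) t := by
  simpa using (((hasDerivAt_id t).sub_const t₀).const_mul m).exp

/-- A Gronwall inequality with integrable coefficients. -/
theorem le_mul_exp_of_deriv_le {f f' : ℝ → ℝ} {α β k t₀ : ℝ} (hk : 0 < k) (hα : 0 ≤ α)
    (hβ : 0 ≤ β) (hf : ∀ t, t₀ ≤ t → HasDerivWithinAt f (f' t) (Ici t₀) t) (h₀ : 0 ≤ f t₀)
    (h : ∀ t, t₀ ≤ t → f' t ≤ α * Real.exp (-k * (t - t₀)) * f t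
      + β * Real.exp (-k * (t - t₀))) :
    ∀ t, t₀ ≤ t → f t ≤ (f t₀ + β / k) * Real.exp (α / k) := by
  -- Integrating factor: `α / k * (1 - exp (-k (t - t₀)))` is the integral of the coefficient `α exp
  -- (-k (s - t₀))`, hence at most `α / k`.
  have hw : ∀ t, HasDerivAt (fun s => Real.exp (-(α / k * (1 - Real.exp (-k * (s - t₀))))))
      (Real.exp (-(α / k * (1 - Real.exp (-k * (t - t₀))))) * -(α * Real.exp (-k * (t - t₀)))) t := by
    intro t
    refine ((((hasDerivAt_exp_mul_sub (-k) t₀ t).const_sub 1).const_mul (α / k)).fun_neg).exp.congr_deriv ?_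
    field_simp
  have hb : ∀ t, HasDerivAt (fun s => f t₀ + β / k * (1 - Real.exp (-k * (s - t₀))))
      (β * Real.exp (-k * (t - t₀))) t := by
    intro t
    refine ((((hasDerivAt_exp_mul_sub (-k) t₀ t).const_sub 1).const_mul (β / k)).const_add
      (f t₀)).congr_deriv ?_
    field_simp
  have hpos : ∀ t, t₀ ≤ t → 0 ≤ 1 - Real.exp (-k * (t - t₀)) := fun t ht => by
    rw [sub_nonneg, Real.exp_le_one_iff]; nlinarith
  have key := le_of_hasDerivWithinAt_le (fun t ht => (hf t ht).fun_mul (hw t).hasDerivWithinAt)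
    (fun t _ => (hb t).hasDerivWithinAt) (by simp) (fun t ht => by
      have hE : Real.exp (-(α / k * (1 - Real.exp (-k * (t - t₀))))) ≤ 1 := by
        rw [Real.exp_le_one_iff, neg_nonpos]
        exact mul_nonneg (by positivity) (hpos t ht)
      have hE0 := (Real.exp_pos (-(α / k * (1 - Real.exp (-k * (t - t₀)))))).le
      have h1 := mul_le_mul_of_nonneg_right (h t ht) hE0
      have h2 : 0 ≤ β * Real.exp (-k * (t - t₀)) := by positivity
      nlinarith [mul_le_mul_of_nonneg_left hE h2])
  intro t ht
  have h1 := key t ht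
  have hA : f t * Real.exp (-(α / k * (1 - Real.exp (-k * (t - t₀))))) ≤ f t₀ + β / k := by
    refine h1.trans ?_
    have : β / k * (1 - Real.exp (-k * (t - t₀))) ≤ β / k * 1 :=
      mul_le_mul_of_nonneg_left (by linarith [Real.exp_pos (-k * (t - t₀))]) (by positivity)
    linarith
  have hB : f t = f t * Real.exp (-(α / k * (1 - Real.exp (-k * (t - t₀)))))
      * Real.exp (α / k * (1 - Real.exp (-k * (t - t₀)))) := by
    rw [mul_assoc, ← Real.exp_add]; simp
  rw [hB]
  refine mul_le_mul hA (Real.exp_le_exp.2 ?_) (Real.exp_pos _).le (by positivity)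
  have : α / k * (1 - Real.exp (-k * (t - t₀))) ≤ α / k * 1 :=
      mul_le_mul_of_nonneg_left (by linarith [Real.exp_pos (-k * (t - t₀))]) (by positivity)
  linarith

/-- Exponential decay under an exponentially decaying forcing. -/
theorem le_exp_mul_of_deriv_le {W W' : ℝ → ℝ} {ν β k t₀ : ℝ} (hk : 0 < k) (hν : ν ≤ k)
    (hβ : 0 ≤ β) (hW : ∀ t, t₀ ≤ t → HasDerivWithinAt W (W' t) (Ici t₀) t)
    (h : ∀ t, t₀ ≤ t → W' t ≤ -ν * W t + β * Real.exp (-(2 * k) * (t - t₀))) :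
    ∀ t, t₀ ≤ t → W t ≤ Real.exp (-ν * (t - t₀)) * (W t₀ + β / k) := by
  have hb : ∀ t, HasDerivAt (fun s => W t₀ + β / k * (1 - Real.exp (-k * (s - t₀))))
      (β * Real.exp (-k * (t - t₀))) t := by
    intro t
    refine ((((hasDerivAt_exp_mul_sub (-k) t₀ t).const_sub 1).const_mul (β / k)).const_add
      (W t₀)).congr_deriv ?_
    field_simp
  -- Multiplying by `exp (ν (t - t₀))` removes the damping; as `ν ≤ k`, the forcing at rate `2k`
  -- still decays at rate `k` and integrates to at most `β / k`.
  have key := le_of_hasDerivWithinAt_le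
    (fun t ht => (hW t ht).fun_mul (hasDerivAt_exp_mul_sub ν t₀ t).hasDerivWithinAt)
    (fun t _ => (hb t).hasDerivWithinAt) (by simp) (fun t ht => by
      have h1 := mul_le_mul_of_nonneg_right (h t ht) (Real.exp_pos (ν * (t - t₀))).le
      have h2 : Real.exp (-(2 * k) * (t - t₀)) * Real.exp (ν * (t - t₀))
          ≤ Real.exp (-k * (t - t₀)) := by
        rw [← Real.exp_add]
        apply Real.exp_le_exp.2
        nlinarith [mul_nonneg (sub_nonneg.2 hν) (sub_nonneg.2 ht)]
      nlinarith [mul_le_mul_of_nonneg_left h2 hβ])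
  intro t ht
  have h1 := key t ht
  have hA : W t * Real.exp (ν * (t - t₀)) ≤ W t₀ + β / k := by
    refine h1.trans ?_
    have : β / k * (1 - Real.exp (-k * (t - t₀))) ≤ β / k * 1 :=
      mul_le_mul_of_nonneg_left (by linarith [Real.exp_pos (-k * (t - t₀))]) (by positivity)
    linarith
  calc W t = Real.exp (-ν * (t - t₀)) * (W t * Real.exp (ν * (t - t₀))) := by
        rw [mul_comm (W t), ← mul_assoc, ← Real.exp_add]; simp
    _ ≤ _ := mul_le_mul_of_nonneg_left hA (Real.exp_pos _).le

/-- A stable linear filter with bounded input has bounded output. -/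
theorem norm_le_of_filter {E : Type*} [NormedAddCommGroup E] [NormedSpace ℝ E]
    {y f : ℝ → E} {k C t₀ : ℝ} (hk : 0 < k) 
    (hy : ∀ t, t₀ ≤ t → HasDerivWithinAt y (-k • y t + f t) (Ici t₀) t)
    (hf : ∀ t, t₀ ≤ t → ‖f t‖ ≤ C) : ∀ t, t₀ ≤ t → ‖y t‖ ≤ ‖y t₀‖ + C / k := by
  have hC : 0 ≤ C := (norm_nonneg _).trans (hf t₀ le_rfl)
  have hb : ∀ t, HasDerivAt (fun s => ‖y t₀‖ + C / k * (Real.exp (k * (s - t₀)) - 1))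
      (C * Real.exp (k * (t - t₀))) t := by
    intro t
    refine ((((hasDerivAt_exp_mul_sub k t₀ t).sub_const 1).const_mul (C / k)).const_add
      (‖y t₀‖)).congr_deriv ?_
    field_simp
  have key := norm_le_of_hasDerivWithinAt_le
    (fun t ht => (hasDerivAt_exp_mul_sub k t₀ t).hasDerivWithinAt.fun_smul (hy t ht))
    (fun t _ => (hb t).hasDerivWithinAt) (by simp) (fun t ht => by
      have : Real.exp (k * (t - t₀)) • (-k • y t + f t) + (Real.exp (k * (t - t₀)) * k) • y t
          = Real.exp (k * (t - t₀)) • f t := by module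
      rw [this, norm_smul, Real.norm_eq_abs, abs_of_pos (Real.exp_pos _), mul_comm C]
      exact mul_le_mul_of_nonneg_left (hf t ht) (Real.exp_pos _).le)
  intro t ht
  have h1 := key t ht
  simp only [norm_smul, Real.norm_eq_abs, abs_of_pos (Real.exp_pos _)] at h1
  have hE : 1 ≤ Real.exp (k * (t - t₀)) := Real.one_le_exp (mul_nonneg hk.le (sub_nonneg.2 ht))
  have hCk : 0 ≤ C / k := by positivity
  have : Real.exp (k * (t - t₀)) * ‖y t‖ ≤ Real.exp (k * (t - t₀)) * (‖y t₀‖ + C / k) := by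
    nlinarith [norm_nonneg (y t₀)]
  exact le_of_mul_le_mul_left this (Real.exp_pos _)

theorem eq_exp_smul_of_hasDerivWithinAt {E : Type*} [NormedAddCommGroup E] [NormedSpace ℝ E]
    {y : ℝ → E} {k t₀ : ℝ} (hy : ∀ t, t₀ ≤ t → HasDerivWithinAt y (-k • y t) (Ici t₀) t) :
    ∀ t, t₀ ≤ t → y t = Real.exp (-k * (t - t₀)) • y t₀ := by
  have key := eq_of_hasDerivWithinAt_zero (t₀ := t₀)
    (f := fun t => Real.exp (k * (t - t₀)) • y t) (fun t ht => by
      refine ((hasDerivAt_exp_mul_sub k t₀ t).hasDerivWithinAt.fun_smul (hy t ht)).congr_deriv ?_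
      module)
  intro t ht
  have h1 := key t ht
  simp only [sub_self, mul_zero, Real.exp_zero, one_smul] at h1
  rw [← h1, smul_smul, ← Real.exp_add]
  simp

/-- Global existence for ordinary differential equations with a uniformly Lipschitz right-hand
side. -/
theorem exists_global_solution {E : Type*} [NormedAddCommGroup E] [NormedSpace ℝ E]
    [CompleteSpace E] {F : ℝ → E → E} {t₀ : ℝ} {K : NNReal} {C : ℝ}
    (hc : ∀ y, ContinuousOn (fun t => F t y) (Ici t₀)) (hL : ∀ t, t₀ ≤ t → LipschitzWith K (F t))
    (hb : ∀ t, t₀ ≤ t → ‖F t 0‖ ≤ C) (y₀ : E) :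
    ∃ y : ℝ → E, y t₀ = y₀ ∧ ∀ t, t₀ ≤ t → HasDerivWithinAt y (F t (y t)) (Ici t₀) t := by
  have hC : 0 ≤ C := (norm_nonneg _).trans (hb t₀ le_rfl)
  -- Freezing the field before `t₀` makes it continuous on the whole line, so that the fixed point
  -- can be sought among bounded continuous functions on `ℝ`.
  set σ : ℝ → ℝ := fun t => max t t₀ with hσ
  have hσc : Continuous σ := continuous_id.max continuous_const
  have hσle : ∀ t, t₀ ≤ σ t := fun t => le_max_right _ _
  have hσeq : ∀ t, t₀ ≤ t → σ t = t := fun t ht => max_eq_left ht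
  set G : ℝ → E → E := fun t => F (σ t) with hG
  have hGc : Continuous fun p : ℝ × E => G p.1 p.2 :=
    continuous_prod_of_continuous_lipschitzWith' _ K (fun t => hL _ (hσle t))
      (fun y => (hc y).comp_continuous hσc hσle)
  -- Exponential weight: the unknown is `u = y / w`. The Picard map in this variable has Lipschitz
  -- constant at most `K / m ≤ 1 / 2`, so one contraction covers the whole half-line.
  set m : ℝ := 2 * K + 1 with hm
  have hm0 : 0 < m := by positivity
  set w : ℝ → ℝ := fun s => Real.exp (m * (s - t₀)) with hw
  have hwc : Continuous w := by fun_prop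
  have hw1 : ∀ s, t₀ ≤ s → 1 ≤ w s := fun s hs =>
    Real.one_le_exp (mul_nonneg hm0.le (sub_nonneg.2 hs))
  have hGb : ∀ t y, ‖G t y‖ ≤ C + K * ‖y‖ := fun t y => by
    have h1 := (hL (σ t) (hσle t)).dist_le_mul y 0
    rw [dist_eq_norm, dist_zero_right] at h1
    calc ‖G t y‖ = ‖(F (σ t) y - F (σ t) 0) + F (σ t) 0‖ := by simp [hG]
      _ ≤ _ := norm_add_le _ _
      _ ≤ _ := by linarith [hb (σ t) (hσle t)]
  have hint : ∀ a t, t₀ ≤ t → 0 ≤ a → ∫ s in t₀..t, a * w s ≤ a * (w t / m) := by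
    intro a t ht ha
    have hd : ∀ s ∈ uIcc t₀ t, HasDerivAt (fun s => a * (w s / m)) (a * w s) s := fun s _ => by
      refine (((hasDerivAt_exp_mul_sub m t₀ s).div_const m).const_mul a).congr_deriv ?_
      simp only [hw]; field_simp
    rw [intervalIntegral.integral_eq_sub_of_hasDerivAt hd
      ((continuous_const.mul hwc).intervalIntegrable _ _)]
    have : 0 ≤ a * (w t₀ / m) := by positivity
    linarith
  have hcu : ∀ u : ℝ → E, Continuous u → Continuous fun s => G s (w s • u s) := fun u hu =>
    hGc.comp (continuous_id.prodMk (hwc.smul hu))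
  have hwpos : ∀ s, 0 < w s := fun s => Real.exp_pos _
  set J : (ℝ → E) → ℝ → E := fun u t => ∫ s in t₀..t, G s (w s • u s) with hJ
  have hJc : ∀ u : ℝ → E, Continuous u → Continuous (J u) := fun u hu =>
    intervalIntegral.continuous_primitive (fun _ _ => (hcu u hu).intervalIntegrable _ _) _
  set T₀ : (ℝ → E) → ℝ → E := fun u t => (w (σ t))⁻¹ • (y₀ + J u (σ t)) with hT₀
  have hTc : ∀ u : ℝ → E, Continuous u → Continuous (T₀ u) := fun u hu =>
    ((hwc.comp hσc).inv₀ fun t => (hwpos _).ne').smul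
      (continuous_const.add ((hJc u hu).comp hσc))
  have hTb : ∀ (u : ℝ → E) (B : ℝ), (∀ t, ‖u t‖ ≤ B) →
      ∀ t, ‖T₀ u t‖ ≤ ‖y₀‖ + (C + K * B) / m := by
    intro u B hB t
    have hB0 : 0 ≤ B := (norm_nonneg _).trans (hB t)
    have h1 : ‖J u (σ t)‖ ≤ (C + K * B) * (w (σ t) / m) := by
      refine (intervalIntegral.norm_integral_le_of_norm_le (hσle t) (ae_of_all _ fun s hs => ?_)
        ((continuous_const.fun_mul hwc).intervalIntegrable _ _)).trans
        (hint (C + K * B) _ (hσle t) (by positivity))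
      refine (hGb _ _).trans ?_
      rw [norm_smul, Real.norm_eq_abs, abs_of_pos (hwpos s)]
      have h2 := hw1 s hs.1.le
      have h3 : (K : ℝ) * (w s * ‖u s‖) ≤ K * (w s * B) := by
        gcongr
        exact hB s
      nlinarith
    simp only [hT₀]
    rw [norm_smul, norm_inv, Real.norm_eq_abs, abs_of_pos (hwpos _)]
    rw [inv_mul_le_iff₀ (hwpos _)]
    refine (norm_add_le _ _).trans ?_
    have h2 := hw1 _ (hσle t)
    have h3 : (C + K * B) * (w (σ t) / m) = w (σ t) * ((C + K * B) / m) := by ring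
    nlinarith [norm_nonneg y₀]
  set T : BoundedContinuousFunction ℝ E → BoundedContinuousFunction ℝ E := fun u =>
    BoundedContinuousFunction.ofNormedAddCommGroup (T₀ u) (hTc u u.continuous) _
      (hTb u ‖u‖ u.norm_coe_le_norm) with hT
  have hcontr : ContractingWith (1 / 2) T := by
    refine ⟨by rw [← NNReal.coe_lt_coe]; push_cast; norm_num, LipschitzWith.of_dist_le_mul fun u u' => ?_⟩
    rw [BoundedContinuousFunction.dist_le (by positivity)]
    intro t
    set D := dist u u' with hD
    have hD0 : 0 ≤ D := dist_nonneg
    have h1 : ‖J u (σ t) - J u' (σ t)‖ ≤ (K * D) * (w (σ t) / m) := by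
      simp only [hJ]
      rw [← intervalIntegral.integral_sub ((hcu u u.continuous).intervalIntegrable _ _)
        ((hcu u' u'.continuous).intervalIntegrable _ _)]
      refine (intervalIntegral.norm_integral_le_of_norm_le (hσle t) (ae_of_all _ fun s hs => ?_)
        ((continuous_const.fun_mul hwc).intervalIntegrable _ _)).trans
        (hint (K * D) _ (hσle t) (by positivity))
      have h2 := (hL (σ s) (hσle s)).dist_le_mul (w s • u s) (w s • u' s)
      rw [dist_eq_norm, dist_eq_norm, ← smul_sub, norm_smul, Real.norm_eq_abs,
        abs_of_pos (hwpos s), ← dist_eq_norm (u s)] at h2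
      refine h2.trans ?_
      have h3 : (K : ℝ) * (w s * dist (u s) (u' s)) ≤ K * (w s * D) := by
        gcongr
        exact BoundedContinuousFunction.dist_coe_le_dist s
      linarith
    change dist (T₀ u t) (T₀ u' t) ≤ _
    simp only [hT₀]
    rw [dist_eq_norm, ← smul_sub, add_sub_add_left_eq_sub, norm_smul, norm_inv, Real.norm_eq_abs,
      abs_of_pos (hwpos _), inv_mul_le_iff₀ (hwpos _)]
    refine h1.trans ?_
    have h4 : (K : ℝ) / m ≤ 1 / 2 := by
      rw [div_le_iff₀ hm0]; linarith
    have h5 : (K * D) * (w (σ t) / m) = (K / m) * (w (σ t) * D) := by ring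
    rw [h5]
    push_cast
    nlinarith [mul_le_mul_of_nonneg_right h4 (mul_nonneg (hwpos (σ t)).le hD0)]
  obtain ⟨u, hu⟩ : ∃ u, T u = u := ⟨_, hcontr.fixedPoint_isFixedPt⟩
  have hu' : ∀ t, u t = T₀ u t := fun t =>
    (congrArg (fun f : BoundedContinuousFunction ℝ E => f t) hu).symm
  have hy : ∀ t, t₀ ≤ t → w t • u t = y₀ + J u t := fun t ht => by
    rw [hu' t]
    simp only [hT₀]
    rw [hσeq t ht, smul_smul, mul_inv_cancel₀ (hwpos t).ne', one_smul]
  refine ⟨fun t => y₀ + J u t, by simp [hJ], fun t ht => ?_⟩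
  have hd : HasDerivAt (J u) (G t (w t • u t)) t :=
    intervalIntegral.integral_hasDerivAt_right ((hcu u u.continuous).intervalIntegrable _ _)
      ((hcu u u.continuous).stronglyMeasurableAtFilter _ _) (hcu u u.continuous).continuousAt
  have h := (hd.const_add y₀).hasDerivWithinAt (s := Ici t₀)
  rw [hy t ht] at h
  simpa [hG, hσeq t ht] using h

end HalfLine

/-! ### Vector algebra -/

section VectorAlgebra

theorem cross_zero (x y : E3) : cross x y 0 = x 1 * y 2 - x 2 * y 1 := by
  simp [cross, cross_apply]

theorem cross_one (x y : E3) : cross x y 1 = x 2 * y 0 - x 0 * y 2 := by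
  simp [cross, cross_apply]

theorem cross_two (x y : E3) : cross x y 2 = x 0 * y 1 - x 1 * y 0 := by
  simp [cross, cross_apply]

theorem act_apply (M : M3) (x : E3) (i : Fin 3) :
    act M x i = M i 0 * x 0 + M i 1 * x 1 + M i 2 * x 2 := by
  simp [act, Matrix.mulVec, dotProduct, Fin.sum_univ_three]

theorem norm_sq_eq_coords (x : E3) : ‖x‖ ^ 2 = x 0 ^ 2 + x 1 ^ 2 + x 2 ^ 2 := by
  rw [EuclideanSpace.norm_sq_eq]; simp [Fin.sum_univ_three]

theorem inner_eq_coords (x y : E3) : inner ℝ x y = x 0 * y 0 + x 1 * y 1 + x 2 * y 2 := by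
  simp [PiLp.inner_apply, Fin.sum_univ_three]; ring

theorem E3.ext {x y : E3} (h0 : x 0 = y 0) (h1 : x 1 = y 1) (h2 : x 2 = y 2) : x = y := by
  ext i; fin_cases i <;> assumption

theorem norm_cross_sq (x y : E3) :
    ‖cross x y‖ ^ 2 = ‖x‖ ^ 2 * ‖y‖ ^ 2 - inner ℝ x y ^ 2 := by
  simp only [norm_sq_eq_coords, inner_eq_coords, cross_zero, cross_one, cross_two]; ring

theorem norm_cross_le (x y : E3) : ‖cross x y‖ ≤ ‖x‖ * ‖y‖ := by
  refine abs_le_of_sq_le_sq' ?_ (by positivity) |>.2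
  rw [norm_cross_sq, mul_pow]; nlinarith [sq_nonneg (inner ℝ x y)]

theorem cross_add_left (x y z : E3) : cross (x + y) z = cross x z + cross y z := by
  apply E3.ext <;> simp only [cross_zero, cross_one, cross_two, PiLp.add_apply] <;> ring

theorem cross_add_right (x y z : E3) : cross x (y + z) = cross x y + cross x z := by
  apply E3.ext <;> simp only [cross_zero, cross_one, cross_two, PiLp.add_apply] <;> ring

theorem cross_smul_left (r : ℝ) (x y : E3) : cross (r • x) y = r • cross x y := by
  apply E3.ext <;>
    simp only [cross_zero, cross_one, cross_two, PiLp.smul_apply, smul_eq_mul] <;> ring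

theorem cross_smul_right (r : ℝ) (x y : E3) : cross x (r • y) = r • cross x y := by
  apply E3.ext <;>
    simp only [cross_zero, cross_one, cross_two, PiLp.smul_apply, smul_eq_mul] <;> ring

theorem cross_sub_right (x y z : E3) : cross x (y - z) = cross x y - cross x z := by
  apply E3.ext <;> simp only [cross_zero, cross_one, cross_two, PiLp.sub_apply] <;> ring

theorem inner_cross_cross (x y : E3) : inner ℝ (cross x (cross x y)) y = -‖cross x y‖ ^ 2 := by
  simp only [norm_sq_eq_coords, inner_eq_coords, cross_zero, cross_one, cross_two]; ring

/-- The cross product as a continuous bilinear map. -/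
noncomputable def crossL : E3 →L[ℝ] E3 →L[ℝ] E3 :=
  LinearMap.mkContinuous₂ (LinearMap.mk₂ ℝ cross cross_add_left cross_smul_left cross_add_right
    cross_smul_right) 1 (fun x y => by simpa using norm_cross_le x y)

theorem crossL_apply (x y : E3) : crossL x y = cross x y := rfl

/-- The squared Euclidean norm of a quaternion with the given scalar and vector parts. -/
noncomputable def normSq (y : ℝ × E3) : ℝ := y.1 ^ 2 + ‖y.2‖ ^ 2

theorem normSq_nonneg (y : ℝ × E3) : 0 ≤ normSq y := by unfold normSq; positivity

theorem normSq_eq_zero {y : ℝ × E3} : normSq y = 0 ↔ y = 0 := by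
  constructor
  · intro h
    have h1 : y.1 ^ 2 = 0 := by unfold normSq at h; nlinarith [sq_nonneg y.1, sq_nonneg ‖y.2‖]
    have h2 : ‖y.2‖ ^ 2 = 0 := by unfold normSq at h; nlinarith [sq_nonneg y.1, sq_nonneg ‖y.2‖]
    exact Prod.ext (by simpa using h1) (by simpa using h2)
  · rintro rfl; simp [normSq]

/-- The quaternion product `e y x` of `y` with two vectors. -/
noncomputable def sandwich (e x : E3) (y : ℝ × E3) : ℝ × E3 :=
  (-(y.1 * inner ℝ e x) - inner ℝ (cross e y.2) x,
    y.1 • cross e x - inner ℝ e y.2 • x + cross (cross e y.2) x)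

/-- Multiplicativity of the quaternion norm; it gives the exact size of the perturbation term. -/
theorem normSq_sandwich (e x : E3) (y : ℝ × E3) :
    normSq (sandwich e x y) = ‖e‖ ^ 2 * ‖x‖ ^ 2 * normSq y := by
  simp only [normSq, sandwich, norm_sq_eq_coords, inner_eq_coords, cross_zero, cross_one,
    cross_two, PiLp.add_apply, PiLp.sub_apply, PiLp.smul_apply, smul_eq_mul]
  ring

theorem sandwich_add (e x : E3) (y y' : ℝ × E3) :
    sandwich e x (y + y') = sandwich e x y + sandwich e x y' := by
  refine Prod.ext ?_ (E3.ext ?_ ?_ ?_) <;>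
  simp only [sandwich, inner_eq_coords, cross_zero, cross_one, Prod.fst_add, Prod.snd_add,
    cross_two, PiLp.add_apply, PiLp.sub_apply, PiLp.smul_apply, smul_eq_mul] <;>
  ring

theorem sandwich_smul (r : ℝ) (e x : E3) (y : ℝ × E3) :
    sandwich e x (r • y) = r • sandwich e x y := by
  refine Prod.ext ?_ (E3.ext ?_ ?_ ?_) <;>
  simp only [sandwich, inner_eq_coords, cross_zero, cross_one, Prod.smul_fst, Prod.smul_snd,
    cross_two, PiLp.add_apply, PiLp.sub_apply, PiLp.smul_apply, smul_eq_mul] <;>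
  ring

theorem sandwich_add_left (e e' x : E3) (y : ℝ × E3) :
    sandwich (e + e') x y = sandwich e x y + sandwich e' x y := by
  refine Prod.ext ?_ (E3.ext ?_ ?_ ?_) <;>
  simp only [sandwich, inner_eq_coords, cross_zero, cross_one, Prod.fst_add, Prod.snd_add,
    cross_two, PiLp.add_apply, PiLp.sub_apply, PiLp.smul_apply, smul_eq_mul] <;>
  ring

/-- The right-hand side of the linear system covering the attitude error. -/
noncomputable def liftField (c : ℝ) (x e : E3) (y : ℝ × E3) : ℝ × E3 :=
  (0, c • cross x (cross x y.2)) + (c / 2) • sandwich e x y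

theorem liftField_add (c : ℝ) (x e : E3) (y y' : ℝ × E3) :
    liftField c x e (y + y') = liftField c x e y + liftField c x e y' := by
  simp only [liftField, sandwich_add, Prod.snd_add, cross_add_right, smul_add]
  ext <;> simp
  ring

theorem liftField_smul (c r : ℝ) (x e : E3) (y : ℝ × E3) :
    liftField c x e (r • y) = r • liftField c x e y := by
  simp only [liftField, sandwich_smul, Prod.smul_snd, cross_smul_right]
  ext <;> (simp; ring)

theorem abs_le_of_normSq_le {y : ℝ × E3} {B : ℝ} (hB : 0 ≤ B) (h : normSq y ≤ B ^ 2) :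
    |y.1| ≤ B ∧ ‖y.2‖ ≤ B := by
  unfold normSq at h
  exact ⟨abs_le_of_sq_le_sq (by nlinarith [sq_nonneg ‖y.2‖]) hB,
    (abs_le_of_sq_le_sq' (by nlinarith [sq_nonneg y.1]) hB).2⟩

theorem norm_le_of_normSq_le {y : ℝ × E3} {B : ℝ} (hB : 0 ≤ B) (h : normSq y ≤ B ^ 2) :
    ‖y‖ ≤ B := by
  obtain ⟨h1, h2⟩ := abs_le_of_normSq_le hB h
  exact max_le (by simpa using h1) h2

/-- The product norm on `ℝ × E3` is the maximum of the two norms, so it is only equivalent to the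
square root of `normSq`. -/
theorem normSq_le_norm_sq (y : ℝ × E3) : normSq y ≤ 2 * ‖y‖ ^ 2 := by
  have h1 : |y.1| ≤ ‖y‖ := by simpa using norm_fst_le y
  have h2 : ‖y.2‖ ≤ ‖y‖ := norm_snd_le y
  have h3 : y.1 ^ 2 ≤ ‖y‖ ^ 2 := by rw [← sq_abs]; gcongr
  have h4 : ‖y.2‖ ^ 2 ≤ ‖y‖ ^ 2 := by gcongr
  unfold normSq; linarith

theorem norm_sandwich_le (e x : E3) (y : ℝ × E3) : ‖sandwich e x y‖ ≤ 2 * ‖e‖ * ‖x‖ * ‖y‖ := by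
  refine norm_le_of_normSq_le (by positivity) ?_
  rw [normSq_sandwich]
  have h : ‖e‖ ^ 2 * ‖x‖ ^ 2 * normSq y ≤ ‖e‖ ^ 2 * ‖x‖ ^ 2 * (2 * ‖y‖ ^ 2) := by
    gcongr
    exact normSq_le_norm_sq y
  nlinarith [sq_nonneg (‖e‖ * ‖x‖ * ‖y‖)]

theorem norm_liftField_le {c : ℝ} (hc : 0 < c) (x e : E3) (y : ℝ × E3) :
    ‖liftField c x e y‖ ≤ c * (‖x‖ ^ 2 + ‖e‖ * ‖x‖) * ‖y‖ := by
  have h1 : ‖((0 : ℝ), c • cross x (cross x y.2))‖ ≤ c * ‖x‖ ^ 2 * ‖y‖ := by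
    refine max_le (by simpa using by positivity) ?_
    rw [norm_smul, Real.norm_eq_abs, abs_of_pos hc]
    calc c * ‖cross x (cross x y.2)‖ ≤ c * (‖x‖ * (‖x‖ * ‖y‖)) := by
          gcongr
          refine (norm_cross_le _ _).trans ?_
          gcongr
          refine (norm_cross_le _ _).trans ?_
          gcongr
          exact norm_snd_le y
      _ = _ := by ring
  have h2 : ‖(c / 2) • sandwich e x y‖ ≤ c / 2 * (2 * ‖e‖ * ‖x‖ * ‖y‖) := by
    rw [norm_smul, Real.norm_eq_abs, abs_of_pos (by positivity)]
    gcongr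
    exact norm_sandwich_le e x y
  calc _ ≤ _ := norm_add_le _ _
    _ ≤ _ := add_le_add h1 h2
    _ = _ := by ring

theorem continuous_cross : Continuous fun p : E3 × E3 => cross p.1 p.2 := by
  have := crossL.continuous₂
  exact this

theorem continuousOn_cross {f g : ℝ → E3} {s : Set ℝ} (hf : ContinuousOn f s)
    (hg : ContinuousOn g s) : ContinuousOn (fun t => cross (f t) (g t)) s :=
  continuous_cross.comp_continuousOn (hf.prodMk hg)

theorem continuousOn_liftField (c : ℝ) {f g : ℝ → E3} {s : Set ℝ} (hf : ContinuousOn f s)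
    (hg : ContinuousOn g s) (y : ℝ × E3) :
    ContinuousOn (fun t => liftField c (f t) (g t) y) s := by
  have h1 : ContinuousOn (fun t => cross (f t) (cross (f t) y.2)) s :=
    continuousOn_cross hf (continuousOn_cross hf continuousOn_const)
  have h2 := continuousOn_cross hg (continuousOn_const (c := y.2))
  have h3 := continuousOn_cross hg hf
  have h4 := continuousOn_cross h2 hf
  have h5 : ContinuousOn (fun t => inner ℝ (g t) (f t)) s := hg.inner hf
  have h6 : ContinuousOn (fun t => inner ℝ (g t) y.2) s := hg.inner continuousOn_const
  have h7 : ContinuousOn (fun t => inner ℝ (cross (g t) y.2) (f t)) s := h2.inner hf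
  unfold liftField sandwich
  exact (continuousOn_const.prodMk (h1.const_smul c)).add
    ((((continuousOn_const.mul h5).neg.sub h7).prodMk
      (((h3.const_smul y.1).sub (h6.smul hf)).add h4)).const_smul (c / 2))

end VectorAlgebra

/-! ### The linear system -/

section LinearSystem

/-- `y` solves the linear system driven by the signal `x` and by a perturbation decaying at the
rate `k` from its value `e₀` at time `t₀`. -/
def IsLift (c k : ℝ) (x : ℝ → E3) (t₀ : ℝ) (e₀ : E3) (y : ℝ → ℝ × E3) : Prop :=
  ∀ t, t₀ ≤ t →
    HasDerivWithinAt y (liftField c (x t) (Real.exp (-k * (t - t₀)) • e₀) (y t)) (Ici t₀) t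

variable {c k X t₀ : ℝ} {x : ℝ → E3} {e₀ : E3} {y y' : ℝ → ℝ × E3}

theorem IsLift.add (h : IsLift c k x t₀ e₀ y) (h' : IsLift c k x t₀ e₀ y') :
    IsLift c k x t₀ e₀ (fun t => y t + y' t) := fun t ht => by
  rw [liftField_add]; exact (h t ht).fun_add (h' t ht)

theorem IsLift.smul (r : ℝ) (h : IsLift c k x t₀ e₀ y) :
    IsLift c k x t₀ e₀ (fun t => r • y t) := fun t ht => by
  rw [liftField_smul]; exact (h t ht).fun_const_smul r

/-- Restarting at `t₁` replaces `e₀` by its decayed value, which turns bounds at the initial time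
into tail bounds. -/
theorem IsLift.shift (h : IsLift c k x t₀ e₀ y) {t₁ : ℝ} (h₁ : t₀ ≤ t₁) :
    IsLift c k x t₁ (Real.exp (-k * (t₁ - t₀)) • e₀) y := fun t ht => by
  have h2 : Real.exp (-k * (t - t₁)) • Real.exp (-k * (t₁ - t₀)) • e₀
      = Real.exp (-k * (t - t₀)) • e₀ := by
    rw [smul_smul, ← Real.exp_add]; ring_nf
  rw [h2]
  exact (h t (h₁.trans ht)).mono (Ici_subset_Ici.2 h₁)

theorem exists_isLift (hc : 0 < c) (hk : 0 < k) (hxc : ContinuousOn x (Ici 0))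
    (hX : ∀ t, 0 ≤ t → ‖x t‖ ≤ X) (ht₀ : 0 ≤ t₀) (e₀ : E3) (y₀ : ℝ × E3) :
    ∃ y, y t₀ = y₀ ∧ IsLift c k x t₀ e₀ y := by
  have hX0 : 0 ≤ X := (norm_nonneg _).trans (hX 0 le_rfl)
  refine exists_global_solution
    (F := fun t y => liftField c (x t) (Real.exp (-k * (t - t₀)) • e₀) y)
    (K := Real.toNNReal (c * (X ^ 2 + ‖e₀‖ * X))) (C := 0)
    (fun y => continuousOn_liftField c (hxc.mono (Ici_subset_Ici.2 ht₀))
      (Continuous.continuousOn (by fun_prop)) y)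
    (fun t ht => LipschitzWith.of_dist_le_mul fun y y' => ?_) (fun t ht => ?_) y₀
  · have hsub : liftField c (x t) (Real.exp (-k * (t - t₀)) • e₀) y
        - liftField c (x t) (Real.exp (-k * (t - t₀)) • e₀) y'
        = liftField c (x t) (Real.exp (-k * (t - t₀)) • e₀) (y - y') := by
      rw [sub_eq_add_neg y, ← neg_one_smul ℝ y', liftField_add, liftField_smul]; module
    rw [dist_eq_norm, hsub, dist_eq_norm, Real.coe_toNNReal _ (by positivity)]
    refine (norm_liftField_le hc _ _ _).trans ?_
    have h1 : ‖Real.exp (-k * (t - t₀)) • e₀‖ ≤ ‖e₀‖ := by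
      rw [norm_smul, Real.norm_eq_abs, abs_of_pos (Real.exp_pos _)]
      have : Real.exp (-k * (t - t₀)) ≤ 1 := by rw [Real.exp_le_one_iff]; nlinarith
      nlinarith [norm_nonneg e₀]
    have h2 := hX t (ht₀.trans ht)
    gcongr
  · have : liftField c (x t) (Real.exp (-k * (t - t₀)) • e₀) 0 = 0 := by
      simpa using liftField_smul c 0 (x t) (Real.exp (-k * (t - t₀)) • e₀) 0
    exact (by rw [this, norm_zero] : ‖liftField c (x t) (Real.exp (-k * (t - t₀)) • e₀) 0‖ = 0).le

theorem hasDerivWithinAt_normSq {y : ℝ → ℝ × E3} {y' : ℝ × E3} {s : Set ℝ} {t : ℝ}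
    (h : HasDerivWithinAt y y' s t) :
    HasDerivWithinAt (fun t => normSq (y t)) (2 * ((y t).1 * y'.1 + inner ℝ (y t).2 y'.2)) s t := by
  have h1 : HasDerivWithinAt (fun t => (y t).1) y'.1 s t := h.fst
  have h2 : HasDerivWithinAt (fun t => (y t).2) y'.2 s t := h.snd
  refine ((h1.fun_pow 2).fun_add h2.norm_sq).congr_deriv ?_
  ring

theorem abs_dot_le (y y' : ℝ × E3) :
    |y.1 * y'.1 + inner ℝ y.2 y'.2| ≤ Real.sqrt (normSq y) * Real.sqrt (normSq y') := by
  rw [← Real.sqrt_mul (normSq_nonneg y)]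
  apply Real.abs_le_sqrt
  have h := abs_real_inner_le_norm y.2 y'.2
  have h2 : inner ℝ y.2 y'.2 ^ 2 ≤ ‖y.2‖ ^ 2 * ‖y'.2‖ ^ 2 := by
    rw [← mul_pow, ← sq_abs]; gcongr
  have h3 : 2 * (y.1 * y'.1) * inner ℝ y.2 y'.2 ≤ y.1 ^ 2 * ‖y'.2‖ ^ 2 + y'.1 ^ 2 * ‖y.2‖ ^ 2 := by
    have h4 : (y.1 * y'.1) * inner ℝ y.2 y'.2 ≤ |y.1 * y'.1| * (‖y.2‖ * ‖y'.2‖) :=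
      (le_abs_self _).trans (by rw [abs_mul]; gcongr)
    rw [abs_mul] at h4
    nlinarith [sq_nonneg (|y.1| * ‖y'.2‖ - |y'.1| * ‖y.2‖), sq_abs y.1, sq_abs y'.1]
  unfold normSq; nlinarith

theorem sqrt_normSq_sandwich (e x : E3) (y : ℝ × E3) :
    Real.sqrt (normSq (sandwich e x y)) = ‖e‖ * ‖x‖ * Real.sqrt (normSq y) := by
  rw [normSq_sandwich, Real.sqrt_mul (by positivity), ← mul_pow, Real.sqrt_sq (by positivity)]

/-- The term `x × (x × ·)` is negative semidefinite, so `normSq` can grow only through the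
perturbation, whose total effect is bounded. -/
theorem dot_liftField (c : ℝ) (x e : E3) (y : ℝ × E3) :
    2 * (y.1 * (liftField c x e y).1 + inner ℝ y.2 (liftField c x e y).2)
      = -(2 * c * ‖cross x y.2‖ ^ 2)
        + c * (y.1 * (sandwich e x y).1 + inner ℝ y.2 (sandwich e x y).2) := by
  have h := inner_cross_cross x y.2
  rw [real_inner_comm] at h
  simp only [liftField, Prod.fst_add, Prod.snd_add, Prod.smul_fst, Prod.smul_snd, inner_add_right,
    inner_smul_right, h, smul_eq_mul]
  ring

theorem abs_dot_sandwich_le (e x : E3) (y y' : ℝ × E3) :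
    |y.1 * (sandwich e x y').1 + inner ℝ y.2 (sandwich e x y').2|
      ≤ ‖e‖ * ‖x‖ * (Real.sqrt (normSq y) * Real.sqrt (normSq y')) := by
  refine (abs_dot_le _ _).trans (le_of_eq ?_)
  rw [sqrt_normSq_sandwich]; ring

theorem norm_exp_smul (k t t₀ : ℝ) (e₀ : E3) :
    ‖Real.exp (-k * (t - t₀)) • e₀‖ = Real.exp (-k * (t - t₀)) * ‖e₀‖ := by
  rw [norm_smul, Real.norm_eq_abs, abs_of_pos (Real.exp_pos _)]

theorem norm_exp_smul_le (hk : 0 < k) {t : ℝ} (ht : t₀ ≤ t) (e₀ : E3) :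
    ‖Real.exp (-k * (t - t₀)) • e₀‖ ≤ ‖e₀‖ := by
  rw [norm_exp_smul]
  have : Real.exp (-k * (t - t₀)) ≤ 1 := by rw [Real.exp_le_one_iff]; nlinarith
  nlinarith [norm_nonneg e₀]

/-- Continuous dependence on the perturbation. -/
theorem IsLift.normSq_sub_le (hc : 0 < c) (hk : 0 < k) (hX : ∀ t, 0 ≤ t → ‖x t‖ ≤ X)
    (ht₀ : 0 ≤ t₀) {e₁ : E3} {D : ℝ} (h : IsLift c k x t₀ e₀ y) (h' : IsLift c k x t₀ e₁ y')
    (hD : ∀ t, t₀ ≤ t → normSq (y' t) ≤ D) {t : ℝ} (ht : t₀ ≤ t) :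
    normSq (y t - y' t) ≤ (normSq (y t₀ - y' t₀) + c * X * ‖e₀ - e₁‖ * D / k)
      * Real.exp (c * X * (‖e₀‖ + ‖e₀ - e₁‖) / k) := by
  have hX0 : 0 ≤ X := (norm_nonneg _).trans (hX 0 le_rfl)
  have hD0 : 0 ≤ D := (normSq_nonneg _).trans (hD t₀ le_rfl)
  have hd : ∀ t, t₀ ≤ t → HasDerivWithinAt (fun t => normSq (y t - y' t)) _ (Ici t₀) t :=
    fun t ht => hasDerivWithinAt_normSq ((h t ht).fun_sub (h' t ht))
  refine le_mul_exp_of_deriv_le hk (by positivity) (by positivity) hd (normSq_nonneg _) ?_ t ht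
  intro t ht
  set E := Real.exp (-k * (t - t₀)) with hE
  have hEpos : 0 < E := Real.exp_pos _
  have hxt := hX t (ht₀.trans ht)
  set d := y t - y' t with hdd
  -- By bilinearity the difference `d` solves the equation with perturbation `e₀`, plus a source
  -- made of `e₀ - e₁` and `y'`.
  have hfield : liftField c (x t) (E • e₀) (y t) - liftField c (x t) (E • e₁) (y' t)
      = liftField c (x t) (E • e₀) d + (c / 2) • sandwich (E • (e₀ - e₁)) (x t) (y' t) := by
    have h1 : y t = d + y' t := by simp [hdd]
    have h2 : E • e₀ = E • (e₀ - e₁) + E • e₁ := by module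
    rw [h1, liftField_add]
    have h3 : liftField c (x t) (E • e₀) (y' t) = liftField c (x t) (E • e₁) (y' t)
        + (c / 2) • sandwich (E • (e₀ - e₁)) (x t) (y' t) := by
      conv_lhs => rw [h2]
      simp only [liftField, sandwich_add_left]
      module
    rw [h3]; abel
  rw [hfield]
  have h4 := dot_liftField c (x t) (E • e₀) d
  have h5 : (d.1 * (liftField c (x t) (E • e₀) d
        + (c / 2) • sandwich (E • (e₀ - e₁)) (x t) (y' t)).1
      + inner ℝ d.2 (liftField c (x t) (E • e₀) d
        + (c / 2) • sandwich (E • (e₀ - e₁)) (x t) (y' t)).2)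
      = (d.1 * (liftField c (x t) (E • e₀) d).1 + inner ℝ d.2 (liftField c (x t) (E • e₀) d).2)
        + (c / 2) * (d.1 * (sandwich (E • (e₀ - e₁)) (x t) (y' t)).1
          + inner ℝ d.2 (sandwich (E • (e₀ - e₁)) (x t) (y' t)).2) := by
    simp only [Prod.fst_add, Prod.snd_add, Prod.smul_fst, Prod.smul_snd, inner_add_right,
      inner_smul_right, smul_eq_mul]
    ring
  rw [h5, mul_add, h4]
  have h6 := (le_abs_self _).trans (abs_dot_sandwich_le (E • e₀) (x t) d d)
  have h7 := (le_abs_self _).trans (abs_dot_sandwich_le (E • (e₀ - e₁)) (x t) d (y' t))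
  rw [Real.mul_self_sqrt (normSq_nonneg _)] at h6
  -- Makes the source term affine in `normSq d`, as the Gronwall inequality requires.
  have h8 : Real.sqrt (normSq d) * Real.sqrt (normSq (y' t)) ≤ normSq d + D := by
    have := hD t ht
    nlinarith [sq_nonneg (Real.sqrt (normSq d) - Real.sqrt (normSq (y' t))),
      Real.sq_sqrt (normSq_nonneg d), Real.sq_sqrt (normSq_nonneg (y' t)), normSq_nonneg d]
  have hn1 : ‖E • e₀‖ * ‖x t‖ ≤ E * ‖e₀‖ * X := by
    rw [hE, norm_exp_smul]; gcongr
  have hn2 : ‖E • (e₀ - e₁)‖ * ‖x t‖ ≤ E * ‖e₀ - e₁‖ * X := by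
    rw [hE, norm_exp_smul]; gcongr
  have h9 : ‖E • e₀‖ * ‖x t‖ * normSq d ≤ E * ‖e₀‖ * X * normSq d :=
    mul_le_mul_of_nonneg_right hn1 (normSq_nonneg _)
  have h10 : ‖E • (e₀ - e₁)‖ * ‖x t‖ * (Real.sqrt (normSq d) * Real.sqrt (normSq (y' t)))
      ≤ E * ‖e₀ - e₁‖ * X * (normSq d + D) := by
    gcongr
  have h11 := mul_le_mul_of_nonneg_left (h6.trans h9) hc.le
  have h12 := mul_le_mul_of_nonneg_left (h7.trans h10) hc.le
  nlinarith [sq_nonneg ‖cross (x t) d.2‖, mul_nonneg hc.le (sq_nonneg ‖cross (x t) d.2‖)]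

theorem isLift_zero : IsLift c k x t₀ e₀ (fun _ => 0) := fun t _ => by
  have : liftField c (x t) (Real.exp (-k * (t - t₀)) • e₀) 0 = 0 := by
    simpa using liftField_smul c 0 (x t) (Real.exp (-k * (t - t₀)) • e₀) 0
  rw [this]; exact hasDerivWithinAt_const _ _ _

/-- Continuous dependence, applied to the zero solution with the same perturbation. -/
theorem IsLift.normSq_le (hc : 0 < c) (hk : 0 < k) (hX : ∀ t, 0 ≤ t → ‖x t‖ ≤ X)
    (ht₀ : 0 ≤ t₀) (h : IsLift c k x t₀ e₀ y) {t : ℝ} (ht : t₀ ≤ t) :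
    normSq (y t) ≤ normSq (y t₀) * Real.exp (c * X * ‖e₀‖ / k) := by
  have := h.normSq_sub_le hc hk hX ht₀ (e₁ := e₀) (isLift_zero) (D := 0)
    (fun t _ => by simp [normSq]) ht
  simpa using this

theorem IsLift.eq_of_eq (hc : 0 < c) (hk : 0 < k) (hX : ∀ t, 0 ≤ t → ‖x t‖ ≤ X)
    (ht₀ : 0 ≤ t₀) (h : IsLift c k x t₀ e₀ y) (h' : IsLift c k x t₀ e₀ y')
    (h₀ : y t₀ = y' t₀) {t : ℝ} (ht : t₀ ≤ t) : y t = y' t := by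
  have h1 := (h.add (h'.smul (-1))).normSq_le hc hk hX ht₀ ht
  rw [h₀] at h1
  have h2 : normSq (y' t₀ + (-1 : ℝ) • y' t₀) = 0 := by rw [normSq_eq_zero]; module
  rw [h2, zero_mul] at h1
  have h3 := normSq_eq_zero.1 (le_antisymm h1 (normSq_nonneg _))
  rw [neg_one_smul, ← sub_eq_add_neg, sub_eq_zero] at h3
  exact h3

/-- `normSq` can shrink at most exponentially: `exp (m (t - t₀)) * normSq` does not decrease. Hence
a lift never reaches the origin and always determines a rotation. -/
theorem IsLift.normSq_pos (hc : 0 < c) (hk : 0 < k) (hX : ∀ t, 0 ≤ t → ‖x t‖ ≤ X)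
    (ht₀ : 0 ≤ t₀) (h : IsLift c k x t₀ e₀ y) (h₀ : 0 < normSq (y t₀)) {t : ℝ} (ht : t₀ ≤ t) :
    0 < normSq (y t) := by
  have hX0 : 0 ≤ X := (norm_nonneg _).trans (hX 0 le_rfl)
  -- The first summand bounds the loss through the double cross product, the second the loss through
  -- the sandwich term.
  set m := 2 * c * X ^ 2 + c * (‖e₀‖ * X) with hm
  have key := le_of_hasDerivWithinAt_le (fun t _ => hasDerivWithinAt_const t _ (normSq (y t₀)))
    (fun t ht => (hasDerivAt_exp_mul_sub m t₀ t).hasDerivWithinAt.fun_mul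
      (hasDerivWithinAt_normSq (h t ht))) (by simp) (fun t ht => ?_) t ht
  · by_contra hcon
    have h1 : Real.exp (m * (t - t₀)) * normSq (y t) ≤ 0 :=
      mul_nonpos_of_nonneg_of_nonpos (Real.exp_pos _).le (not_lt.1 hcon)
    linarith
  · rw [dot_liftField]
    have h6 := (neg_abs_le _).trans' (neg_le_neg (abs_dot_sandwich_le
      (Real.exp (-k * (t - t₀)) • e₀) (x t) (y t) (y t)))
    rw [Real.mul_self_sqrt (normSq_nonneg _)] at h6
    have hxt := hX t (ht₀.trans ht)
    have h7 : ‖Real.exp (-k * (t - t₀)) • e₀‖ * ‖x t‖ * normSq (y t)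
        ≤ ‖e₀‖ * X * normSq (y t) := by
      have := normSq_nonneg (y t)
      have := norm_exp_smul_le hk ht e₀
      gcongr
    have h8 : ‖cross (x t) (y t).2‖ ^ 2 ≤ X ^ 2 * normSq (y t) := by
      have h9 : ‖cross (x t) (y t).2‖ ≤ X * ‖(y t).2‖ := (norm_cross_le _ _).trans (by gcongr)
      calc ‖cross (x t) (y t).2‖ ^ 2 ≤ (X * ‖(y t).2‖) ^ 2 := by gcongr
        _ = X ^ 2 * ‖(y t).2‖ ^ 2 := by ring
        _ ≤ _ := by gcongr; unfold normSq; nlinarith [sq_nonneg (y t).1]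
    have h10 : 0 ≤ m * normSq (y t) + (-(2 * c * ‖cross (x t) (y t).2‖ ^ 2)
        + c * ((y t).1 * (sandwich (Real.exp (-k * (t - t₀)) • e₀) (x t) (y t)).1
          + inner ℝ (y t).2 (sandwich (Real.exp (-k * (t - t₀)) • e₀) (x t) (y t)).2)) := by
      have := mul_le_mul_of_nonneg_left h8 hc.le
      have := mul_le_mul_of_nonneg_left h6 hc.le
      have := mul_le_mul_of_nonneg_left h7 hc.le
      rw [hm]; linarith
    have := mul_nonneg (Real.exp_pos (m * (t - t₀))).le h10
    linarith

/-- The scalar part moves at most proportionally to the perturbation. -/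
theorem IsLift.abs_fst_sub_le (hc : 0 < c) (hk : 0 < k) (hX : ∀ t, 0 ≤ t → ‖x t‖ ≤ X)
    (ht₀ : 0 ≤ t₀) (h : IsLift c k x t₀ e₀ y) {t : ℝ} (ht : t₀ ≤ t) :
    |(y t).1 - (y t₀).1|
      ≤ c * X * ‖e₀‖ / k * Real.sqrt (normSq (y t₀) * Real.exp (c * X * ‖e₀‖ / k)) := by
  have hX0 : 0 ≤ X := (norm_nonneg _).trans (hX 0 le_rfl)
  set S := Real.sqrt (normSq (y t₀) * Real.exp (c * X * ‖e₀‖ / k)) with hS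
  have hb : ∀ t, HasDerivAt (fun s => c * X * ‖e₀‖ / k * S * (1 - Real.exp (-k * (s - t₀))))
      (c * X * ‖e₀‖ * S * Real.exp (-k * (t - t₀))) t := by
    intro t
    refine ((((hasDerivAt_exp_mul_sub (-k) t₀ t).const_sub 1).const_mul
      (c * X * ‖e₀‖ / k * S))).congr_deriv ?_
    field_simp
  have key := norm_le_of_hasDerivWithinAt_le
    (fun t ht => (h t ht).fst.sub_const (y t₀).1)
    (fun t _ => (hb t).hasDerivWithinAt) (by simp) (fun t ht => ?_) t ht
  · refine key.trans ?_
    have h1 : (0:ℝ) ≤ c * X * ‖e₀‖ / k * S := by positivity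
    nlinarith [Real.exp_pos (-k * (t - t₀))]
  · set E := Real.exp (-k * (t - t₀)) with hE
    have h1 : (liftField c (x t) (E • e₀) (y t)).1 = c / 2 * (sandwich (E • e₀) (x t) (y t)).1 := by
      simp [liftField]
    change ‖(liftField c (x t) (E • e₀) (y t)).1‖ ≤ _
    rw [h1, norm_mul, Real.norm_eq_abs, Real.norm_eq_abs, abs_of_pos (by positivity)]
    have h2 : |(sandwich (E • e₀) (x t) (y t)).1| ≤ E * ‖e₀‖ * X * S := by
      refine (Real.abs_le_sqrt (y := normSq (sandwich (E • e₀) (x t) (y t))) ?_).trans ?_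
      · unfold normSq; nlinarith [sq_nonneg ‖(sandwich (E • e₀) (x t) (y t)).2‖]
      · rw [sqrt_normSq_sandwich, hE, norm_exp_smul]
        have := hX t (ht₀.trans ht)
        have := Real.sqrt_le_sqrt (h.normSq_le hc hk hX ht₀ ht)
        gcongr
    have h3 : 0 ≤ E * ‖e₀‖ * X * S := by positivity
    nlinarith

/-- The drift bound restarted at `s`. It is relative to the size of the state at time `s`, which
matters when the whole state tends to zero. -/
theorem IsLift.abs_fst_sub_le_exp (hc : 0 < c) (hk : 0 < k) (hX : ∀ t, 0 ≤ t → ‖x t‖ ≤ X)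
    (ht₀ : 0 ≤ t₀) (h : IsLift c k x t₀ e₀ y) {s t : ℝ} (hs : t₀ ≤ s) (ht : s ≤ t) :
    |(y t).1 - (y s).1| ≤ c * X * ‖e₀‖ / k * Real.exp (c * X * ‖e₀‖ / (2 * k))
      * Real.exp (-k * (s - t₀)) * Real.sqrt (normSq (y s)) := by
  have hX0 : 0 ≤ X := (norm_nonneg _).trans (hX 0 le_rfl)
  have h1 := (h.shift hs).abs_fst_sub_le hc hk hX (ht₀.trans hs) ht
  refine h1.trans ?_
  rw [Real.sqrt_mul (normSq_nonneg _), ← Real.exp_half]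
  have h2 := norm_exp_smul_le hk hs e₀
  have h3 : Real.exp (c * X * ‖Real.exp (-k * (s - t₀)) • e₀‖ / k / 2)
      ≤ Real.exp (c * X * ‖e₀‖ / (2 * k)) := by
    apply Real.exp_le_exp.2
    rw [div_div, mul_comm k 2]
    gcongr
  calc c * X * ‖Real.exp (-k * (s - t₀)) • e₀‖ / k * (Real.sqrt (normSq (y s))
        * Real.exp (c * X * ‖Real.exp (-k * (s - t₀)) • e₀‖ / k / 2))
      ≤ c * X * ‖Real.exp (-k * (s - t₀)) • e₀‖ / k * (Real.sqrt (normSq (y s))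
        * Real.exp (c * X * ‖e₀‖ / (2 * k))) := by gcongr
    _ = _ := by rw [norm_exp_smul]; ring

theorem tendsto_exp_neg_mul_sub (hk : 0 < k) (t₀ : ℝ) :
    Tendsto (fun t => Real.exp (-k * (t - t₀))) atTop (𝓝 0) := by
  refine Real.tendsto_exp_atBot.comp ?_
  exact (tendsto_atTop_add_const_right _ (-t₀) tendsto_id).const_mul_atTop_of_neg (by linarith)

/-- After time `s` the scalar part moves by at most a constant times `exp (-k (s - t₀))`, so it
satisfies the Cauchy criterion. -/
theorem IsLift.exists_tendsto_fst (hc : 0 < c) (hk : 0 < k) (hX : ∀ t, 0 ≤ t → ‖x t‖ ≤ X)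
    (ht₀ : 0 ≤ t₀) (h : IsLift c k x t₀ e₀ y) :
    ∃ l, Tendsto (fun t => (y t).1) atTop (𝓝 l) := by
  have hX0 : 0 ≤ X := (norm_nonneg _).trans (hX 0 le_rfl)
  set A := c * X * ‖e₀‖ / k * Real.exp (c * X * ‖e₀‖ / (2 * k))
    * Real.sqrt (normSq (y t₀) * Real.exp (c * X * ‖e₀‖ / k)) with hA
  have hbd : ∀ s t, t₀ ≤ s → s ≤ t → dist (y t).1 (y s).1 ≤ A * Real.exp (-k * (s - t₀)) := by
    intro s t hs ht
    rw [Real.dist_eq]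
    refine (h.abs_fst_sub_le_exp hc hk hX ht₀ hs ht).trans ?_
    have := Real.sqrt_le_sqrt (h.normSq_le hc hk hX ht₀ hs)
    calc _ ≤ c * X * ‖e₀‖ / k * Real.exp (c * X * ‖e₀‖ / (2 * k)) * Real.exp (-k * (s - t₀))
          * Real.sqrt (normSq (y t₀) * Real.exp (c * X * ‖e₀‖ / k)) := by gcongr
      _ = _ := by rw [hA]; ring
  apply cauchy_map_iff_exists_tendsto.1
  have hlim : Tendsto (fun s => A * Real.exp (-k * (s - t₀))) atTop (𝓝 0) := by
    simpa using (tendsto_exp_neg_mul_sub hk t₀).const_mul A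
  rw [Metric.cauchy_iff]
  refine ⟨inferInstance, fun ε hε => ?_⟩
  obtain ⟨s, hs₁, hs₂⟩ := ((hlim.eventually_lt_const (half_pos hε)).and
    (eventually_ge_atTop t₀)).exists
  refine ⟨(fun t => (y t).1) '' Ici s, image_mem_map (Ici_mem_atTop s), ?_⟩
  rintro _ ⟨t, ht, rfl⟩ _ ⟨t', ht', rfl⟩
  calc dist (y t).1 (y t').1 ≤ dist (y t).1 (y s).1 + dist (y t').1 (y s).1 :=
        dist_triangle_right _ _ _
    _ < ε := by linarith [hbd s t hs₂ ht, hbd s t' hs₂ ht']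

/-- If the scalar part tends to zero then it is dominated by the perturbation. -/
theorem IsLift.abs_fst_le_of_tendsto_zero (hc : 0 < c) (hk : 0 < k)
    (hX : ∀ t, 0 ≤ t → ‖x t‖ ≤ X) (ht₀ : 0 ≤ t₀) (h : IsLift c k x t₀ e₀ y)
    (h0 : Tendsto (fun t => (y t).1) atTop (𝓝 0)) {s : ℝ} (hs : t₀ ≤ s) :
    |(y s).1| ≤ c * X * ‖e₀‖ / k * Real.exp (c * X * ‖e₀‖ / (2 * k))
      * Real.exp (-k * (s - t₀)) * Real.sqrt (normSq (y s)) := by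
  refine le_of_tendsto (x := atTop) (f := fun t => |(y t).1 - (y s).1|) ?_
    ((eventually_ge_atTop s).mono fun t ht => h.abs_fst_sub_le_exp hc hk hX ht₀ hs ht)
  simpa using (h0.sub_const (y s).1).abs

end LinearSystem

/-! ### Exponential decay of the vector part and the limit functional of the scalar part -/

section Decay

/-- The operator `-(x ×)²`, that is `‖x‖²` times the projection orthogonal to `x`. -/
noncomputable def negCrossSq (x : E3) : E3 →L[ℝ] E3 := -((crossL x).comp (crossL x))

theorem negCrossSq_apply (x b : E3) : negCrossSq x b = -cross x (cross x b) := rfl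

theorem inner_negCrossSq (x b : E3) : inner ℝ (negCrossSq x b) b = ‖cross x b‖ ^ 2 := by
  rw [negCrossSq_apply, inner_neg_left, inner_cross_cross, neg_neg]

/-- `M` is a uniformly positive, bounded filtered version of `-(x ×)²`. -/
structure IsExcitationFilter (x : ℝ → E3) (M : ℝ → E3 →L[ℝ] E3) (m κ : ℝ) : Prop where
  deriv : ∀ t, 0 ≤ t → HasDerivWithinAt M (-M t + negCrossSq (x t)) (Ici 0) t
  norm_le : ∀ t, 0 ≤ t → ‖M t‖ ≤ m
  le_inner : ∀ t, 0 ≤ t → ∀ b, κ * ‖b‖ ^ 2 ≤ inner ℝ (M t b) b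

variable {c k X t₀ : ℝ} {x : ℝ → E3} {e₀ : E3} {y y' : ℝ → ℝ × E3}

theorem mul_le_young {κ : ℝ} (hκ : 0 < κ) (a p q : ℝ) :
    a * p * q ≤ κ / 4 * p ^ 2 + a ^ 2 / κ * q ^ 2 := by
  have : κ / 4 * p ^ 2 + a ^ 2 / κ * q ^ 2 - a * p * q = (κ * p / 2 - a * q) ^ 2 / κ := by
    field_simp; ring
  have h2 : 0 ≤ (κ * p / 2 - a * q) ^ 2 / κ := by positivity
  linarith

theorem IsLift.hasDerivWithinAt_snd (h : IsLift c k x t₀ e₀ y) {t : ℝ} (ht : t₀ ≤ t) :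
    HasDerivWithinAt (fun t => (y t).2)
      (liftField c (x t) (Real.exp (-k * (t - t₀)) • e₀) (y t)).2 (Ici t₀) t :=
  (h t ht).snd

set_option maxHeartbeats 1000000 in
/-- The vector part decays exponentially, uniformly in the initial time. -/
theorem IsLift.exists_decay (hc : 0 < c) (hk : 0 < k) (hX : ∀ t, 0 ≤ t → ‖x t‖ ≤ X)
    {M : ℝ → E3 →L[ℝ] E3} {m κ : ℝ} (hκ : 0 < κ) (hM : IsExcitationFilter x M m κ) :
    ∃ ν > 0, ∃ K > 0, ∀ t₀, 0 ≤ t₀ → ∀ e₀ y, IsLift c k x t₀ e₀ y → ∀ t, t₀ ≤ t →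
      ‖(y t).2‖ ^ 2 ≤ Real.exp (-ν * (t - t₀)) * (K * (‖(y t₀).2‖ ^ 2
        + ‖e₀‖ ^ 2 * (normSq (y t₀) * Real.exp (c * X * ‖e₀‖ / k)))) := by
  have hX0 : 0 ≤ X := (norm_nonneg _).trans (hX 0 le_rfl)
  have hm0 : 0 ≤ m := (norm_nonneg _).trans (hM.norm_le 0 le_rfl)
  -- With `p = ‖ε‖` and `q = ‖x × ε‖`, the function `W = A p² + ⟨Mε, ε⟩` satisfies `W' ≤ -κ p² + q²
  -- - 2cA q² + a p q + (2A + 2m) p ‖f‖`, where `f` is the perturbation. Young's inequality spends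
  -- `κ/4 p²` on each mixed term; `A` is chosen so that `2cA = 1 + a²/κ` cancels all `q²` terms, and
  -- `C` is the remaining factor of `‖f‖²`.
  set a := 2 * m * c * X with ha
  set A := (1 + a ^ 2 / κ) / (2 * c) with hA
  have hA0 : 0 < A := by positivity
  have hcA : 2 * c * A = 1 + a ^ 2 / κ := by rw [hA]; field_simp
  set C := (2 * A + 2 * m) ^ 2 / κ with hC
  have hC0 : 0 ≤ C := by positivity
  -- As `W ≤ (A + m) p²`, the leftover `-κ/2 p²` is at most `-ν W`; the bound `ν ≤ k` lets the
  -- forcing be absorbed.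
  set ν := min k (κ / (2 * (A + m))) with hν
  have hν0 : 0 < ν := lt_min hk (by positivity)
  have hνA : ν * (A + m) ≤ κ / 2 := by
    calc ν * (A + m) ≤ κ / (2 * (A + m)) * (A + m) := by gcongr; exact min_le_right _ _
      _ = κ / 2 := by field_simp
  set G := C * (c ^ 2 / 4 * X ^ 2) with hG
  refine ⟨ν, hν0, (A + m + G / k) / κ, by positivity, fun t₀ ht₀ e₀ y h t ht => ?_⟩
  set S := normSq (y t₀) * Real.exp (c * X * ‖e₀‖ / k) with hS
  have hS0 : 0 ≤ S := mul_nonneg (normSq_nonneg _) (Real.exp_pos _).le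
  have hWle : ∀ t, t₀ ≤ t → A * ‖(y t).2‖ ^ 2 + inner ℝ (M t (y t).2) (y t).2
      ≤ (A + m) * ‖(y t).2‖ ^ 2 := fun t ht => by
    have h1 : inner ℝ (M t (y t).2) (y t).2 ≤ m * ‖(y t).2‖ * ‖(y t).2‖ :=
      (real_inner_le_norm _ _).trans (by
        gcongr; exact (M t).le_of_opNorm_le (hM.norm_le t (ht₀.trans ht)) _)
    nlinarith
  have key := le_exp_mul_of_deriv_le (t₀ := t₀) hk (min_le_left k (κ / (2 * (A + m))))
    (β := G * ‖e₀‖ ^ 2 * S) (by positivity)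
    (W := fun t => A * ‖(y t).2‖ ^ 2 + inner ℝ (M t (y t).2) (y t).2)
    (fun t ht => ((h.hasDerivWithinAt_snd ht).norm_sq.const_mul A).fun_add
      ((((hM.deriv t (ht₀.trans ht)).mono (Ici_subset_Ici.2 ht₀)).clm_apply (h.hasDerivWithinAt_snd ht)).inner ℝ
        (h.hasDerivWithinAt_snd ht))) (fun t ht => ?_) t ht
  · have h1 := hM.le_inner t (ht₀.trans ht) (y t).2
    have h2 := hWle t₀ le_rfl
    have h3 : κ * ‖(y t).2‖ ^ 2 ≤ Real.exp (-ν * (t - t₀))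
        * ((A + m) * ‖(y t₀).2‖ ^ 2 + G * ‖e₀‖ ^ 2 * S / k) := by
      refine le_trans ?_ (key.trans ?_)
      · nlinarith [sq_nonneg ‖(y t).2‖]
      · gcongr
    have h4 : (A + m) * ‖(y t₀).2‖ ^ 2 + G * ‖e₀‖ ^ 2 * S / k
        ≤ (A + m + G / k) * (‖(y t₀).2‖ ^ 2 + ‖e₀‖ ^ 2 * S) := by
      have h5 : 0 ≤ (A + m) * (‖e₀‖ ^ 2 * S) := by positivity
      have h6 : 0 ≤ G / k * ‖(y t₀).2‖ ^ 2 := by positivity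
      have h7 : G * ‖e₀‖ ^ 2 * S / k = G / k * (‖e₀‖ ^ 2 * S) := by ring
      rw [h7]; nlinarith
    have h5 := h3.trans (mul_le_mul_of_nonneg_left h4 (Real.exp_pos (-ν * (t - t₀))).le)
    have h6 : Real.exp (-ν * (t - t₀)) * ((A + m + G / k) / κ * (‖(y t₀).2‖ ^ 2 + ‖e₀‖ ^ 2 * S))
        = (Real.exp (-ν * (t - t₀)) * ((A + m + G / k) * (‖(y t₀).2‖ ^ 2 + ‖e₀‖ ^ 2 * S))) / κ := by
      ring
    rw [h6, le_div_iff₀ hκ]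
    linarith
  · set E := Real.exp (-k * (t - t₀)) with hE
    set ε := (y t).2 with hε
    set f := (c / 2) • (sandwich (E • e₀) (x t) (y t)).2 with hf
    have hε' : (liftField c (x t) (E • e₀) (y t)).2 = c • cross (x t) (cross (x t) ε) + f := by
      simp [liftField, hf, hε]
    rw [hε']
    set p := ‖ε‖ with hp
    set q := ‖cross (x t) ε‖ with hq
    have hxt := hX t (ht₀.trans ht)
    have hN : ‖c • cross (x t) (cross (x t) ε) + f‖ ≤ c * (X * q) + ‖f‖ := by
      refine (norm_add_le _ _).trans ?_
      rw [norm_smul, Real.norm_eq_abs, abs_of_pos hc]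
      gcongr
      exact (norm_cross_le _ _).trans (by gcongr)
    have i1 : inner ℝ ε (c • cross (x t) (cross (x t) ε) + f) ≤ -(c * q ^ 2) + p * ‖f‖ := by
      rw [inner_add_right, inner_smul_right, real_inner_comm, inner_cross_cross]
      linarith [real_inner_le_norm ε f]
    have i2 : inner ℝ ((-M t + negCrossSq (x t)) ε
        + M t (c • cross (x t) (cross (x t) ε) + f)) ε
        ≤ -(κ * p ^ 2) + q ^ 2 + m * (c * (X * q) + ‖f‖) * p := by
      rw [inner_add_left]
      have j1 : inner ℝ ((-M t + negCrossSq (x t)) ε) ε = -inner ℝ (M t ε) ε + q ^ 2 := by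
        rw [add_apply, inner_add_left, inner_negCrossSq,
          neg_apply, inner_neg_left]
      have j2 := hM.le_inner t (ht₀.trans ht) ε
      have j3 : inner ℝ (M t (c • cross (x t) (cross (x t) ε) + f)) ε
          ≤ m * (c * (X * q) + ‖f‖) * p :=
        (real_inner_le_norm _ _).trans (by
          gcongr
          refine ((M t).le_of_opNorm_le (hM.norm_le t (ht₀.trans ht)) _).trans ?_
          gcongr)
      linarith
    have i3 : inner ℝ (M t ε) (c • cross (x t) (cross (x t) ε) + f)
        ≤ m * p * (c * (X * q) + ‖f‖) :=
      (real_inner_le_norm _ _).trans (by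
        gcongr; exact (M t).le_of_opNorm_le (hM.norm_le t (ht₀.trans ht)) _)
    -- The perturbation enters squared, whence the rate `2k`; `S` is the uniform bound on `normSq (y
    -- t)`.
    have hφ : ‖f‖ ^ 2 ≤ c ^ 2 / 4 * X ^ 2 * ‖e₀‖ ^ 2 * S * Real.exp (-(2 * k) * (t - t₀)) := by
      rw [hf, norm_smul, mul_pow, Real.norm_eq_abs, sq_abs]
      have j1 : ‖(sandwich (E • e₀) (x t) (y t)).2‖ ^ 2 ≤ (E * ‖e₀‖) ^ 2 * X ^ 2 * S := by
        calc _ ≤ normSq (sandwich (E • e₀) (x t) (y t)) := by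
              unfold normSq; nlinarith [sq_nonneg (sandwich (E • e₀) (x t) (y t)).1]
          _ = (E * ‖e₀‖) ^ 2 * ‖x t‖ ^ 2 * normSq (y t) := by
              rw [normSq_sandwich, hE, norm_exp_smul]
          _ ≤ _ := by
              have := h.normSq_le hc hk hX ht₀ ht
              have := normSq_nonneg (y t)
              gcongr
      have j2 : Real.exp (-(2 * k) * (t - t₀)) = E ^ 2 := by
        rw [hE, ← Real.exp_nat_mul]; congr 1; push_cast; ring
      rw [j2]
      have := mul_le_mul_of_nonneg_left j1 (by positivity : 0 ≤ (c / 2) ^ 2)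
      linarith
    have y1 := mul_le_young hκ a p q
    have y2 := mul_le_young hκ (2 * A + 2 * m) p ‖f‖
    have hW := hWle t ht
    rw [← hε, ← hp] at hW
    have hνW : ν * (A * p ^ 2 + inner ℝ (M t ε) ε) ≤ κ / 2 * p ^ 2 := by
      calc _ ≤ ν * ((A + m) * p ^ 2) := by gcongr
        _ = ν * (A + m) * p ^ 2 := by ring
        _ ≤ _ := by gcongr
    have hCφ := mul_le_mul_of_nonneg_left hφ hC0
    have e1 := mul_le_mul_of_nonneg_left i1 hA0.le
    have e2 : A * (-(c * q ^ 2)) * 2 = -(1 + a ^ 2 / κ) * q ^ 2 := by rw [← hcA]; ring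
    have e3 : C * (c ^ 2 / 4 * X ^ 2 * ‖e₀‖ ^ 2 * S * Real.exp (-(2 * k) * (t - t₀)))
        = G * ‖e₀‖ ^ 2 * S * Real.exp (-(2 * k) * (t - t₀)) := by rw [hG]; ring
    have e4 : m * (c * (X * q) + ‖f‖) * p + m * p * (c * (X * q) + ‖f‖)
        = a * p * q + 2 * m * p * ‖f‖ := by rw [ha]; ring
    have e5 : (2 * A + 2 * m) ^ 2 / κ * ‖f‖ ^ 2 = C * ‖f‖ ^ 2 := rfl
    change _ ≤ -ν * (A * p ^ 2 + inner ℝ (M t ε) ε) + _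
    linarith

/-- By uniqueness the flow is linear, so the limit of the scalar part is a linear functional of the
initial state, and `n e` is the vector representing it. Continuity and nonvanishing of `n` are what
the measure argument needs. -/
theorem exists_limit_functional (hc : 0 < c) (hk : 0 < k) (hxc : ContinuousOn x (Ici 0))
    (hX : ∀ t, 0 ≤ t → ‖x t‖ ≤ X) (ht₀ : 0 ≤ t₀) :
    ∃ n : E3 → ℝ × E3, Continuous n ∧ (∀ e, n e ≠ 0) ∧ ∀ e y, IsLift c k x t₀ e y →
      Tendsto (fun t => (y t).1) atTop
        (𝓝 ((n e).1 * (y t₀).1 + inner ℝ (n e).2 (y t₀).2)) := by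
  have hX0 : 0 ≤ X := (norm_nonneg _).trans (hX 0 le_rfl)
  choose Y hY₀ hY using fun e q => exists_isLift (X := X) hc hk hxc hX ht₀ e q
  choose L hL using fun e q => (hY e q).exists_tendsto_fst hc hk hX ht₀
  have hYadd : ∀ e q q' t, t₀ ≤ t → Y e (q + q') t = Y e q t + Y e q' t := fun e q q' t ht =>
    (hY e (q + q')).eq_of_eq hc hk hX ht₀ ((hY e q).add (hY e q')) (by simp [hY₀]) ht
  have hYsmul : ∀ e (r : ℝ) q t, t₀ ≤ t → Y e (r • q) t = r • Y e q t := fun e r q t ht =>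
    (hY e (r • q)).eq_of_eq hc hk hX ht₀ ((hY e q).smul r) (by simp [hY₀]) ht
  have hLadd : ∀ e q q', L e (q + q') = L e q + L e q' := fun e q q' => by
    refine tendsto_nhds_unique (hL e (q + q')) (((hL e q).add (hL e q')).congr' ?_)
    filter_upwards [eventually_ge_atTop t₀] with t ht
    rw [hYadd e q q' t ht]; rfl
  have hLsmul : ∀ e (r : ℝ) q, L e (r • q) = r * L e q := fun e r q => by
    refine tendsto_nhds_unique (hL e (r • q)) (((hL e q).const_mul r).congr' ?_)
    filter_upwards [eventually_ge_atTop t₀] with t ht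
    rw [hYsmul e r q t ht]; rfl
  have hLc : ∀ q, Continuous fun e => L e q := fun q => by
    refine continuous_iff_continuousAt.2 fun e₁ => ?_
    set D := normSq q * Real.exp (c * X * ‖e₁‖ / k) with hD
    -- Continuous dependence is uniform in time, so it survives the limit `t → ∞`.
    have hb : ∀ e, (L e q - L e₁ q) ^ 2 ≤ c * X * ‖e - e₁‖ * D / k
        * Real.exp (c * X * (‖e‖ + ‖e - e₁‖) / k) := fun e => by
      refine le_of_tendsto (((hL e q).sub (hL e₁ q)).pow 2) ?_
      filter_upwards [eventually_ge_atTop t₀] with t ht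
      have h1 := (hY e q).normSq_sub_le hc hk hX ht₀ (hY e₁ q) (D := D)
        (fun t ht => by simpa [hY₀] using (hY e₁ q).normSq_le hc hk hX ht₀ ht) ht
      have h2 : normSq (Y e q t₀ - Y e₁ q t₀) = 0 := by simp [hY₀, normSq]
      rw [h2, zero_add] at h1
      refine le_trans ?_ h1
      unfold normSq
      simp only [Prod.fst_sub]
      nlinarith [sq_nonneg ‖(Y e q t - Y e₁ q t).2‖]
    have hlim : Tendsto (fun e => c * X * ‖e - e₁‖ * D / k
        * Real.exp (c * X * (‖e‖ + ‖e - e₁‖) / k)) (𝓝 e₁) (𝓝 0) := by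
      have : Continuous (fun e => c * X * ‖e - e₁‖ * D / k
        * Real.exp (c * X * (‖e‖ + ‖e - e₁‖) / k)) := by fun_prop
      simpa using this.tendsto e₁
    have h1 := (squeeze_zero (fun e => sq_nonneg _) hb hlim).sqrt
    rw [Real.sqrt_zero] at h1
    simp only [Real.sqrt_sq_eq_abs] at h1
    exact tendsto_sub_nhds_zero_iff.1 ((tendsto_zero_iff_abs_tendsto_zero _).2 h1)
  set b : Fin 3 → ℝ × E3 := fun i => (0, EuclideanSpace.single i 1) with hb
  set n : E3 → ℝ × E3 := fun e => (L e (1, 0), !₂[L e (b 0), L e (b 1), L e (b 2)]) with hn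
  have hnL : ∀ e q, (n e).1 * q.1 + inner ℝ (n e).2 q.2 = L e q := fun e q => by
    have h1 : q = q.1 • ((1 : ℝ), (0 : E3)) + (q.2 0 • b 0 + (q.2 1 • b 1 + q.2 2 • b 2)) := by
      refine Prod.ext (by simp [hb]) (E3.ext ?_ ?_ ?_) <;> simp [hb]
    conv_rhs => rw [h1]
    rw [hLadd, hLadd, hLadd, hLsmul, hLsmul, hLsmul, hLsmul, inner_eq_coords]
    simp [hn]; ring
  refine ⟨n, ?_, fun e hne => ?_, fun e y h => ?_⟩
  · refine (hLc _).prodMk ((PiLp.continuous_toLp 2 _).comp (continuous_pi fun i => ?_))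
    fin_cases i <;> exact hLc _
  -- If the functional vanished, every scalar part would tend to zero and so satisfy `|η(s)| ≤ A exp
  -- (-k (s - t₀)) √normSq`. At a late `s` with factor below `1` the state `(1, 0)` violates this,
  -- yet it is reached because the flow map is injective and hence surjective.
  · have hL0 : ∀ q, L e q = 0 := fun q => by rw [← hnL, hne]; simp
    set A := c * X * ‖e‖ / k * Real.exp (c * X * ‖e‖ / (2 * k)) with hA
    have hlim : Tendsto (fun s => A * Real.exp (-k * (s - t₀))) atTop (𝓝 0) := by
      simpa using (tendsto_exp_neg_mul_sub hk t₀).const_mul A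
    obtain ⟨s, hs₁, hs₂⟩ := ((hlim.eventually_lt_const one_pos).and
      (eventually_ge_atTop t₀)).exists
    let Φ : (ℝ × E3) →ₗ[ℝ] (ℝ × E3) :=
      { toFun := fun q => Y e q s
        map_add' := fun q q' => hYadd e q q' s hs₂
        map_smul' := fun r q => hYsmul e r q s hs₂ }
    have hinj : Function.Injective Φ := by
      rw [← LinearMap.ker_eq_bot, LinearMap.ker_eq_bot']
      intro q hq
      by_contra hq0
      have h1 : 0 < normSq (Y e q t₀) := by
        rw [hY₀]; exact lt_of_le_of_ne (normSq_nonneg _) fun h => hq0 (normSq_eq_zero.1 h.symm)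
      have h2 := (hY e q).normSq_pos hc hk hX ht₀ h1 hs₂
      have h3 : Y e q s = 0 := hq
      rw [h3] at h2
      simp [normSq] at h2
    obtain ⟨q, hq⟩ := LinearMap.injective_iff_surjective.1 hinj (1, 0)
    have hq' : Y e q s = (1, 0) := hq
    have h1 := (hY e q).abs_fst_le_of_tendsto_zero hc hk hX ht₀ (by simpa [hL0] using hL e q) hs₂
    rw [hq'] at h1
    have h2 : normSq ((1 : ℝ), (0 : E3)) = 1 := by simp [normSq]
    rw [h2] at h1
    simp only [abs_one, Real.sqrt_one, mul_one] at h1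
    exact absurd hs₁ (not_lt.2 h1)
  · rw [hnL]
    refine (hL e (y t₀)).congr' ?_
    filter_upwards [eventually_ge_atTop t₀] with t ht
    rw [(hY e (y t₀)).eq_of_eq hc hk hX ht₀ h (hY₀ _ _) ht]

end Decay

/-! ### Transfer of persistent excitation from the acceleration to the velocity gap -/

section Excitation

theorem norm_cross_comm (x y : E3) : ‖cross x y‖ = ‖cross y x‖ := by
  have : cross x y = -cross y x := by
    apply E3.ext <;> simp only [cross_zero, cross_one, cross_two, PiLp.neg_apply] <;> ring
  rw [this, norm_neg]

theorem norm_negCrossSq_le (x : E3) : ‖negCrossSq x‖ ≤ ‖x‖ ^ 2 := by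
  refine ContinuousLinearMap.opNorm_le_bound _ (by positivity) fun b => ?_
  rw [negCrossSq_apply, norm_neg]
  calc _ ≤ ‖x‖ * ‖cross x b‖ := norm_cross_le _ _
    _ ≤ ‖x‖ * (‖x‖ * ‖b‖) := by gcongr; exact norm_cross_le _ _
    _ = _ := by ring

theorem continuous_negCrossSq : Continuous negCrossSq :=
  (crossL.continuous.clm_comp crossL.continuous).neg

variable {k X : ℝ} {x u : ℝ → E3}

theorem exists_window {f : ℝ → E3} (hf : UniformContinuousOn f (Ici 0)) {ε : ℝ} (hε : 0 < ε) :
    ∃ h > 0, ∀ t, 0 ≤ t → ∀ s, t ≤ s → s ≤ t + h → ‖f s - f t‖ ≤ ε := by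
  obtain ⟨δ, hδ, h⟩ := Metric.uniformContinuousOn_iff.1 hf ε hε
  refine ⟨δ / 2, half_pos hδ, fun t ht s hts hs => ?_⟩
  rw [← dist_eq_norm]
  refine (h s (ht.trans hts) t ht ?_).le
  rw [Real.dist_eq, abs_of_nonneg (by linarith)]
  linarith

/-- The increments of a solution of `x' = u - k x` over short windows are governed by `u`. -/
theorem norm_map_input_le (hk : 0 < k)
    (hx : ∀ t, 0 ≤ t → HasDerivWithinAt x (u t - k • x t) (Ici 0) t) (A : E3 →L[ℝ] E3)
    {τ h ε Y : ℝ} (hτ : 0 ≤ τ) (hh : 0 ≤ h)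
    (hu : ∀ s, τ ≤ s → s ≤ τ + h → ‖A (u s) - A (u τ)‖ ≤ ε)
    (hY : ∀ s, τ ≤ s → s ≤ τ + h → ‖A (x s)‖ ≤ Y) :
    h * ‖A (u τ)‖ ≤ 2 * Y + h * (ε + k * Y) := by
  have hd : ∀ t, 0 ≤ t → HasDerivWithinAt (fun s => A (x s) - s • A (u τ))
      (A (u t) - A (u τ) - k • A (x t)) (Ici 0) t := fun t ht => by
    refine ((A.hasFDerivAt.comp_hasDerivWithinAt t (hx t ht)).fun_sub
      ((hasDerivWithinAt_id t _).smul_const (A (u τ)))).congr_deriv ?_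
    rw [map_sub, map_smul]; module
  have h1 := norm_sub_le_of_norm_deriv_le (C := ε + k * Y) hd hτ (by linarith : τ ≤ τ + h)
    (fun r hr hr' => by
      refine (norm_sub_le _ _).trans (add_le_add (hu r hr hr') ?_)
      rw [norm_smul, Real.norm_eq_abs, abs_of_pos hk]
      exact mul_le_mul_of_nonneg_left (hY r hr hr') hk.le)
  have h2 : h • A (u τ) = A (x (τ + h)) - A (x τ)
      - (A (x (τ + h)) - (τ + h) • A (u τ) - (A (x τ) - τ • A (u τ))) := by module
  have h3 := norm_sub_le (A (x (τ + h)) - A (x τ))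
    (A (x (τ + h)) - (τ + h) • A (u τ) - (A (x τ) - τ • A (u τ)))
  rw [← h2, norm_smul, Real.norm_eq_abs, abs_of_nonneg hh] at h3
  have h4 := norm_sub_le (A (x (τ + h))) (A (x τ))
  have h5 := hY τ le_rfl (by linarith)
  have h6 := hY (τ + h) (by linarith) le_rfl
  have h7 : τ + h - τ = h := by ring
  rw [h7] at h1
  linarith

/-- On a window where `u` varies by at most `1`, a large value of `u` would force a large increment
of the bounded `x`. The bound on `u` makes `x` Lipschitz. -/
theorem exists_input_bound (hk : 0 < k)
    (hx : ∀ t, 0 ≤ t → HasDerivWithinAt x (u t - k • x t) (Ici 0) t)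
    (hX : ∀ t, 0 ≤ t → ‖x t‖ ≤ X) (hu : UniformContinuousOn u (Ici 0)) :
    ∃ B, ∀ t, 0 ≤ t → ‖u t‖ ≤ B := by
  obtain ⟨h, hh, hw⟩ := exists_window hu one_pos
  refine ⟨(2 * X + h * (1 + k * X)) / h, fun t ht => ?_⟩
  rw [le_div_iff₀ hh, mul_comm]
  exact norm_map_input_le hk hx (ContinuousLinearMap.id ℝ E3) ht hh.le (hw t ht)
    (fun s hs _ => hX s (ht.trans hs))

/-- Persistent excitation passes through the filter `x' = u - k x`. -/
theorem PersistentlyExciting.of_filter (hk : 0 < k)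
    (hx : ∀ t, 0 ≤ t → HasDerivWithinAt x (u t - k • x t) (Ici 0) t)
    (hu : UniformContinuousOn u (Ici 0)) (hpe : PersistentlyExciting u) :
    PersistentlyExciting x := by
  obtain ⟨μ, hμ, δ, hδ, hpe⟩ := hpe
  obtain ⟨h, hh, hw⟩ := exists_window hu (half_pos hμ)
  -- Were `‖b × x‖` below this constant `Y` on the window, an interval of length `h/2` after `τ`
  -- would give `(h/2) μ ≤ 2Y + (h/2)(μ/2 + kY)`, that is `hμ/4 ≤ (2 + kh/2) Y`, contradicting `(2 +
  -- kh) Y = hμ/4`. The extra length `h` keeps that interval inside the window.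
  refine ⟨h * μ / (4 * (2 + k * h)), by positivity, δ + h, by positivity, fun b hb t ht => ?_⟩
  obtain ⟨τ, hτ, hbτ⟩ := hpe b hb t ht
  by_contra! hcon
  have hτ0 : 0 ≤ τ := ht.trans hτ.1
  have h1 := norm_map_input_le (ε := μ / 2) (Y := h * μ / (4 * (2 + k * h))) (h := h * (1 / 2)) hk hx
    (crossL b) hτ0 (by positivity)
    (fun s hs hs' => by
      rw [← map_sub, crossL_apply]
      refine (norm_cross_le _ _).trans ?_
      rw [hb, one_mul]
      exact hw τ hτ0 s hs (by linarith))
    (fun s hs hs' => (hcon s ⟨hτ.1.trans hs, by linarith [hτ.2]⟩).le)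
  rw [crossL_apply] at h1
  have h2 : h * μ / (4 * (2 + k * h)) * (2 + k * h) = h * μ / 4 := by field_simp
  have h3 : 0 < h * μ / (4 * (2 + k * h)) := by positivity
  have h4 : h * (1 / 2) * μ ≤ h * (1 / 2) * ‖cross b (u τ)‖ := by gcongr
  have h5 : 0 < h * μ := by positivity
  have h6 : 0 < k * h * (h * μ / (4 * (2 + k * h))) := by positivity
  nlinarith

/-- `M` solves `M' = -M + negCrossSq (x t)` with `M 0` the identity. For a unit vector `b`, `exp t *
⟨M b, b⟩` is nondecreasing with derivative `exp t * ‖x × b‖²`: the initial value gives positivity up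
to time `T`, and afterwards an excitation window does. -/
theorem exists_excitationFilter_of_lipschitz {Λ : ℝ} (hxc : ContinuousOn x (Ici 0))
    (hX : ∀ t, 0 ≤ t → ‖x t‖ ≤ X)
    (hΛ : ∀ s t, 0 ≤ s → s ≤ t → ‖x t - x s‖ ≤ Λ * (t - s)) (hpe : PersistentlyExciting x) :
    ∃ M m κ, 0 < κ ∧ IsExcitationFilter x M m κ := by
  have hΛ0 : 0 ≤ Λ := by simpa using (norm_nonneg _).trans (hΛ 0 1 le_rfl zero_le_one)
  obtain ⟨M, hM0, hM⟩ := exists_global_solution (E := E3 →L[ℝ] E3) (t₀ := 0) (K := 1) (C := X ^ 2)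
    (F := fun t M => -M + negCrossSq (x t))
    (fun M => continuousOn_const.add (continuous_negCrossSq.comp_continuousOn hxc))
    (fun t _ => LipschitzWith.of_dist_le_mul fun M M' => by simp)
    (fun t ht => by
      rw [neg_zero, zero_add]
      exact (norm_negCrossSq_le _).trans (by gcongr; exact hX t ht))
    (ContinuousLinearMap.id ℝ E3)
  obtain ⟨μ, hμ, δ, hδ, hpe⟩ := hpe
  -- Over a time `h` the signal moves by at most `μ/2`, so `‖x × b‖ ≥ μ/2` persists after an
  -- excitation instant; `Λ + 1` avoids division by zero. A window `δ` followed by this interval has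
  -- total length `T`.
  set h := μ / (2 * (Λ + 1)) with hh
  have hh0 : 0 < h := by positivity
  set T := δ + h with hT
  set κ := Real.exp (-T) * min 1 (h * (μ ^ 2 / 4)) with hκ
  refine ⟨M, ‖M 0‖ + X ^ 2 / 1, κ, by positivity, hM, ?_, ?_⟩
  · refine norm_le_of_filter (f := fun t => negCrossSq (x t)) one_pos (fun t ht => ?_) fun t ht => ?_
    · simpa using hM t ht
    · exact (norm_negCrossSq_le _).trans (by gcongr; exact hX t ht)
  · have hunit : ∀ b : E3, ‖b‖ = 1 → ∀ t, 0 ≤ t → κ ≤ inner ℝ (M t b) b := by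
      intro b hb
      set ψ : ℝ → ℝ := fun t => Real.exp t * inner ℝ (M t b) b with hψ
      have hψd : ∀ t, 0 ≤ t →
          HasDerivWithinAt ψ (Real.exp t * ‖cross (x t) b‖ ^ 2) (Ici 0) t := fun t ht => by
        refine ((Real.hasDerivAt_exp t).hasDerivWithinAt.fun_mul
          (((hM t ht).clm_apply (hasDerivWithinAt_const t _ b)).inner ℝ
            (hasDerivWithinAt_const t _ b))).congr_deriv ?_
        rw [inner_zero_right, map_zero, add_zero, add_apply, inner_add_left, inner_negCrossSq,
          neg_apply, inner_neg_left]
        ring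
      have hψ0 : ψ 0 = 1 := by simp [hψ, hM0, hb]
      have hmono : ∀ s t, 0 ≤ s → s ≤ t → ψ s ≤ ψ t := fun s t hs hst =>
        le_of_hasDerivWithinAt_le (fun t _ => hasDerivWithinAt_const t _ (ψ s))
          (fun t ht => (hψd t (hs.trans ht)).mono (Ici_subset_Ici.2 hs)) le_rfl
          (fun t _ => by positivity) t hst
      have hφ : ∀ t, inner ℝ (M t b) b = Real.exp (-t) * ψ t := fun t => by
        rw [hψ, ← mul_assoc, ← Real.exp_add]; simp
      intro t ht
      rw [hφ]
      rcases le_or_gt t T with htT | htT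
      · have h1 : 1 ≤ ψ t := by rw [← hψ0]; exact hmono 0 t le_rfl ht
        have h2 : Real.exp (-T) ≤ Real.exp (-t) := Real.exp_le_exp.2 (by linarith)
        have h3 : min 1 (h * (μ ^ 2 / 4)) ≤ ψ t := (min_le_left _ _).trans h1
        rw [hκ]
        gcongr
      -- The excitation window starts at `t - T`, so the interval `[τ, τ + h]` ends before `t` and
      -- its contribution is discounted by at most `exp (-T)`.
      · obtain ⟨τ, hτ, hbτ⟩ := hpe b hb (t - T) (by linarith)
        have hτ0 : 0 ≤ τ := by linarith [hτ.1]
        have hτt : τ + h ≤ t := by linarith [hτ.2]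
        have hlow : ∀ s ∈ Ico τ (τ + h), Real.exp τ * (μ ^ 2 / 4)
            ≤ Real.exp s * ‖cross (x s) b‖ ^ 2 := fun s hs => by
          have h1 : ‖cross b (x s) - cross b (x τ)‖ ≤ μ / 2 := by
            rw [← cross_sub_right]
            refine (norm_cross_le _ _).trans ?_
            rw [hb, one_mul]
            refine (hΛ τ s hτ0 hs.1).trans ?_
            calc Λ * (s - τ) ≤ (Λ + 1) * h := by
                  have : s - τ ≤ h := by linarith [hs.2]
                  have : 0 ≤ s - τ := by linarith [hs.1]
                  gcongr
                  linarith
              _ = μ / 2 := by rw [hh]; field_simp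
          have h2 : μ / 2 ≤ ‖cross (x s) b‖ := by
            rw [norm_cross_comm]
            have := norm_sub_norm_le (cross b (x τ)) (cross b (x s))
            rw [norm_sub_rev] at this
            linarith
          have h3 : μ ^ 2 / 4 ≤ ‖cross (x s) b‖ ^ 2 := by nlinarith
          have h4 : Real.exp τ ≤ Real.exp s := Real.exp_le_exp.2 hs.1
          gcongr
        have h1 := image_le_of_deriv_right_le_deriv_boundary (a := τ) (b := τ + h)
          (f := fun s => ψ τ + Real.exp τ * (μ ^ 2 / 4) * (s - τ))
          (f' := fun _ => Real.exp τ * (μ ^ 2 / 4)) (by fun_prop)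
          (fun s _ => by
            simpa using ((((hasDerivAt_id s).sub_const τ).const_mul
              (Real.exp τ * (μ ^ 2 / 4))).const_add (ψ τ)).hasDerivWithinAt)
          (B := ψ) (by simp)
          (fun s hs => (hψd s (hτ0.trans hs.1)).continuousWithinAt.mono
            (Icc_subset_Ici_self.trans (Ici_subset_Ici.2 hτ0)))
          (fun s hs => (hψd s (hτ0.trans hs.1)).mono (Ici_subset_Ici.2 (hτ0.trans hs.1))) hlow
          (right_mem_Icc.2 (by linarith : τ ≤ τ + h))
        have h2 := hmono (τ + h) t (by linarith) hτt
        have h3 : 1 ≤ ψ τ := by rw [← hψ0]; exact hmono 0 τ le_rfl hτ0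
        have h4 : Real.exp τ * (h * (μ ^ 2 / 4)) ≤ ψ t := by
          have : Real.exp τ * (μ ^ 2 / 4) * (τ + h - τ) = Real.exp τ * (h * (μ ^ 2 / 4)) := by ring
          simp only [this] at h1
          linarith
        calc κ ≤ Real.exp (-T) * (h * (μ ^ 2 / 4)) := by
              rw [hκ]; gcongr; exact min_le_right _ _
          _ ≤ Real.exp (-t + τ) * (h * (μ ^ 2 / 4)) := by
              have : Real.exp (-T) ≤ Real.exp (-t + τ) :=
                Real.exp_le_exp.2 (by linarith [hτ.1])
              gcongr
          _ = Real.exp (-t) * (Real.exp τ * (h * (μ ^ 2 / 4))) := by rw [Real.exp_add]; ring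
          _ ≤ _ := by gcongr
    intro t ht b
    rcases eq_or_ne b 0 with rfl | hb
    · simp
    · have hb' : ‖b‖ ≠ 0 := norm_ne_zero_iff.2 hb
      have h1 := hunit (‖b‖⁻¹ • b) (by rw [norm_smul, norm_inv, norm_norm, inv_mul_cancel₀ hb']) t ht
      rw [map_smul, inner_smul_left, inner_smul_right] at h1
      simp only [conj_trivial] at h1
      have h2 : inner ℝ (M t b) b = ‖b‖ ^ 2 * (‖b‖⁻¹ * (‖b‖⁻¹ * inner ℝ (M t b) b)) := by
        field_simp
      rw [h2, mul_comm]
      gcongr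

theorem exists_excitationFilter (hk : 0 < k)
    (hx : ∀ t, 0 ≤ t → HasDerivWithinAt x (u t - k • x t) (Ici 0) t)
    (hX : ∀ t, 0 ≤ t → ‖x t‖ ≤ X) (hu : UniformContinuousOn u (Ici 0))
    (hpe : PersistentlyExciting u) : ∃ M m κ, 0 < κ ∧ IsExcitationFilter x M m κ := by
  obtain ⟨B, hB⟩ := exists_input_bound hk hx hX hu
  refine exists_excitationFilter_of_lipschitz (Λ := B + k * X)
    (fun t ht => (hx t ht).continuousWithinAt) hX (fun s t hs hst => ?_) (hpe.of_filter hk hx hu)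
  refine norm_sub_le_of_norm_deriv_le hx hs hst fun r hr _ => (norm_sub_le _ _).trans ?_
  rw [norm_smul, Real.norm_eq_abs, abs_of_pos hk]
  have := hB r (hs.trans hr)
  have := hX r (hs.trans hr)
  gcongr

end Excitation

/-! ### Rotation matrices and quaternions -/

section Rotation

theorem M3.ext {A B : M3} (h00 : A 0 0 = B 0 0) (h01 : A 0 1 = B 0 1) (h02 : A 0 2 = B 0 2)
    (h10 : A 1 0 = B 1 0) (h11 : A 1 1 = B 1 1) (h12 : A 1 2 = B 1 2)
    (h20 : A 2 0 = B 2 0) (h21 : A 2 1 = B 2 1) (h22 : A 2 2 = B 2 2) : A = B := by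
  ext i j; fin_cases i <;> fin_cases j <;> assumption

theorem mul_apply_three (A B : M3) (i j : Fin 3) :
    (A * B) i j = A i 0 * B 0 j + A i 1 * B 1 j + A i 2 * B 2 j := by
  rw [Matrix.mul_apply, Fin.sum_univ_three]

theorem frobenius_sq (A : M3) : ‖A‖ ^ 2 = A 0 0 ^ 2 + A 0 1 ^ 2 + A 0 2 ^ 2
    + (A 1 0 ^ 2 + A 1 1 ^ 2 + A 1 2 ^ 2) + (A 2 0 ^ 2 + A 2 1 ^ 2 + A 2 2 ^ 2) := by
  rw [Matrix.frobenius_norm_def, ← Real.sqrt_eq_rpow, Real.sq_sqrt (by positivity)]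
  simp [Fin.sum_univ_three]

/-- The polarization of the covering map from quaternions to rotations. -/
def rotPolar (y z : ℝ × E3) : M3 :=
  !![y.1 * z.1 + y.2 0 * z.2 0 - y.2 1 * z.2 1 - y.2 2 * z.2 2,
      y.2 0 * z.2 1 + y.2 1 * z.2 0 - y.1 * z.2 2 - y.2 2 * z.1,
      y.2 0 * z.2 2 + y.2 2 * z.2 0 + y.1 * z.2 1 + y.2 1 * z.1;
    y.2 0 * z.2 1 + y.2 1 * z.2 0 + y.1 * z.2 2 + y.2 2 * z.1,
      y.1 * z.1 - y.2 0 * z.2 0 + y.2 1 * z.2 1 - y.2 2 * z.2 2,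
      y.2 1 * z.2 2 + y.2 2 * z.2 1 - y.1 * z.2 0 - y.2 0 * z.1;
    y.2 0 * z.2 2 + y.2 2 * z.2 0 - y.1 * z.2 1 - y.2 1 * z.1,
      y.2 1 * z.2 2 + y.2 2 * z.2 1 + y.1 * z.2 0 + y.2 0 * z.1,
      y.1 * z.1 - y.2 0 * z.2 0 - y.2 1 * z.2 1 + y.2 2 * z.2 2]

/-- The (unnormalized) rotation matrix of a quaternion. -/
def rotM (y : ℝ × E3) : M3 := rotPolar y y

theorem rotPolar_add_left (y y' z : ℝ × E3) :
    rotPolar (y + y') z = rotPolar y z + rotPolar y' z := by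
  apply M3.ext <;> simp [rotPolar] <;> ring

theorem rotPolar_smul_left (r : ℝ) (y z : ℝ × E3) :
    rotPolar (r • y) z = r • rotPolar y z := by
  apply M3.ext <;> simp [rotPolar] <;> ring

theorem rotPolar_comm (y z : ℝ × E3) : rotPolar y z = rotPolar z y := by
  apply M3.ext <;> simp [rotPolar] <;> ring

theorem rotPolar_add_right (y z z' : ℝ × E3) :
    rotPolar y (z + z') = rotPolar y z + rotPolar y z' := by
  rw [rotPolar_comm, rotPolar_add_left, rotPolar_comm z, rotPolar_comm z']

theorem rotPolar_smul_right (r : ℝ) (y z : ℝ × E3) :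
    rotPolar y (r • z) = r • rotPolar y z := by
  rw [rotPolar_comm, rotPolar_smul_left, rotPolar_comm z]

/-- `rotPolar` as a continuous bilinear map. -/
noncomputable def rotPolarL : (ℝ × E3) →L[ℝ] (ℝ × E3) →L[ℝ] M3 :=
  LinearMap.toContinuousBilinearMap (LinearMap.mk₂ ℝ rotPolar rotPolar_add_left rotPolar_smul_left
    rotPolar_add_right rotPolar_smul_right)

theorem continuous_rotM : Continuous rotM :=
  (rotPolarL.continuous₂.comp (continuous_id.prodMk continuous_id) :)

theorem normSq_coords (y : ℝ × E3) :
    normSq y = y.1 ^ 2 + (y.2 0 ^ 2 + y.2 1 ^ 2 + y.2 2 ^ 2) := by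
  rw [normSq, norm_sq_eq_coords]

theorem rotM_mul_transpose (y : ℝ × E3) : rotM y * (rotM y)ᵀ = normSq y ^ 2 • (1 : M3) := by
  apply M3.ext <;>
  simp [rotM, rotPolar, mul_apply_three, normSq_coords, -Matrix.cons_mul, -Matrix.cons_transpose] <;>
  ring

theorem det_rotM (y : ℝ × E3) : (rotM y).det = normSq y ^ 3 := by
  rw [Matrix.det_fin_three]
  simp [rotM, rotPolar, normSq_coords]; ring

theorem mem_SO3_iff {A : M3} :
    A ∈ Matrix.specialOrthogonalGroup (Fin 3) ℝ ↔ A * Aᵀ = 1 ∧ A.det = 1 := by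
  rw [Matrix.mem_specialOrthogonalGroup_iff, Matrix.mem_orthogonalGroup_iff]

theorem normalized_rotM_mem {y : ℝ × E3} (hy : 0 < normSq y) :
    (normSq y)⁻¹ • rotM y ∈ Matrix.specialOrthogonalGroup (Fin 3) ℝ := by
  rw [mem_SO3_iff, Matrix.transpose_smul, Matrix.smul_mul, Matrix.mul_smul, rotM_mul_transpose,
    Matrix.det_smul, det_rotM, smul_smul, smul_smul]
  constructor
  · rw [show (normSq y)⁻¹ * (normSq y)⁻¹ * normSq y ^ 2 = 1 by field_simp, one_smul]
  · simp only [Fintype.card_fin]; field_simp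

/-- The rotation of a nonzero quaternion. -/
noncomputable def rot (y : ℝ × E3) (hy : 0 < normSq y) : SO3 :=
  ⟨(normSq y)⁻¹ • rotM y, normalized_rotM_mem hy⟩

theorem trace_three (A : M3) : A.trace = A 0 0 + A 1 1 + A 2 2 := by
  rw [Matrix.trace, Fin.sum_univ_three]; rfl

theorem trace_rotM (y : ℝ × E3) : (rotM y).trace = 4 * y.1 ^ 2 - normSq y := by
  rw [trace_three]
  simp [rotM, rotPolar, normSq_coords]; ring

/-- The half-angle formula for the relative rotation: orthogonality of two quaternions is a
condition on the trace alone, hence on rotations without a choice of sign of the quaternion. -/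
theorem trace_rotM_transpose_mul (n q : ℝ × E3) : ((rotM n)ᵀ * rotM q).trace
    = 4 * (n.1 * q.1 + inner ℝ n.2 q.2) ^ 2 - normSq n * normSq q := by
  rw [trace_three, mul_apply_three, mul_apply_three, mul_apply_three]
  simp [rotM, rotPolar, normSq_coords, inner_eq_coords]; ring

theorem SO3.mul_transpose (Q : SO3) : (Q : M3) * (Q : M3)ᵀ = 1 := (mem_SO3_iff.1 Q.2).1

theorem SO3.transpose_mul (Q : SO3) : (Q : M3)ᵀ * (Q : M3) = 1 :=
  mul_eq_one_comm.1 Q.mul_transpose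

theorem SO3.det_eq_one (Q : SO3) : (Q : M3).det = 1 := (mem_SO3_iff.1 Q.2).2

theorem SO3.adjugate_eq (Q : SO3) : (Q : M3).adjugate = (Q : M3)ᵀ := by
  calc (Q : M3).adjugate = ((Q : M3)ᵀ * (Q : M3)) * (Q : M3).adjugate := by
        rw [Q.transpose_mul, one_mul]
    _ = (Q : M3)ᵀ := by
        rw [mul_assoc, Matrix.mul_adjugate, Q.det_eq_one, one_smul, mul_one]

/-- Inverse equals transpose and the determinant is one, so each entry is its own cofactor. These
quadratic relations linearize the later entrywise computations. -/
theorem SO3.cofactor (Q : SO3) (A : M3) (hA : (Q : M3) = A) :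
    A 0 0 = A 1 1 * A 2 2 - A 1 2 * A 2 1 ∧ A 0 1 = A 1 2 * A 2 0 - A 1 0 * A 2 2 ∧
    A 0 2 = A 1 0 * A 2 1 - A 1 1 * A 2 0 ∧ A 1 0 = A 0 2 * A 2 1 - A 0 1 * A 2 2 ∧
    A 1 1 = A 0 0 * A 2 2 - A 0 2 * A 2 0 ∧ A 1 2 = A 0 1 * A 2 0 - A 0 0 * A 2 1 ∧
    A 2 0 = A 0 1 * A 1 2 - A 0 2 * A 1 1 ∧ A 2 1 = A 0 2 * A 1 0 - A 0 0 * A 1 2 ∧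
    A 2 2 = A 0 0 * A 1 1 - A 0 1 * A 1 0 := by
  subst hA
  have h := Q.adjugate_eq
  rw [Matrix.adjugate_fin_three] at h
  have e := fun i j => congrFun (congrFun h i) j
  have e00 := e 0 0
  have e01 := e 0 1
  have e02 := e 0 2
  have e10 := e 1 0
  have e11 := e 1 1
  have e12 := e 1 2
  have e20 := e 2 0
  have e21 := e 2 1
  have e22 := e 2 2
  simp at e00 e01 e02 e10 e11 e12 e20 e21 e22
  refine ⟨?_, ?_, ?_, ?_, ?_, ?_, ?_, ?_, ?_⟩ <;> linarith

theorem rotM_smul (r : ℝ) (y : ℝ × E3) : rotM (r • y) = r ^ 2 • rotM y := by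
  rw [rotM, rotPolar_smul_left, rotPolar_smul_right, smul_smul, rotM, sq]

theorem normSq_smul (r : ℝ) (y : ℝ × E3) : normSq (r • y) = r ^ 2 * normSq y := by
  simp [normSq_coords]; ring

theorem exists_rotM_of_trace (Q : SO3) (h : 0 < 1 + (Q : M3).trace) :
    ∃ y, normSq y = 1 ∧ rotM y = Q := by
  obtain ⟨A, hA⟩ : ∃ A : M3, (Q : M3) = A := ⟨_, rfl⟩
  obtain ⟨c00, c01, c02, c10, c11, c12, c20, c21, c22⟩ := Q.cofactor A hA
  have h1 := Q.mul_transpose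
  have h2 := Q.transpose_mul
  rw [hA] at h h1 h2 ⊢
  rw [trace_three] at h
  have e := fun i j => congrFun (congrFun h1 i) j
  have f := fun i j => congrFun (congrFun h2 i) j
  simp only [mul_apply_three, Matrix.transpose_apply] at e f
  have e00 := e 0 0
  have e11 := e 1 1
  have e22 := e 2 2
  have e01 := e 0 1
  have e02 := e 0 2
  have e12 := e 1 2
  have f00 := f 0 0
  have f11 := f 1 1
  have f22 := f 2 2
  have f01 := f 0 1
  have f02 := f 0 2
  have f12 := f 1 2
  simp at e00 e11 e22 e01 e02 e12 f00 f11 f22 f01 f02 f12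
  set s := 1 + (A 0 0 + A 1 1 + A 2 2) with hs
  -- For a unit quaternion `(η, ε)` of `A` one has `s = 4η²` and the antisymmetric differences are
  -- `4ηε`, so this is `4η (η, ε)`, with squared norm `4s`.
  set y : ℝ × E3 := (s, !₂[A 2 1 - A 1 2, A 0 2 - A 2 0, A 1 0 - A 0 1]) with hy
  have hN : normSq y = 4 * s := by
    rw [normSq_coords]
    simp [hy]
    rw [hs]
    linarith
  have hR : rotM y = (4 * s) • A := by
    apply M3.ext <;> simp [rotM, rotPolar, hy] <;> rw [hs] <;> linarith
  have h4 : ((Real.sqrt (4 * s))⁻¹) ^ 2 = (4 * s)⁻¹ := by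
    rw [inv_pow, Real.sq_sqrt (by positivity)]
  refine ⟨(Real.sqrt (4 * s))⁻¹ • y, ?_, ?_⟩
  · rw [normSq_smul, h4, hN]; field_simp
  · rw [rotM_smul, h4, hR, smul_smul, inv_mul_cancel₀ (by positivity), one_smul]

/-- Right multiplication by the quaternion units `i`, `j`, `k` corresponds to the half-turns about
the coordinate axes. -/
theorem rotM_mul_diagonal (y : ℝ × E3) :
    rotM (-y.2 0, !₂[y.1, y.2 2, -y.2 1]) = rotM y * Matrix.diagonal ![1, -1, -1] ∧
    rotM (-y.2 1, !₂[-y.2 2, y.1, y.2 0]) = rotM y * Matrix.diagonal ![-1, 1, -1] ∧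
    rotM (-y.2 2, !₂[y.2 1, -y.2 0, y.1]) = rotM y * Matrix.diagonal ![-1, -1, 1] := by
  refine ⟨?_, ?_, ?_⟩ <;> apply M3.ext <;>
    simp only [Matrix.mul_diagonal] <;> simp [rotM, rotPolar] <;> ring

theorem exists_rotM_of_mul_diagonal (Q : SO3) (d : Fin 3 → ℝ) (hd : ∀ i, d i * d i = 1)
    (hdet : d 0 * d 1 * d 2 = 1)
    (hrot : ∀ y, ∃ y', normSq y' = normSq y ∧ rotM y' = rotM y * Matrix.diagonal d)
    (h : 0 < 1 + ((Q : M3) * Matrix.diagonal d).trace) : ∃ y, normSq y = 1 ∧ rotM y = Q := by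
  have hdd : Matrix.diagonal d * Matrix.diagonal d = (1 : M3) := by
    rw [Matrix.diagonal_mul_diagonal, ← Matrix.diagonal_one]
    congr 1; funext i; exact hd i
  have hD : Matrix.diagonal d ∈ Matrix.specialOrthogonalGroup (Fin 3) ℝ := by
    rw [mem_SO3_iff, Matrix.diagonal_transpose]
    exact ⟨hdd, by rw [Matrix.det_diagonal, Fin.prod_univ_three, hdet]⟩
  obtain ⟨P, hP⟩ : ∃ P : SO3, (P : M3) = (Q : M3) * Matrix.diagonal d :=
    ⟨⟨_, mul_mem Q.2 hD⟩, rfl⟩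
  rw [← hP] at h
  obtain ⟨y, hy, hyQ⟩ := exists_rotM_of_trace P h
  obtain ⟨y', hy', hyQ'⟩ := hrot y
  refine ⟨y', hy'.trans hy, ?_⟩
  rw [hyQ', hyQ, hP, mul_assoc, hdd, mul_one]

/-- Every rotation comes from a unit quaternion. -/
theorem exists_rotM_eq (Q : SO3) : ∃ y, normSq y = 1 ∧ rotM y = Q := by
  by_cases h0 : 0 < 1 + (Q : M3).trace
  · exact exists_rotM_of_trace Q h0
  by_cases h1 : 0 < 1 + ((Q : M3) * Matrix.diagonal ![1, -1, -1]).trace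
  · exact exists_rotM_of_mul_diagonal Q _ (fun i => by fin_cases i <;> simp) (by simp)
      (fun y => ⟨_, by simp [normSq_coords]; ring, (rotM_mul_diagonal y).1⟩) h1
  by_cases h2 : 0 < 1 + ((Q : M3) * Matrix.diagonal ![-1, 1, -1]).trace
  · exact exists_rotM_of_mul_diagonal Q _ (fun i => by fin_cases i <;> simp) (by simp)
      (fun y => ⟨_, by simp [normSq_coords]; ring, (rotM_mul_diagonal y).2.1⟩) h2
  -- The traces of `Q` and of its three products with axis half-turns sum to zero, so they cannot
  -- all be at most `-1`.
  · refine exists_rotM_of_mul_diagonal Q _ (fun i => by fin_cases i <;> simp) (by simp)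
      (fun y => ⟨_, by simp [normSq_coords]; ring, (rotM_mul_diagonal y).2.2⟩) ?_
    simp only [trace_three, Matrix.mul_diagonal] at h0 h1 h2 ⊢
    simp at h0 h1 h2 ⊢
    linarith

/-- The squared Frobenius distance of a rotation to the identity. -/
theorem SO3.norm_sub_one_sq (Q : SO3) : ‖(Q : M3) - 1‖ ^ 2 = 2 * (3 - (Q : M3).trace) := by
  have h2 := Q.transpose_mul
  have f := fun i j => congrFun (congrFun h2 i) j
  simp only [mul_apply_three, Matrix.transpose_apply] at f
  have f00 := f 0 0
  have f11 := f 1 1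
  have f22 := f 2 2
  rw [frobenius_sq, trace_three]
  simp at f00 f11 f22 ⊢
  linarith

theorem SO3.norm_le_two (Q : SO3) : ‖(Q : M3)‖ ≤ 2 := by
  have h2 := Q.transpose_mul
  have f := fun i j => congrFun (congrFun h2 i) j
  simp only [mul_apply_three, Matrix.transpose_apply] at f
  have f00 := f 0 0
  have f11 := f 1 1
  have f22 := f 2 2
  simp at f00 f11 f22
  refine (abs_le_of_sq_le_sq' ?_ (by norm_num)).2
  rw [frobenius_sq]
  linarith

/-- The quaternion product of a vector with `y`. -/
noncomputable def vecMul (w : E3) (y : ℝ × E3) : ℝ × E3 :=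
  (-inner ℝ w y.2, y.1 • w + cross w y.2)

/-- As `rotM` is quadratic, its derivative along `y'` is `2 rotPolar y' y`; hence `y' = ½ w y` lifts
`R' = w^× R`. -/
theorem rotPolar_vecMul (w : E3) (y : ℝ × E3) : rotPolar (vecMul w y) y = skew w * rotM y := by
  apply M3.ext <;> rw [mul_apply_three] <;>
  simp [rotM, rotPolar, vecMul, skew, inner_eq_coords, cross_zero, cross_one, cross_two] <;> ring

theorem dot_vecMul (w : E3) (y : ℝ × E3) :
    y.1 * (vecMul w y).1 + inner ℝ y.2 (vecMul w y).2 = 0 := by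
  simp [vecMul, inner_eq_coords, cross_zero, cross_one, cross_two]; ring

/-- The linear system is, up to a scalar multiple of the state, the lift of the attitude error
kinematics. -/
theorem normSq_smul_liftField (c : ℝ) (x e : E3) (y : ℝ × E3) :
    normSq y • liftField c x e y
      = (1 / 2 : ℝ) • vecMul (c • cross (act (rotM y) x) (x - e)) y
        + (c / 2 * (inner ℝ (x - e) (act (rotM y) x) - normSq y * ‖x‖ ^ 2)) • y := by
  refine Prod.ext ?_ (E3.ext ?_ ?_ ?_) <;>
  simp [liftField, sandwich, vecMul, inner_eq_coords, cross_zero, cross_one, cross_two, act_apply,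
    rotM, rotPolar, normSq_coords, norm_sq_eq_coords] <;> ring

theorem act_smul_left (r : ℝ) (M : M3) (x : E3) : act (r • M) x = r • act M x := by
  apply E3.ext <;> simp [act_apply] <;> ring

theorem skew_smul (r : ℝ) (w : E3) : skew (r • w) = r • skew w := by
  apply M3.ext <;> simp [skew]

theorem skew_add (w w' : E3) : skew (w + w') = skew w + skew w' := by
  apply M3.ext <;> simp [skew] <;> ring

/-- The attitude error field. -/
noncomputable def attitudeField (c : ℝ) (x p : E3) (M : M3) : M3 :=
  skew (c • cross (act M x) p) * M

/-- The field is a rotational part `½ W y`, tangent to spheres, plus a radial part `σ y`, both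
divided by `normSq y`. Normalization cancels the radial part, and the rotational one projects to the
attitude kinematics. -/
theorem hasDerivWithinAt_normalized_rotM {c : ℝ} {x e : E3} {y : ℝ → ℝ × E3} {s : Set ℝ} {t : ℝ}
    (hy : HasDerivWithinAt y (liftField c x e (y t)) s t) (hpos : 0 < normSq (y t)) :
    HasDerivWithinAt (fun t => (normSq (y t))⁻¹ • rotM (y t))
      (attitudeField c x (x - e) ((normSq (y t))⁻¹ • rotM (y t))) s t := by
  have hN := hasDerivWithinAt_normSq hy
  have hR : HasDerivWithinAt (fun t => rotM (y t))
      (rotPolar (y t) (liftField c x e (y t)) + rotPolar (liftField c x e (y t)) (y t)) s t :=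
    rotPolarL.hasDerivWithinAt_of_bilinear hy hy
  refine ((hN.fun_inv hpos.ne').fun_smul hR).congr_deriv ?_
  set N := normSq (y t) with hNd
  set W := c • cross (act (rotM (y t)) x) (x - e) with hW
  set σ := c / 2 * (inner ℝ (x - e) (act (rotM (y t)) x) - N * ‖x‖ ^ 2) with hσ
  have hf : liftField c x e (y t) = N⁻¹ • ((1 / 2 : ℝ) • vecMul W (y t) + σ • y t) := by
    rw [← normSq_smul_liftField, smul_smul, inv_mul_cancel₀ hpos.ne', one_smul]
  have h1 : (y t).1 * (liftField c x e (y t)).1 + inner ℝ (y t).2 (liftField c x e (y t)).2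
      = σ := by
    have h2 := dot_vecMul W (y t)
    have h3 : (y t).1 * (y t).1 + inner ℝ (y t).2 (y t).2 = N := by
      rw [real_inner_self_eq_norm_sq, hNd, normSq]; ring
    rw [hf]
    simp only [Prod.smul_fst, Prod.smul_snd, Prod.fst_add, Prod.snd_add, inner_smul_right,
      inner_add_right, smul_eq_mul]
    have h4 : (y t).1 * (N⁻¹ * (1 / 2 * (vecMul W (y t)).1 + σ * (y t).1))
        + N⁻¹ * (1 / 2 * inner ℝ (y t).2 (vecMul W (y t)).2 + σ * inner ℝ (y t).2 (y t).2)
        = N⁻¹ * (1 / 2 * ((y t).1 * (vecMul W (y t)).1 + inner ℝ (y t).2 (vecMul W (y t)).2)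
          + σ * ((y t).1 * (y t).1 + inner ℝ (y t).2 (y t).2)) := by ring
    rw [h4, h2, h3]
    field_simp
    ring
  have h2 : rotPolar (liftField c x e (y t)) (y t)
      = N⁻¹ • ((1 / 2 : ℝ) • (skew W * rotM (y t)) + σ • rotM (y t)) := by
    rw [hf, rotPolar_smul_left, rotPolar_add_left, rotPolar_smul_left, rotPolar_smul_left,
      rotPolar_vecMul]
    rfl
  rw [h1, rotPolar_comm (y t), h2, attitudeField, act_smul_left, cross_smul_left, smul_comm c,
    ← hW, skew_smul N⁻¹, Matrix.smul_mul, Matrix.mul_smul]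
  match_scalars <;> field_simp <;> ring

end Rotation

/-! ### The error dynamics -/

section ErrorDynamics

theorem act_mul (A B : M3) (x : E3) : act (A * B) x = act A (act B x) := by
  simp [act, Matrix.mulVec_mulVec]

theorem act_one (x : E3) : act 1 x = x := by simp [act]

theorem act_add_left (A B : M3) (x : E3) : act (A + B) x = act A x + act B x := by
  apply E3.ext <;> simp [act_apply] <;> ring

theorem act_neg_left (A : M3) (x : E3) : act (-A) x = -act A x := by
  apply E3.ext <;> simp [act_apply] <;> ring

theorem act_add_right (A : M3) (x y : E3) : act A (x + y) = act A x + act A y := by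
  apply E3.ext <;> simp [act_apply] <;> ring

theorem act_smul_right (r : ℝ) (A : M3) (x : E3) : act A (r • x) = r • act A x := by
  apply E3.ext <;> simp [act_apply] <;> ring

theorem act_sub_right (A : M3) (x y : E3) : act A (x - y) = act A x - act A y := by
  apply E3.ext <;> simp [act_apply] <;> ring

theorem eq_of_act_eq {A B : M3} (h : ∀ x, act A x = act B x) : A = B := by
  ext i j
  have h1 := congrArg (fun v : E3 => v i) (h (EuclideanSpace.single j 1))
  simp only [act_apply] at h1
  fin_cases j <;> simpa using h1

/-- The action of matrices on vectors as a continuous bilinear map. -/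
noncomputable def actL : M3 →L[ℝ] E3 →L[ℝ] E3 :=
  LinearMap.toContinuousBilinearMap (LinearMap.mk₂ ℝ act act_add_left act_smul_left
    act_add_right act_smul_right)

/-- The transpose as a continuous linear map. -/
noncomputable def transposeL : M3 →L[ℝ] M3 :=
  LinearMap.toContinuousLinearMap (Matrix.transposeLinearEquiv (Fin 3) (Fin 3) ℝ ℝ).toLinearMap

theorem hasDerivWithinAt_transpose {A : ℝ → M3} {A' : M3} {s : Set ℝ} {t : ℝ}
    (h : HasDerivWithinAt A A' s t) : HasDerivWithinAt (fun r => (A r)ᵀ) A'ᵀ s t :=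
  (transposeL.hasFDerivAt.comp_hasDerivWithinAt t h :)

theorem hasDerivWithinAt_act {A : ℝ → M3} {A' : M3} {x : ℝ → E3} {x' : E3} {s : Set ℝ} {t : ℝ}
    (hA : HasDerivWithinAt A A' s t) (hx : HasDerivWithinAt x x' s t) :
    HasDerivWithinAt (fun r => act (A r) (x r)) (act (A t) x' + act A' (x t)) s t :=
  (actL.hasDerivWithinAt_of_bilinear hA hx :)

theorem norm_skew_le (w : E3) : ‖skew w‖ ≤ 2 * ‖w‖ := by
  refine (abs_le_of_sq_le_sq' ?_ (by positivity)).2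
  rw [frobenius_sq, mul_pow, norm_sq_eq_coords]
  simp [skew]
  nlinarith [sq_nonneg (w 0), sq_nonneg (w 1), sq_nonneg (w 2)]

theorem norm_act_le (A : M3) (x : E3) : ‖act A x‖ ≤ ‖A‖ * ‖x‖ := by
  refine (abs_le_of_sq_le_sq' ?_ (by positivity)).2
  have h : ∀ a b c p q r : ℝ,
      (a * p + b * q + c * r) ^ 2 ≤ (a ^ 2 + b ^ 2 + c ^ 2) * (p ^ 2 + q ^ 2 + r ^ 2) := by
    intro a b c p q r
    nlinarith [sq_nonneg (a * q - b * p), sq_nonneg (a * r - c * p), sq_nonneg (b * r - c * q)]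
  rw [mul_pow, frobenius_sq, norm_sq_eq_coords, norm_sq_eq_coords, add_mul, add_mul]
  simp only [act_apply]
  exact add_le_add (add_le_add (h _ _ _ _ _ _) (h _ _ _ _ _ _)) (h _ _ _ _ _ _)

theorem skew_transpose (w : E3) : (skew w)ᵀ = -skew w := by
  apply M3.ext <;> simp [skew]

theorem skew_neg (w : E3) : skew (-w) = -skew w := by
  apply M3.ext <;> simp [skew]

theorem SO3.coe_inv (Q : SO3) : ((Q⁻¹ : SO3) : M3) = (Q : M3)ᵀ := by
  change star (Q : M3) = _
  rw [Matrix.star_eq_conjTranspose, Matrix.conjTranspose_eq_transpose_of_trivial]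

theorem SO3.cross_act (Q : SO3) (a b : E3) : cross (act Q a) (act Q b) = act Q (cross a b) := by
  obtain ⟨A, hA⟩ : ∃ A : M3, (Q : M3) = A := ⟨_, rfl⟩
  obtain ⟨c00, c01, c02, c10, c11, c12, c20, c21, c22⟩ := Q.cofactor A hA
  rw [hA]
  apply E3.ext <;> simp only [cross_zero, cross_one, cross_two, act_apply]
  · linear_combination -(a 1 * b 2 - a 2 * b 1) * c00 - (a 2 * b 0 - a 0 * b 2) * c01
      - (a 0 * b 1 - a 1 * b 0) * c02
  · linear_combination -(a 1 * b 2 - a 2 * b 1) * c10 - (a 2 * b 0 - a 0 * b 2) * c11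
      - (a 0 * b 1 - a 1 * b 0) * c12
  · linear_combination -(a 1 * b 2 - a 2 * b 1) * c20 - (a 2 * b 0 - a 0 * b 2) * c21
      - (a 0 * b 1 - a 1 * b 0) * c22

theorem SO3.mul_skew (Q : SO3) (w : E3) : (Q : M3) * skew w = skew (act Q w) * (Q : M3) :=
  eq_of_act_eq fun x => by rw [act_mul, act_mul, act_skew, act_skew, Q.cross_act]

theorem cross_anticomm' (x y : E3) : cross x y = -cross y x := by
  apply E3.ext <;> simp only [cross_zero, cross_one, cross_two, PiLp.neg_apply] <;> ring

variable {g : E3} {c k : ℝ} {Ω a : ℝ → E3} {R : ℝ → SO3} {v z : ℝ → E3} {t₀ : ℝ}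

/-- Gravity cancels, so the signal driving the error system is `Ra` passed through a first-order
filter. -/
theorem hasDerivWithinAt_velocity_gap (htraj : IsVehicleTrajectory g Ω a R v)
    (hz : IsAuxiliary g k v z) {t : ℝ} (ht : 0 ≤ t) :
    HasDerivWithinAt (fun s => v s - z s) (act (R t) (a t) - k • (v t - z t)) (Ici 0) t := by
  refine ((htraj.vel t ht).fun_sub (hz t ht)).congr_deriv ?_
  rw [uGamma]; module

/-- True and estimated attitude share the body rate `Ω`, which cancels and leaves only the
innovation. -/
theorem IsEstimate.hasDerivWithinAt_attitude (htraj : IsVehicleTrajectory g Ω a R v)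
    {Rh : ℝ → SO3} {vh : ℝ → E3} (ht₀ : 0 ≤ t₀)
    (h : IsEstimate g c k Ω a v z t₀ Rh vh) {t : ℝ} (ht : t₀ ≤ t) :
    HasDerivWithinAt (fun s => (R s : M3) * (Rh s : M3)ᵀ)
      (-(((R t : M3) * (Rh t : M3)ᵀ) * skew (omegaDelta c (v t) (vh t) (z t)))) (Ici t₀) t := by
  have h1 := (htraj.rot t (ht₀.trans ht)).mono (Ici_subset_Ici.2 ht₀)
  have h2 := hasDerivWithinAt_transpose (h.rot t ht)
  refine (h1.fun_mul h2).congr_deriv ?_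
  rw [Matrix.transpose_add, Matrix.transpose_mul, Matrix.transpose_mul,
    skew_transpose, skew_transpose]
  noncomm_ring

theorem act_error_velocity (P Ph : SO3) (x xh ζ : E3) :
    act ((P : M3) * (Ph : M3)ᵀ) (xh - ζ) = x - ζ - (err P x Ph xh ζ).2 := by
  simp [err]

/-- Conjugating the innovation by `Q` expresses it through `x - ζ` and `Q (xh - ζ)`. The latter is
`x - ζ` minus the velocity error, so the attitude equation closes in the error variables. -/
theorem neg_mul_skew_omegaDelta (Q : SO3) (c : ℝ) (x xh ζ : E3) :
    -((Q : M3) * skew (omegaDelta c x xh ζ))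
      = attitudeField c (x - ζ) (act Q (xh - ζ)) (Q : M3) := by
  rw [Q.mul_skew, attitudeField, omegaDelta, act_smul_right, ← Q.cross_act,
    cross_anticomm' (act Q (xh - ζ)), smul_neg, skew_neg, neg_mul, neg_neg]

theorem IsEstimate.hasDerivWithinAt_err_snd (htraj : IsVehicleTrajectory g Ω a R v)
    (hz : IsAuxiliary g k v z) {Rh : ℝ → SO3} {vh : ℝ → E3} (ht₀ : 0 ≤ t₀)
    (h : IsEstimate g c k Ω a v z t₀ Rh vh) {t : ℝ} (ht : t₀ ≤ t) :
    HasDerivWithinAt (fun s => (err (R s) (v s) (Rh s) (vh s) (z s)).2)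
      (-k • (err (R t) (v t) (Rh t) (vh t) (z t)).2) (Ici t₀) t := by
  have h1 := (hasDerivWithinAt_velocity_gap htraj hz (ht₀.trans ht)).mono (Ici_subset_Ici.2 ht₀)
  have h2 := (h.vel t ht).fun_sub ((hz t (ht₀.trans ht)).mono (Ici_subset_Ici.2 ht₀))
  have h3 := hasDerivWithinAt_act (h.hasDerivWithinAt_attitude htraj ht₀ ht) h2
  refine (h1.fun_sub h3).congr_deriv ?_
  set Q : M3 := (R t : M3) * (Rh t : M3)ᵀ with hQ
  set W := omegaDelta c (v t) (vh t) (z t) with hW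
  have hu : uDelta c k (v t) (vh t) (z t) = k • (v t - vh t) - cross W (z t) := by
    rw [uDelta, hW, omegaDelta, cross_smul_left]
  -- The correction in `uDelta` changes `W × vh` into `W × (vh - z)`, exactly what the derivative of
  -- the attitude error compensates.
  have h4 : act (Rh t) (a t) + g + cross W (vh t) + uDelta c k (v t) (vh t) (z t)
      - (g + uGamma k (v t) (z t))
      = act (Rh t) (a t) + cross W (vh t - z t) - k • (vh t - z t) := by
    rw [hu, uGamma, cross_sub_right]; module
  have h5 : act Q (act (Rh t) (a t)) = act (R t) (a t) := by
    rw [← act_mul, hQ, mul_assoc, (Rh t).transpose_mul, mul_one]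
  rw [h4, act_sub_right, act_add_right, h5, act_neg_left, act_mul Q, act_skew, act_smul_right]
  simp only [err, ← hQ]
  module

theorem IsErrorMotion.snd_eq (htraj : IsVehicleTrajectory g Ω a R v)
    (hz : IsAuxiliary g k v z) (ht₀ : 0 ≤ t₀) {E : ℝ → SO3 × E3}
    (h : IsErrorMotion g c k Ω a R v z t₀ E) {t : ℝ} (ht : t₀ ≤ t) :
    (E t).2 = Real.exp (-k * (t - t₀)) • (E t₀).2 := by
  obtain ⟨Rh, vh, hest, hE⟩ := h
  rw [hE t ht, hE t₀ le_rfl]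
  exact eq_exp_smul_of_hasDerivWithinAt
    (fun t ht => hest.hasDerivWithinAt_err_snd htraj hz ht₀ ht) t ht

theorem IsErrorMotion.hasDerivWithinAt_fst (htraj : IsVehicleTrajectory g Ω a R v)
    (hz : IsAuxiliary g k v z) (ht₀ : 0 ≤ t₀) {E : ℝ → SO3 × E3}
    (h : IsErrorMotion g c k Ω a R v z t₀ E) {t : ℝ} (ht : t₀ ≤ t) :
    HasDerivWithinAt (fun s => ((E s).1 : M3)) (attitudeField c (v t - z t)
      (v t - z t - Real.exp (-k * (t - t₀)) • (E t₀).2) ((E t).1 : M3)) (Ici t₀) t := by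
  have hsnd := h.snd_eq htraj hz ht₀ ht
  obtain ⟨Rh, vh, hest, hE⟩ := h
  have h1 : ∀ s, t₀ ≤ s → ((E s).1 : M3) = (R s : M3) * (Rh s : M3)ᵀ := fun s hs => by
    rw [hE s hs, coe_err_fst]
  refine ((hest.hasDerivWithinAt_attitude htraj ht₀ ht).congr (fun s hs => h1 s hs)
    (h1 t ht)).congr_deriv ?_
  rw [← h1 t ht, neg_mul_skew_omegaDelta, ← hsnd, h1 t ht, act_error_velocity _ _ (v t), ← hE t ht]

/-- The field is quadratic in `M`, hence Lipschitz only on bounded sets; the ball of radius `2`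
contains all rotations. -/
theorem attitudeField_lipschitz {X Y : ℝ} (hc : 0 < c) {x p : E3} (hx : ‖x‖ ≤ X) (hp : ‖p‖ ≤ Y) :
    LipschitzOnWith (Real.toNNReal (2 * (c * (X * Y)) * 4))
      (attitudeField c x p) {M | ‖M‖ ≤ 2} := by
  have hX0 : 0 ≤ X := (norm_nonneg _).trans hx
  have hY0 : 0 ≤ Y := (norm_nonneg _).trans hp
  set K := 2 * (c * (X * Y)) with hK
  have hlin : ∀ M, ‖skew (c • cross (act M x) p)‖ ≤ K * ‖M‖ := fun M => by
    calc ‖skew (c • cross (act M x) p)‖ ≤ 2 * ‖c • cross (act M x) p‖ := norm_skew_le _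
      _ = 2 * (c * ‖cross (act M x) p‖) := by
          rw [norm_smul, Real.norm_eq_abs, abs_of_pos hc]
      _ ≤ 2 * (c * (‖act M x‖ * ‖p‖)) := by gcongr; exact norm_cross_le _ _
      _ ≤ 2 * (c * ((‖M‖ * ‖x‖) * ‖p‖)) := by
          gcongr; exact norm_act_le M x
      _ ≤ 2 * (c * ((‖M‖ * X) * Y)) := by gcongr
      _ = _ := by rw [hK]; ring
  refine LipschitzOnWith.of_dist_le_mul fun M hM M' hM' => ?_
  rw [dist_eq_norm, dist_eq_norm, Real.coe_toNNReal _ (by positivity)]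
  have h1 : attitudeField c x p M - attitudeField c x p M'
      = skew (c • cross (act (M - M') x) p) * M + skew (c • cross (act M' x) p) * (M - M') := by
    have h2 : M - M' = M + -M' := sub_eq_add_neg _ _
    have h3 : c • cross (act (M - M') x) p
        = c • cross (act M x) p + -(c • cross (act M' x) p) := by
      rw [h2, act_add_left, act_neg_left, cross_add_left, ← neg_one_smul ℝ (act M' x),
        cross_smul_left]
      module
    rw [h3, skew_add, skew_neg, attitudeField, attitudeField]
    noncomm_ring
  rw [h1]
  refine (norm_add_le _ _).trans ?_
  have hK0 : 0 ≤ K := by positivity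
  have h4 : ‖skew (c • cross (act (M - M') x) p) * M‖ ≤ K * ‖M - M'‖ * 2 :=
    (norm_mul_le _ _).trans (by gcongr; exacts [hlin _, hM])
  have h5 : ‖skew (c • cross (act M' x) p) * (M - M')‖ ≤ K * 2 * ‖M - M'‖ :=
    (norm_mul_le _ _).trans (by
      gcongr
      exact (hlin _).trans (by gcongr; exact hM'))
  linarith

/-- The attitude error is the projection of a solution of the linear system. -/
theorem IsErrorMotion.exists_lift {X : ℝ} (hc : 0 < c) (hk : 0 < k)
    (htraj : IsVehicleTrajectory g Ω a R v) (hz : IsAuxiliary g k v z)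
    (hX : ∀ t, 0 ≤ t → ‖v t - z t‖ ≤ X) (ht₀ : 0 ≤ t₀) {E : ℝ → SO3 × E3}
    (h : IsErrorMotion g c k Ω a R v z t₀ E) {q : ℝ × E3} (hq : normSq q = 1)
    (hqE : rotM q = ((E t₀).1 : M3)) :
    ∃ y, y t₀ = q ∧ IsLift c k (fun t => v t - z t) t₀ (E t₀).2 y ∧ ∀ t, t₀ ≤ t →
      0 < normSq (y t) ∧ ((E t).1 : M3) = (normSq (y t))⁻¹ • rotM (y t) := by
  have hxc : ContinuousOn (fun t => v t - z t) (Ici 0) := fun t ht =>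
    (hasDerivWithinAt_velocity_gap htraj hz ht).continuousWithinAt
  obtain ⟨y, hy₀, hy⟩ := exists_isLift hc hk hxc hX ht₀ (E t₀).2 q
  have hpos : ∀ t, t₀ ≤ t → 0 < normSq (y t) := fun t ht =>
    hy.normSq_pos hc hk hX ht₀ (by rw [hy₀, hq]; exact one_pos) ht
  refine ⟨y, hy₀, hy, fun t ht => ⟨hpos t ht, ?_⟩⟩
  have hd1 := fun s hs => h.hasDerivWithinAt_fst htraj hz ht₀ (t := s) hs
  have hd2 := fun s (hs : t₀ ≤ s) => hasDerivWithinAt_normalized_rotM (hy s hs) (hpos s hs)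
  -- The attitude error and the projected lift solve the same equation inside that ball and agree at
  -- `t₀`.
  refine ODE_solution_unique_of_mem_Icc_right
    (v := fun s => attitudeField c (v s - z s)
      (v s - z s - Real.exp (-k * (s - t₀)) • (E t₀).2))
    (s := fun _ => {M : M3 | ‖M‖ ≤ 2}) (a := t₀) (b := t)
    (fun s hs => attitudeField_lipschitz hc (hX s (ht₀.trans hs.1))
      (Y := X + ‖(E t₀).2‖) ((norm_sub_le _ _).trans
        (add_le_add (hX s (ht₀.trans hs.1)) (norm_exp_smul_le hk hs.1 _))))
    (fun s hs => (hd1 s hs.1).continuousWithinAt.mono Icc_subset_Ici_self)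
    (fun s hs => (hd1 s hs.1).mono (Ici_subset_Ici.2 hs.1))
    (fun s hs => (E s).1.norm_le_two)
    (fun s hs => (hd2 s hs.1).continuousWithinAt.mono Icc_subset_Ici_self)
    (fun s hs => (hd2 s hs.1).mono (Ici_subset_Ici.2 hs.1))
    (fun s hs => (rot (y s) (hpos s hs.1)).norm_le_two) ?_ (right_mem_Icc.2 ht)
  change ((E t₀).1 : M3) = (normSq (y t₀))⁻¹ • rotM (y t₀)
  rw [hy₀, hq, inv_one, one_smul, hqE]

/-- The observer equations are not globally Lipschitz, so they are solved backwards: the linear lift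
gives a global error `(P, e)`, from which the estimates are recovered by inverting the error map. -/
theorem exists_isEstimate {X : ℝ} (hc : 0 < c) (hk : 0 < k)
    (htraj : IsVehicleTrajectory g Ω a R v) (hz : IsAuxiliary g k v z)
    (hX : ∀ t, 0 ≤ t → ‖v t - z t‖ ≤ X) (ht₀ : 0 ≤ t₀) (Rh₀ : SO3) (vh₀ : E3) :
    ∃ Rh vh, IsEstimate g c k Ω a v z t₀ Rh vh ∧ Rh t₀ = Rh₀ ∧ vh t₀ = vh₀ := by
  have hxc : ContinuousOn (fun t => v t - z t) (Ici 0) := fun t ht =>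
    (hasDerivWithinAt_velocity_gap htraj hz ht).continuousWithinAt
  set e₀ := (err (R t₀) (v t₀) Rh₀ vh₀ (z t₀)).2 with he₀
  obtain ⟨q, hq, hqQ⟩ := exists_rotM_eq (R t₀ * Rh₀⁻¹)
  obtain ⟨y, hy₀, hy⟩ := exists_isLift hc hk hxc hX ht₀ e₀ q
  have hpos : ∀ t, t₀ ≤ t → 0 < normSq (y t) := fun t ht =>
    hy.normSq_pos hc hk hX ht₀ (by rw [hy₀, hq]; exact one_pos) ht
  classical
  set P : ℝ → SO3 := fun t => if h : 0 < normSq (y t) then rot (y t) h else 1 with hP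
  have hPcoe : ∀ t, t₀ ≤ t → (P t : M3) = (normSq (y t))⁻¹ • rotM (y t) := fun t ht => by
    simp only [hP, dif_pos (hpos t ht)]; rfl
  set e : ℝ → E3 := fun t => Real.exp (-k * (t - t₀)) • e₀ with he
  set x : ℝ → E3 := fun t => v t - z t with hx
  have hPd : ∀ t, t₀ ≤ t → HasDerivWithinAt (fun s => (P s : M3))
      (attitudeField c (x t) (x t - e t) (P t : M3)) (Ici t₀) t := fun t ht => by
    rw [hPcoe t ht]
    exact (hasDerivWithinAt_normalized_rotM (hy t ht) (hpos t ht)).congr (fun s hs => hPcoe s hs)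
      (hPcoe t ht)
  have hPt : ∀ t, t₀ ≤ t → HasDerivWithinAt (fun s => (P s : M3)ᵀ)
      (skew (c • cross (act ((P t : M3)ᵀ) (x t - e t)) (x t)) * (P t : M3)ᵀ) (Ici t₀) t :=
    fun t ht => by
    have h1 := hasDerivWithinAt_transpose (hPd t ht)
    refine h1.congr_deriv ?_
    rw [attitudeField, Matrix.transpose_mul, skew_transpose, mul_neg,
      ← SO3.coe_inv, SO3.mul_skew, act_smul_right, ← SO3.cross_act, ← act_mul, SO3.coe_inv,
      (P t).transpose_mul, act_one, cross_anticomm' (x t), smul_neg, skew_neg, neg_mul, neg_neg]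
  have hed : ∀ t, HasDerivWithinAt e (-k • e t) (Ici t₀) t := fun t => by
    refine ((hasDerivAt_exp_mul_sub (-k) t₀ t).smul_const e₀).hasDerivWithinAt.congr_deriv ?_
    simp only [he]; module
  refine ⟨fun t => (P t)⁻¹ * R t, fun t => z t + act ((P t : M3)ᵀ) (x t - e t), ⟨fun t ht => ?_,
    fun t ht => ?_⟩, ?_, ?_⟩
  · have h1 := (hPt t ht).fun_mul ((htraj.rot t (ht₀.trans ht)).mono (Ici_subset_Ici.2 ht₀))
    have h2 : ∀ s, (((P s)⁻¹ * R s : SO3) : M3) = (P s : M3)ᵀ * (R s : M3) := fun s => by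
      rw [← SO3.coe_inv]; rfl
    simp only [h2]
    refine h1.congr_deriv ?_
    rw [omegaDelta, add_sub_cancel_left, add_comm, mul_assoc, mul_assoc]
  · have h1 := hasDerivWithinAt_act (hPt t ht)
      (((hasDerivWithinAt_velocity_gap htraj hz (ht₀.trans ht)).mono
        (Ici_subset_Ici.2 ht₀)).fun_sub (hed t))
    refine (((hz t (ht₀.trans ht)).mono (Ici_subset_Ici.2 ht₀)).fun_add h1).congr_deriv ?_
    have h2 : (((P t)⁻¹ * R t : SO3) : M3) = (P t : M3)ᵀ * (R t : M3) := by
      rw [← SO3.coe_inv]; rfl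
    rw [h2, omegaDelta, uDelta, uGamma, add_sub_cancel_left, act_mul, act_mul, act_skew]
    change g + k • x t + (act ((P t : M3)ᵀ) (act (R t) (a t) - k • x t - -k • e t)
      + cross (c • cross (act ((P t : M3)ᵀ) (x t - e t)) (x t)) (act ((P t : M3)ᵀ) (x t - e t)))
      = act ((P t : M3)ᵀ) (act (R t) (a t)) + g
        + cross (c • cross (act ((P t : M3)ᵀ) (x t - e t)) (x t))
          (z t + act ((P t : M3)ᵀ) (x t - e t))
        + (k • (v t - (z t + act ((P t : M3)ᵀ) (x t - e t)))
          - c • cross (cross (act ((P t : M3)ᵀ) (x t - e t)) (x t)) (z t))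
    have h3 : act (R t) (a t) - k • x t - -k • e t = act (R t) (a t) - k • (x t - e t) := by module
    have h4 : v t = z t + x t := by simp [hx]
    rw [h3, act_sub_right _ (act (R t : M3) (a t)), act_smul_right, cross_add_right, h4]
    simp only [cross_smul_left]
    module
  · have h1 : P t₀ = R t₀ * Rh₀⁻¹ := by
      apply Subtype.ext
      rw [hPcoe t₀ le_rfl, hy₀, hq, inv_one, one_smul, hqQ]
    simp [h1]
  · have h1 : P t₀ = R t₀ * Rh₀⁻¹ := by
      apply Subtype.ext
      rw [hPcoe t₀ le_rfl, hy₀, hq, inv_one, one_smul, hqQ]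
    have h2 : (P t₀ : M3) = (R t₀ : M3) * (Rh₀ : M3)ᵀ := by
      rw [h1, ← SO3.coe_inv]; rfl
    have h3 : x t₀ - e t₀ = act (P t₀ : M3) (vh₀ - z t₀) := by
      rw [h2, act_error_velocity _ _ (v t₀)]
      simp [hx, he, he₀]
    change z t₀ + act ((P t₀ : M3)ᵀ) (x t₀ - e t₀) = vh₀
    rw [h3, ← act_mul, (P t₀).transpose_mul, act_one]
    abel

end ErrorDynamics

/-! ### Half-turns and Haar measure -/

section HalfTurns

/-- The rotations by the angle `π`. -/
def halfTurns : Set SO3 := {Q | (Q : M3).trace = -1}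

/-- The rotations whose unit quaternions are orthogonal to the quaternion `n`. -/
def orthRotations (n : ℝ × E3) : Set SO3 := {Q | ((rotM n)ᵀ * (Q : M3)).trace + normSq n = 0}

theorem continuous_trace_coe : Continuous fun Q : SO3 => (Q : M3).trace :=
  continuous_subtype_val.matrix_trace

theorem isClosed_halfTurns : IsClosed halfTurns :=
  isClosed_eq continuous_trace_coe continuous_const

theorem mem_orthRotations {n q : ℝ × E3} {Q : SO3} (hq : normSq q = 1) (hqQ : rotM q = (Q : M3)) :
    Q ∈ orthRotations n ↔ n.1 * q.1 + inner ℝ n.2 q.2 = 0 := by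
  unfold orthRotations
  rw [Set.mem_ofPred_eq, ← hqQ, trace_rotM_transpose_mul, hq]
  constructor
  · intro h
    have : (n.1 * q.1 + inner ℝ n.2 q.2) ^ 2 = 0 := by linarith
    exact pow_eq_zero_iff two_ne_zero |>.1 this
  · intro h; rw [h]; ring

/-- The trace condition says that the rotation relative to `rot n` has trace `-1`; translation
invariance of Haar measure then applies. -/
theorem orthRotations_eq_preimage {n : ℝ × E3} (hn : 0 < normSq n) :
    orthRotations n = (fun Q => (rot n hn)⁻¹ * Q) ⁻¹' halfTurns := by
  ext Q
  have h1 : (((rot n hn)⁻¹ * Q : SO3) : M3) = (normSq n)⁻¹ • ((rotM n)ᵀ * (Q : M3)) := by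
    have : (((rot n hn)⁻¹ * Q : SO3) : M3) = (rot n hn : M3)ᵀ * (Q : M3) := by
      rw [← SO3.coe_inv]; rfl
    rw [this, rot, Matrix.transpose_smul, Matrix.smul_mul]
  simp only [orthRotations, halfTurns, Set.mem_preimage, Set.mem_ofPred_eq, h1, Matrix.trace_smul,
    smul_eq_mul]
  rw [inv_mul_eq_iff_eq_mul₀ hn.ne']
  constructor <;> intro h <;> linarith

theorem haar_orthRotations {n : ℝ × E3} (hn : 0 < normSq n) :
    (Measure.haar : Measure SO3) (orthRotations n) = (Measure.haar : Measure SO3) halfTurns := by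
  rw [orthRotations_eq_preimage hn, measure_preimage_mul]

theorem measurableSet_orthRotations (n : ℝ × E3) : MeasurableSet (orthRotations n) :=
  (isClosed_eq (((continuous_const.mul continuous_subtype_val).matrix_trace).add continuous_const)
    continuous_const).measurableSet

/-- Points of a rational normal curve, any four of which are linearly independent. -/
noncomputable def momentCurve (j : ℕ) : ℝ × E3 := (1, !₂[(j : ℝ), (j : ℝ) ^ 2, (j : ℝ) ^ 3])

theorem normSq_momentCurve_pos (j : ℕ) : 0 < normSq (momentCurve j) := by
  have : (momentCurve j).1 = 1 := rfl
  unfold normSq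
  rw [this]; positivity

-- Membership for the index `j` says that `j` is a root of the cubic with the components of `q` as
-- coefficients. That cubic is nonzero because `q` is a unit quaternion.
open Classical in
theorem card_orthRotations_le (Q : SO3) (N : ℕ) :
    ((Finset.range N).filter fun j => Q ∈ orthRotations (momentCurve j)).card ≤ 3 := by
  obtain ⟨q, hq, hqQ⟩ := exists_rotM_eq Q
  set p : Polynomial ℝ := Polynomial.C q.1 + Polynomial.C (q.2 0) * Polynomial.X
    + Polynomial.C (q.2 1) * Polynomial.X ^ 2 + Polynomial.C (q.2 2) * Polynomial.X ^ 3 with hp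
  have hdeg : p.natDegree ≤ 3 := by rw [hp]; compute_degree
  have hp0 : p ≠ 0 := by
    intro h0
    have c0 : p.coeff 0 = q.1 := by simp [hp]
    have c1 : p.coeff 1 = q.2 0 := by simp [hp, Polynomial.coeff_C]
    have c2 : p.coeff 2 = q.2 1 := by simp [hp]
    have c3 : p.coeff 3 = q.2 2 := by simp [hp]
    rw [h0] at c0 c1 c2 c3
    simp only [Polynomial.coeff_zero] at c0 c1 c2 c3
    rw [normSq_coords, ← c0, ← c1, ← c2, ← c3] at hq
    norm_num at hq
  refine le_trans ?_ (((Multiset.toFinset_card_le p.roots).trans (Polynomial.card_roots' p)).trans hdeg)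
  refine Finset.card_le_card_of_injOn (fun j : ℕ => (j : ℝ)) (fun j hj => ?_)
    (fun i _ j _ h => Nat.cast_injective h)
  have h1 := (mem_orthRotations hq hqQ).1 (Finset.mem_filter.1 hj).2
  simp only [Finset.mem_coe, Multiset.mem_toFinset]
  rw [Polynomial.mem_roots hp0, Polynomial.IsRoot.def]
  simp [momentCurve, inner_eq_coords] at h1
  simp [hp]
  linarith

/-- The half-turns form a null set: translates of it along the moment curve overlap at most three
times. -/
theorem haar_halfTurns : (Measure.haar : Measure SO3) halfTurns = 0 := by
  classical
  set μ : Measure SO3 := Measure.haar with hμ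
  have hbound : ∀ N : ℕ, (N : ENNReal) * μ halfTurns ≤ 3 * μ univ := fun N => by
    calc (N : ENNReal) * μ halfTurns
        = ∑ j ∈ Finset.range N, μ (orthRotations (momentCurve j)) := by
          rw [Finset.sum_congr rfl fun j _ => haar_orthRotations (normSq_momentCurve_pos j)]
          simp [hμ]
      _ = ∑ j ∈ Finset.range N, ∫⁻ Q, (orthRotations (momentCurve j)).indicator 1 Q ∂μ := by
          refine Finset.sum_congr rfl fun j _ => ?_
          rw [lintegral_indicator_one (measurableSet_orthRotations _)]
      _ = ∫⁻ Q, ∑ j ∈ Finset.range N, (orthRotations (momentCurve j)).indicator 1 Q ∂μ := by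
          rw [lintegral_finsetSum]
          exact fun j _ => measurable_one.indicator (measurableSet_orthRotations _)
      _ ≤ ∫⁻ _, 3 ∂μ := by
          refine lintegral_mono fun Q => ?_
          simp only [Set.indicator_apply, Pi.one_apply]
          rw [Finset.sum_boole]
          exact_mod_cast card_orthRotations_le Q N
      _ = 3 * μ univ := by simp
  by_contra h0
  obtain ⟨N, hN⟩ := ENNReal.exists_nat_mul_gt h0
    (ENNReal.mul_ne_top (by norm_num) (measure_ne_top μ univ) : 3 * μ univ ≠ ⊤)
  exact absurd hN (not_lt.2 (hbound N))

/-- Fubini: for each fixed velocity error the slice is a translate of the half-turns. Continuity of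
`n` makes the set closed and thus measurable. -/
theorem errorMeasure_orthRotations {n : E3 → ℝ × E3} (hn : Continuous n) (hn0 : ∀ e, n e ≠ 0) :
    errorMeasure {p | p.1 ∈ orthRotations (n p.2)} = 0 := by
  have hclosed : IsClosed {p : SO3 × E3 | p.1 ∈ orthRotations (n p.2)} := by
    have h1 : Continuous fun p : SO3 × E3 => (rotM (n p.2))ᵀ :=
      (continuous_rotM.comp (hn.comp continuous_snd)).matrix_transpose
    have h2 : Continuous fun p : SO3 × E3 => (p.1 : M3) := continuous_subtype_val.comp continuous_fst
    have h3 : Continuous fun p : SO3 × E3 => normSq (n p.2) := by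
      have := hn.comp (continuous_snd (X := SO3))
      exact (this.fst.pow 2).add (this.snd.norm.pow 2)
    exact isClosed_eq ((h1.mul h2).matrix_trace.add h3) continuous_const
  rw [errorMeasure, Measure.prod_apply_symm hclosed.measurableSet]
  refine (lintegral_congr fun e => ?_).trans lintegral_zero
  have hpos : 0 < normSq (n e) :=
    lt_of_le_of_ne (normSq_nonneg _) fun h => hn0 e (normSq_eq_zero.1 h.symm)
  exact (haar_orthRotations hpos).trans haar_halfTurns

theorem neg_one_le_trace (Q : SO3) : -1 ≤ (Q : M3).trace := by
  obtain ⟨q, hq, hqQ⟩ := exists_rotM_eq Q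
  rw [← hqQ, trace_rotM, hq]
  nlinarith [sq_nonneg q.1]

theorem halfTurns_nonempty : halfTurns.Nonempty := by
  have h : normSq (0, EuclideanSpace.single 0 1) = 1 := by simp [normSq_coords]
  refine ⟨rot (0, EuclideanSpace.single 0 1) (by rw [h]; exact one_pos), ?_⟩
  change ((normSq _)⁻¹ • rotM _).trace = -1
  rw [Matrix.trace_smul, trace_rotM, h]; simp

/-- Compactness: on the rotations at distance at least `ε` from the half-turns the trace attains a
minimum, which exceeds `-1`. -/
theorem exists_infDist_halfTurns_lt {ε : ℝ} (hε : 0 < ε) :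
    ∃ m > 0, ∀ Q : SO3, (Q : M3).trace < -1 + m → Metric.infDist Q halfTurns < ε := by
  have hcl : IsClosed {Q : SO3 | ε ≤ Metric.infDist Q halfTurns} :=
    isClosed_le continuous_const (Metric.continuous_infDist_pt _)
  have hK := hcl.isCompact
  rcases Set.eq_empty_or_nonempty {Q : SO3 | ε ≤ Metric.infDist Q halfTurns} with he | hne
  · refine ⟨1, one_pos, fun Q _ => ?_⟩
    by_contra hcon
    exact (he ▸ (not_lt.1 hcon : Q ∈ {Q : SO3 | ε ≤ Metric.infDist Q halfTurns}) : Q ∈ (∅ : Set SO3))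
  · obtain ⟨Q₀, hQ₀, hmin⟩ := hK.exists_isMinOn hne continuous_trace_coe.continuousOn
    refine ⟨(Q₀ : M3).trace + 1, ?_, fun Q hQ => ?_⟩
    · refine lt_of_le_of_ne (by linarith [neg_one_le_trace Q₀]) fun h => ?_
      have h1 : Q₀ ∈ halfTurns := by
        change (Q₀ : M3).trace = -1
        linarith
      have h2 : ε ≤ Metric.infDist Q₀ halfTurns := hQ₀
      rw [Metric.infDist_zero_of_mem h1] at h2
      linarith
    · by_contra hcon
      have := hmin (not_lt.1 hcon : Q ∈ {Q : SO3 | ε ≤ Metric.infDist Q halfTurns})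
      simp only [Set.mem_ofPred_eq] at this
      linarith

end HalfTurns

/-! ### Stability of the observer -/

section Stability

theorem IsLocallyExponentiallyStable.isStablePoint {α : Type*} [PseudoMetricSpace α]
    {M : ℝ → (ℝ → α) → Prop} {p : α} (h : IsLocallyExponentiallyStable M p) :
    IsStablePoint M p := by
  obtain ⟨r, hr, C, hC, lam, hlam, h⟩ := h
  intro ε hε
  refine ⟨min r (ε / C), lt_min hr (by positivity), fun t₀ ht₀ E hE hd t ht => ?_⟩
  refine (h t₀ ht₀ E hE (hd.trans_le (min_le_left _ _)) t ht).trans_lt ?_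
  have h1 : Real.exp (-lam * (t - t₀)) ≤ 1 := by
    rw [Real.exp_le_one_iff]; nlinarith
  have h2 : dist (E t₀) p < ε / C := hd.trans_le (min_le_right _ _)
  calc C * Real.exp (-lam * (t - t₀)) * dist (E t₀) p ≤ C * 1 * dist (E t₀) p := by gcongr
    _ = C * dist (E t₀) p := by ring
    _ < ε := by rwa [mul_comm, ← lt_div_iff₀ hC]

theorem IsAuxiliary.exists_solution {v : ℝ → E3} {g : E3} {k B : ℝ} (hk : 0 < k)
    (hv : ContinuousOn v (Ici 0)) (hB : ∀ t, 0 ≤ t → ‖v t‖ ≤ B) (z₀ : E3) :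
    ∃ z, IsAuxiliary g k v z ∧ z 0 = z₀ := by
  obtain ⟨z, hz₀, hz⟩ := exists_global_solution (t₀ := 0) (K := Real.toNNReal k)
    (C := ‖g‖ + k * B) (F := fun t z => g + uGamma k (v t) z)
    (fun z => continuousOn_const.add ((hv.sub continuousOn_const).const_smul k))
    (fun t _ => LipschitzWith.of_dist_le_mul fun z z' => by
      rw [Real.coe_toNNReal _ hk.le, dist_add_left, uGamma, uGamma, dist_smul₀, dist_sub_left,
        Real.norm_eq_abs, abs_of_pos hk])
    (fun t ht => (norm_add_le _ _).trans (by
      rw [uGamma, norm_smul, Real.norm_eq_abs, abs_of_pos hk, sub_zero]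
      have := hB t ht
      gcongr)) z₀
  exact ⟨z, hz, hz₀⟩

theorem IsAuxiliary.exists_bound {v z : ℝ → E3} {g : E3} {k B : ℝ} (hk : 0 < k)
    (hB : ∀ t, 0 ≤ t → ‖v t‖ ≤ B) (hz : IsAuxiliary g k v z) :
    ∃ Z, ∀ t, 0 ≤ t → ‖z t‖ ≤ Z := by
  refine ⟨_, norm_le_of_filter (f := fun t => g + k • v t) (C := ‖g‖ + k * B) hk
    (fun t ht => (hz t ht).congr_deriv ?_) fun t ht => (norm_add_le _ _).trans ?_⟩
  · rw [uGamma]; module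
  · rw [norm_smul, Real.norm_eq_abs, abs_of_pos hk]
    have := hB t ht
    gcongr

theorem IsAuxiliary.uniformContinuousOn {v z : ℝ → E3} {g : E3} {k X : ℝ} (hk : 0 < k)
    (hX : ∀ t, 0 ≤ t → ‖v t - z t‖ ≤ X) (hz : IsAuxiliary g k v z) :
    UniformContinuousOn z (Ici 0) := by
  refine ((convex_Ici 0).lipschitzOnWith_of_nnnorm_hasDerivWithin_le
    (C := Real.toNNReal (‖g‖ + k * X)) (fun t ht => hz t ht) fun t ht => ?_).uniformContinuousOn
  rw [← NNReal.coe_le_coe, coe_nnnorm]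
  refine le_trans ((norm_add_le _ _).trans ?_) (Real.le_coe_toNNReal _)
  rw [uGamma, norm_smul, Real.norm_eq_abs, abs_of_pos hk]
  have := hX t ht
  gcongr

theorem err_mem_stableSet_iff (P Ph : SO3) (x xh ζ : E3) :
    err P x Ph xh ζ ∈ stableSet ↔ Ph = P ∧ xh = x := by
  have hact : act ((P : M3) * (P : M3)ᵀ) (xh - ζ) = xh - ζ := by rw [P.mul_transpose, act_one]
  simp only [stableSet, Set.mem_singleton_iff, Prod.ext_iff, err, mul_inv_eq_one]
  constructor
  · rintro ⟨h1, h2⟩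
    subst h1
    rw [hact, sub_sub_sub_cancel_right, sub_eq_zero] at h2
    exact ⟨rfl, h2.symm⟩
  · rintro ⟨rfl, rfl⟩
    rw [hact, sub_self]
    exact ⟨rfl, rfl⟩

theorem dist_one_sq (Q : SO3) : dist Q 1 ^ 2 = 2 * (3 - (Q : M3).trace) := by
  rw [Subtype.dist_eq, dist_eq_norm]
  exact Q.norm_sub_one_sq

theorem dist_one_sq_of_lift {Q : SO3} {y : ℝ × E3} (hy : 0 < normSq y)
    (hQ : (Q : M3) = (normSq y)⁻¹ • rotM y) : dist Q 1 ^ 2 = 8 * ‖y.2‖ ^ 2 / normSq y := by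
  rw [dist_one_sq, hQ, Matrix.trace_smul, trace_rotM, smul_eq_mul, eq_div_iff hy.ne']
  have h : (normSq y)⁻¹ * (4 * y.1 ^ 2 - normSq y) * normSq y = 4 * y.1 ^ 2 - normSq y := by
    field_simp
  have h2 : ‖y.2‖ ^ 2 = normSq y - y.1 ^ 2 := by unfold normSq; ring
  rw [h2]
  linear_combination -2 * h

theorem trace_of_lift {Q : SO3} {y : ℝ × E3} (hy : 0 < normSq y)
    (hQ : (Q : M3) = (normSq y)⁻¹ • rotM y) : (Q : M3).trace = 4 * (y.1 ^ 2 / normSq y) - 1 := by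
  rw [hQ, Matrix.trace_smul, trace_rotM, smul_eq_mul]
  field_simp

theorem infDist_equilibria_le (p : SO3 × E3) :
    Metric.infDist p (stableSet ∪ unstableSet) ≤ max (Metric.infDist p.1 halfTurns) ‖p.2‖ := by
  obtain ⟨h, hh, hd⟩ := isClosed_halfTurns.isCompact.exists_infDist_eq_dist halfTurns_nonempty p.1
  have hmem : ((h, 0) : SO3 × E3) ∈ stableSet ∪ unstableSet := Or.inr ⟨hh, rfl⟩
  refine (Metric.infDist_le_dist_of_mem hmem).trans ?_
  rw [Prod.dist_eq, hd, dist_zero_right]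

variable {g : E3} {c k X t₀ : ℝ} {Ω a : ℝ → E3} {R : ℝ → SO3} {v z : ℝ → E3}
  {E : ℝ → SO3 × E3}

theorem IsErrorMotion.tendsto_snd (hk : 0 < k) (htraj : IsVehicleTrajectory g Ω a R v)
    (hz : IsAuxiliary g k v z) (ht₀ : 0 ≤ t₀) (h : IsErrorMotion g c k Ω a R v z t₀ E) :
    Tendsto (fun t => (E t).2) atTop (𝓝 0) := by
  have h1 : Tendsto (fun t => Real.exp (-k * (t - t₀)) • (E t₀).2) atTop (𝓝 0) := by
    simpa using (tendsto_exp_neg_mul_sub hk t₀).smul_const (E t₀).2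
  refine h1.congr' ?_
  filter_upwards [eventually_ge_atTop t₀] with t ht
  rw [h.snd_eq htraj hz ht₀ ht]

theorem IsLift.tendsto_snd {x : ℝ → E3} {e₀ : E3} {y : ℝ → ℝ × E3} (hc : 0 < c) (hk : 0 < k)
    (hX : ∀ t, 0 ≤ t → ‖x t‖ ≤ X) {M : ℝ → E3 →L[ℝ] E3} {m κ : ℝ} (hκ : 0 < κ)
    (hM : IsExcitationFilter x M m κ) (ht₀ : 0 ≤ t₀) (h : IsLift c k x t₀ e₀ y) :
    Tendsto (fun t => ‖(y t).2‖ ^ 2) atTop (𝓝 0) := by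
  obtain ⟨ν, hν, K, hK, hdecay⟩ := IsLift.exists_decay hc hk hX hκ hM
  refine squeeze_zero' (Eventually.of_forall fun t => sq_nonneg _)
    ((eventually_ge_atTop t₀).mono fun t ht => hdecay t₀ ht₀ e₀ y h t ht) ?_
  simpa using (tendsto_exp_neg_mul_sub hν t₀).mul_const (K * (‖(y t₀).2‖ ^ 2
        + ‖e₀‖ ^ 2 * (normSq (y t₀) * Real.exp (c * X * ‖e₀‖ / k))))

/-- The error tends to the identity if the scalar part of its lift has a nonzero limit. -/
theorem IsErrorMotion.tendsto_of_lift (hc : 0 < c) (hk : 0 < k)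
    (htraj : IsVehicleTrajectory g Ω a R v) (hz : IsAuxiliary g k v z)
    (hX : ∀ t, 0 ≤ t → ‖v t - z t‖ ≤ X) {M : ℝ → E3 →L[ℝ] E3} {m κ : ℝ} (hκ : 0 < κ)
    (hM : IsExcitationFilter (fun t => v t - z t) M m κ) (ht₀ : 0 ≤ t₀)
    (h : IsErrorMotion g c k Ω a R v z t₀ E) {y : ℝ → ℝ × E3}
    (hy : IsLift c k (fun t => v t - z t) t₀ (E t₀).2 y)
    (hyE : ∀ t, t₀ ≤ t → 0 < normSq (y t) ∧ ((E t).1 : M3) = (normSq (y t))⁻¹ • rotM (y t))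
    {l : ℝ} (hl : l ≠ 0) (hlim : Tendsto (fun t => (y t).1) atTop (𝓝 l)) :
    Tendsto E atTop (𝓝 (1, 0)) := by
  have h1 := hy.tendsto_snd hc hk hX hκ hM ht₀
  have h2 : Tendsto (fun t => normSq (y t)) atTop (𝓝 (l ^ 2 + 0)) := (hlim.pow 2).add h1
  have h3 : Tendsto (fun t => dist (E t).1 1 ^ 2) atTop (𝓝 (8 * 0 / (l ^ 2 + 0))) := by
    refine ((h1.const_mul 8).div h2 (by positivity)).congr' ?_
    filter_upwards [eventually_ge_atTop t₀] with t ht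
    exact (dist_one_sq_of_lift (hyE t ht).1 (hyE t ht).2).symm
  have h4 : Tendsto (fun t => dist (E t).1 1) atTop (𝓝 0) := by
    have := h3.sqrt
    simpa [Real.sqrt_sq dist_nonneg] using this
  exact (tendsto_iff_dist_tendsto_zero.2 h4).prodMk_nhds (h.tendsto_snd hk htraj hz ht₀)

theorem IsErrorMotion.tendsto_infDist (hc : 0 < c) (hk : 0 < k)
    (htraj : IsVehicleTrajectory g Ω a R v) (hz : IsAuxiliary g k v z)
    (hX : ∀ t, 0 ≤ t → ‖v t - z t‖ ≤ X) {M : ℝ → E3 →L[ℝ] E3} {m κ : ℝ} (hκ : 0 < κ)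
    (hM : IsExcitationFilter (fun t => v t - z t) M m κ) (ht₀ : 0 ≤ t₀)
    (h : IsErrorMotion g c k Ω a R v z t₀ E) :
    Tendsto (fun t => Metric.infDist (E t) (stableSet ∪ unstableSet)) atTop (𝓝 0) := by
  obtain ⟨q, hq, hqE⟩ := exists_rotM_eq (E t₀).1
  obtain ⟨y, hy₀, hy, hyE⟩ := h.exists_lift hc hk htraj hz hX ht₀ hq hqE
  obtain ⟨l, hl⟩ := hy.exists_tendsto_fst hc hk hX ht₀
  by_cases hl0 : l = 0
  -- Here both parts of the lift tend to zero, so only their ratio counts: the relative bound on `η`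
  -- gives `η² / normSq → 0`, that is, trace tending to `-1`.
  · subst hl0
    have h1 : Tendsto (fun t => ((E t).1 : M3).trace) atTop (𝓝 (-1)) := by
      set A := c * X * ‖(E t₀).2‖ / k * Real.exp (c * X * ‖(E t₀).2‖ / (2 * k)) with hA
      have h2 : Tendsto (fun t => 4 * (A * Real.exp (-k * (t - t₀))) ^ 2 - 1) atTop
          (𝓝 (4 * (A * 0) ^ 2 - 1)) :=
        ((((tendsto_exp_neg_mul_sub hk t₀).const_mul A).pow 2).const_mul 4).sub_const 1
      have h3 : (4 * (A * 0) ^ 2 - 1 : ℝ) = -1 := by ring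
      rw [h3] at h2
      refine tendsto_of_tendsto_of_tendsto_of_le_of_le' tendsto_const_nhds h2
        (Eventually.of_forall fun t => neg_one_le_trace _) ?_
      filter_upwards [eventually_ge_atTop t₀] with t ht
      obtain ⟨hpos, hEt⟩ := hyE t ht
      rw [trace_of_lift hpos hEt]
      have h4 := hy.abs_fst_le_of_tendsto_zero hc hk hX ht₀ hl ht
      have h5 : (y t).1 ^ 2 ≤ (A * Real.exp (-k * (t - t₀))) ^ 2 * normSq (y t) := by
        calc (y t).1 ^ 2 = |(y t).1| ^ 2 := (sq_abs _).symm
          _ ≤ (A * Real.exp (-k * (t - t₀)) * Real.sqrt (normSq (y t))) ^ 2 := by gcongr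
          _ = _ := by rw [mul_pow _ (Real.sqrt _), Real.sq_sqrt hpos.le]
      rw [← div_le_iff₀ hpos] at h5
      linarith
    have h2 : Tendsto (fun t => Metric.infDist (E t).1 halfTurns) atTop (𝓝 0) := by
      rw [Metric.tendsto_nhds]
      intro ε hε
      obtain ⟨m, hm, hmQ⟩ := exists_infDist_halfTurns_lt hε
      filter_upwards [h1.eventually_lt_const (by linarith : -1 < -1 + m)] with t ht
      rw [Real.dist_eq, sub_zero, abs_of_nonneg Metric.infDist_nonneg]
      exact hmQ _ ht
    have h3 := h2.max (h.tendsto_snd hk htraj hz ht₀).norm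
    rw [norm_zero, max_self] at h3
    exact squeeze_zero (fun _ => Metric.infDist_nonneg) (fun t => infDist_equilibria_le (E t)) h3
  · have h1 := h.tendsto_of_lift hc hk htraj hz hX hκ hM ht₀ hy hyE hl0 hl
    refine squeeze_zero (fun _ => Metric.infDist_nonneg) (fun t => ?_)
      (tendsto_iff_dist_tendsto_zero.1 h1)
    exact Metric.infDist_le_dist_of_mem (Or.inl rfl)

/-- With zero velocity error the lift has constant scalar part, and half-turns are the rotations
whose quaternions have zero scalar part. -/
theorem isInvariantSet_unstableSet (hc : 0 < c) (hk : 0 < k)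
    (htraj : IsVehicleTrajectory g Ω a R v) (hz : IsAuxiliary g k v z)
    (hX : ∀ t, 0 ≤ t → ‖v t - z t‖ ≤ X) :
    IsInvariantSet (IsErrorMotion g c k Ω a R v z) unstableSet := by
  rintro t₀ ht₀ E h ⟨htr, h0⟩ t ht
  obtain ⟨q, hq, hqE⟩ := exists_rotM_eq (E t₀).1
  obtain ⟨y, hy₀, hy, hyE⟩ := h.exists_lift hc hk htraj hz hX ht₀ hq hqE
  have hq1 : q.1 = 0 := by
    rw [← hqE, trace_rotM, hq] at htr
    exact pow_eq_zero_iff two_ne_zero |>.1 (by linarith)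
  have h1 := hy.abs_fst_sub_le hc hk hX ht₀ ht
  rw [h0, hy₀, hq1] at h1
  have h2 : (y t).1 = 0 := by simpa using h1
  refine ⟨?_, ?_⟩
  · rw [trace_of_lift (hyE t ht).1 (hyE t ht).2, h2]; norm_num
  · rw [h.snd_eq htraj hz ht₀ ht, h0, smul_zero]

theorem exists_isErrorMotion (hc : 0 < c) (hk : 0 < k)
    (htraj : IsVehicleTrajectory g Ω a R v) (hz : IsAuxiliary g k v z)
    (hX : ∀ t, 0 ≤ t → ‖v t - z t‖ ≤ X) (ht₀ : 0 ≤ t₀) (p : SO3 × E3) :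
    ∃ E, IsErrorMotion g c k Ω a R v z t₀ E ∧ E t₀ = p := by
  obtain ⟨Rh, vh, hest, hRh, hvh⟩ := exists_isEstimate hc hk htraj hz hX ht₀ (p.1⁻¹ * R t₀)
    (z t₀ + act ((p.1 : M3)ᵀ) (v t₀ - z t₀ - p.2))
  refine ⟨_, ⟨Rh, vh, hest, fun t _ => rfl⟩, ?_⟩
  have h1 : R t₀ * (p.1⁻¹ * R t₀)⁻¹ = p.1 := by group
  have h2 : (R t₀ : M3) * ((p.1⁻¹ * R t₀ : SO3) : M3)ᵀ = p.1 := by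
    rw [← SO3.coe_inv]; exact congrArg Subtype.val h1
  change err (R t₀) (v t₀) (Rh t₀) (vh t₀) (z t₀) = p
  rw [hRh, hvh, err, h1, h2, add_sub_cancel_left, ← act_mul, p.1.mul_transpose, act_one,
    sub_sub_cancel]

/-- Half-turns are Haar-null, so arbitrarily near there are other attitudes. Starting there with
zero velocity error freezes the scalar part at a nonzero value. -/
theorem escapesTo_of_mem_unstableSet (hc : 0 < c) (hk : 0 < k)
    (htraj : IsVehicleTrajectory g Ω a R v) (hz : IsAuxiliary g k v z)
    (hX : ∀ t, 0 ≤ t → ‖v t - z t‖ ≤ X) {M : ℝ → E3 →L[ℝ] E3} {m κ : ℝ} (hκ : 0 < κ)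
    (hM : IsExcitationFilter (fun t => v t - z t) M m κ) {p : SO3 × E3} (hp : p ∈ unstableSet) :
    EscapesTo (IsErrorMotion g c k Ω a R v z) p (1, 0) := by
  intro t₀ ht₀ U hU
  have hU' : {Q : SO3 | (Q, p.2) ∈ U} ∈ 𝓝 p.1 := by
    have hcont : Continuous fun Q : SO3 => (Q, p.2) := by fun_prop
    exact hcont.continuousAt hU
  obtain ⟨Q, hQU, hQ⟩ : ∃ Q : SO3, (Q, p.2) ∈ U ∧ Q ∉ halfTurns := by
    by_contra! hcon
    have h1 := Measure.measure_pos_of_mem_nhds (Measure.haar : Measure SO3) hU'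
    exact h1.ne' (measure_mono_null (fun Q hQ => hcon Q hQ) haar_halfTurns)
  rw [hp.2] at hQU
  refine ⟨(Q, 0), hQU, exists_isErrorMotion hc hk htraj hz hX ht₀ _, fun E h hE => ?_⟩
  obtain ⟨q, hq, hqE⟩ := exists_rotM_eq (E t₀).1
  obtain ⟨y, hy₀, hy, hyE⟩ := h.exists_lift hc hk htraj hz hX ht₀ hq hqE
  have hq1 : q.1 ≠ 0 := by
    intro h0
    apply hQ
    change (Q : M3).trace = -1
    rw [hE] at hqE
    change rotM q = (Q : M3) at hqE
    rw [← hqE, trace_rotM, hq, h0]; norm_num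
  refine h.tendsto_of_lift hc hk htraj hz hX hκ hM ht₀ hy hyE hq1
    (tendsto_const_nhds.congr' ?_)
  filter_upwards [eventually_ge_atTop t₀] with t ht
  have h1 := hy.abs_fst_sub_le hc hk hX ht₀ ht
  rw [hE, hy₀] at h1
  have h2 : (y t).1 - q.1 = 0 := by simpa using h1
  linarith

/-- Convergence can fail only when the limit functional kills the initial quaternion, and such
initial errors form a null set. -/
theorem ae_tendsto (hc : 0 < c) (hk : 0 < k)
    (htraj : IsVehicleTrajectory g Ω a R v) (hz : IsAuxiliary g k v z)
    (hX : ∀ t, 0 ≤ t → ‖v t - z t‖ ≤ X) {M : ℝ → E3 →L[ℝ] E3} {m κ : ℝ} (hκ : 0 < κ)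
    (hM : IsExcitationFilter (fun t => v t - z t) M m κ) (ht₀ : 0 ≤ t₀) :
    ∀ᵐ x₀ ∂errorMeasure, ∀ E, IsErrorMotion g c k Ω a R v z t₀ E → E t₀ = x₀ →
      Tendsto E atTop (𝓝 (1, 0)) := by
  have hxc : ContinuousOn (fun t => v t - z t) (Ici 0) := fun t ht =>
    (hasDerivWithinAt_velocity_gap htraj hz ht).continuousWithinAt
  obtain ⟨n, hnc, hn0, hn⟩ := exists_limit_functional hc hk hxc hX ht₀
  rw [ae_iff]
  refine measure_mono_null ?_ (errorMeasure_orthRotations hnc hn0)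
  intro p hp
  by_contra hpn
  refine hp fun E h hE => ?_
  subst hE
  obtain ⟨q, hq, hqE⟩ := exists_rotM_eq (E t₀).1
  obtain ⟨y, hy₀, hy, hyE⟩ := h.exists_lift hc hk htraj hz hX ht₀ hq hqE
  have h1 := hn _ _ hy
  rw [hy₀] at h1
  exact h.tendsto_of_lift hc hk htraj hz hX hκ hM ht₀ hy hyE
    (fun h0 => hpn ((mem_orthRotations hq hqE).2 h0)) h1

set_option maxHeartbeats 1000000 in
theorem isLocallyExponentiallyStable (hc : 0 < c) (hk : 0 < k)
    (htraj : IsVehicleTrajectory g Ω a R v) (hz : IsAuxiliary g k v z)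
    (hX : ∀ t, 0 ≤ t → ‖v t - z t‖ ≤ X) {M : ℝ → E3 →L[ℝ] E3} {m κ : ℝ} (hκ : 0 < κ)
    (hM : IsExcitationFilter (fun t => v t - z t) M m κ) :
    IsLocallyExponentiallyStable (IsErrorMotion g c k Ω a R v z) (1, 0) := by
  have hX0 : 0 ≤ X := (norm_nonneg _).trans (hX 0 le_rfl)
  obtain ⟨ν, hν, K, hK, hdecay⟩ := IsLift.exists_decay hc hk hX hκ hM
  set F := Real.exp (c * X / k) with hF
  set G := c * X / k * Real.sqrt F with hG
  have hG0 : 0 ≤ G := by positivity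
  -- The factor `128 = 8 * 16` comes from `dist² = 8 ‖ε‖² / normSq` and `normSq ≥ 1/16`; the summand
  -- `1` serves the velocity component.
  set C := Real.sqrt (128 * (K * (1 + F))) + 1 with hC
  -- Radius `1/2` forces an initial scalar part of modulus at least `1/2`; the second bound limits
  -- its later drift, at most `d * G`, to `1/4`. So it stays at least `1/4` in modulus. The rate is
  -- `ν / 2` because `ν` governs the squared norm.
  refine ⟨min (1 / 2) (1 / (4 * (1 + G))), by positivity, C, by positivity, min (ν / 2) k,
    lt_min (half_pos hν) hk, fun t₀ ht₀ E h hd t ht => ?_⟩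
  set lam := min (ν / 2) k with hlam
  set d := dist (E t₀) (1, 0) with hdd
  have hd0 : 0 ≤ d := dist_nonneg
  have hd1 : dist (E t₀).1 1 ≤ d := le_max_left _ _
  have hd2 : ‖(E t₀).2‖ ≤ d := by rw [← dist_zero_right]; exact le_max_right _ _
  have hdhalf : d < 1 / 2 := hd.trans_le (min_le_left _ _)
  have hdG : d * (1 + G) < 1 / 4 := by
    have h1 := hd.trans_le (min_le_right _ _)
    rw [lt_div_iff₀ (by positivity)] at h1
    linarith
  obtain ⟨q, hq, hqE⟩ := exists_rotM_eq (E t₀).1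
  obtain ⟨y, hy₀, hy, hyE⟩ := h.exists_lift hc hk htraj hz hX ht₀ hq hqE
  have hNy₀ : normSq (y t₀) = 1 := by rw [hy₀, hq]
  have hε₀ : 8 * ‖(y t₀).2‖ ^ 2 ≤ d ^ 2 := by
    have h1 := dist_one_sq_of_lift (hyE t₀ le_rfl).1 (hyE t₀ le_rfl).2
    rw [hNy₀, div_one] at h1
    rw [← h1]; gcongr
  have hη₀ : 1 / 2 ≤ |(y t₀).1| := by
    have h1 : (y t₀).1 ^ 2 = 1 - ‖(y t₀).2‖ ^ 2 := by rw [← hNy₀, normSq]; ring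
    have h2 : (1 / 2 : ℝ) ^ 2 ≤ |(y t₀).1| ^ 2 := by rw [sq_abs, h1]; nlinarith
    exact (sq_le_sq₀ (by norm_num) (abs_nonneg _)).1 h2
  have hFle : Real.exp (c * X * ‖(E t₀).2‖ / k) ≤ F := by
    apply Real.exp_le_exp.2
    have : c * X * ‖(E t₀).2‖ ≤ c * X * 1 := by gcongr; linarith
    rw [mul_one] at this
    gcongr
  have hη : 1 / 4 ≤ |(y t).1| := by
    have h1 := hy.abs_fst_sub_le hc hk hX ht₀ ht
    rw [hNy₀, one_mul] at h1
    have h2 : c * X * ‖(E t₀).2‖ / k * Real.sqrt (Real.exp (c * X * ‖(E t₀).2‖ / k)) ≤ d * G := by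
      calc _ ≤ c * X * d / k * Real.sqrt F := by gcongr
        _ = d * G := by rw [hG]; ring
    have h3 := abs_sub_abs_le_abs_sub (y t₀).1 (y t).1
    rw [abs_sub_comm] at h3
    nlinarith
  have hN : 1 / 16 ≤ normSq (y t) := by
    have h1 : (1 / 4 : ℝ) ^ 2 ≤ |(y t).1| ^ 2 := by gcongr
    rw [sq_abs] at h1
    unfold normSq
    nlinarith [sq_nonneg ‖(y t).2‖]
  have hε : ‖(y t).2‖ ^ 2 ≤ Real.exp (-ν * (t - t₀)) * (K * (1 + F) * d ^ 2) := by
    refine (hdecay t₀ ht₀ _ y hy t ht).trans ?_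
    rw [hNy₀, one_mul]
    have h1 : ‖(y t₀).2‖ ^ 2 ≤ d ^ 2 := by nlinarith [sq_nonneg ‖(y t₀).2‖]
    have h2 : ‖(E t₀).2‖ ^ 2 * Real.exp (c * X * ‖(E t₀).2‖ / k) ≤ d ^ 2 * F := by gcongr
    have h3 : K * (1 + F) * d ^ 2 = K * (d ^ 2 + d ^ 2 * F) := by ring
    rw [h3]
    gcongr
  have hQ : dist (E t).1 1 ^ 2 ≤ (Real.sqrt (128 * (K * (1 + F)))
      * Real.exp (-(ν / 2) * (t - t₀)) * d) ^ 2 := by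
    rw [dist_one_sq_of_lift (hyE t ht).1 (hyE t ht).2, mul_pow, mul_pow,
      Real.sq_sqrt (by positivity), ← Real.exp_nat_mul]
    have h1 : ((2 : ℕ) : ℝ) * (-(ν / 2) * (t - t₀)) = -ν * (t - t₀) := by push_cast; ring
    rw [h1, div_le_iff₀ (hyE t ht).1]
    have h2 : 0 ≤ Real.exp (-ν * (t - t₀)) * (K * (1 + F) * d ^ 2) := by positivity
    nlinarith [mul_le_mul_of_nonneg_left hN h2]
  have hQ' := (abs_le_of_sq_le_sq' hQ (by positivity)).2
  have hexp1 : Real.exp (-(ν / 2) * (t - t₀)) ≤ Real.exp (-lam * (t - t₀)) := by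
    apply Real.exp_le_exp.2
    nlinarith [mul_nonneg (sub_nonneg.2 (min_le_left (ν / 2) k)) (sub_nonneg.2 ht)]
  have hexp2 : Real.exp (-k * (t - t₀)) ≤ Real.exp (-lam * (t - t₀)) := by
    apply Real.exp_le_exp.2
    nlinarith [mul_nonneg (sub_nonneg.2 (min_le_right (ν / 2) k)) (sub_nonneg.2 ht)]
  rw [Prod.dist_eq]
  refine max_le ?_ ?_
  · calc dist (E t).1 1 ≤ _ := hQ'
      _ ≤ C * Real.exp (-lam * (t - t₀)) * d := by gcongr; rw [hC]; linarith
  · have hC1 : 1 ≤ C := by rw [hC]; exact le_add_of_nonneg_left (Real.sqrt_nonneg _)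
    calc dist (E t).2 0 = Real.exp (-k * (t - t₀)) * ‖(E t₀).2‖ := by
          rw [dist_zero_right, h.snd_eq htraj hz ht₀ ht, norm_exp_smul]
      _ ≤ Real.exp (-lam * (t - t₀)) * d :=
          mul_le_mul hexp2 hd2 (norm_nonneg _) (Real.exp_pos _).le
      _ ≤ C * (Real.exp (-lam * (t - t₀)) * d) :=
          le_mul_of_one_le_left (mul_nonneg (Real.exp_pos _).le hd0) hC1
      _ = C * Real.exp (-lam * (t - t₀)) * d := (mul_assoc _ _ _).symm

end Stability

end VelocityAided

theorem theorem1
    (g : VelocityAided.E3) (Ω a : ℝ → VelocityAided.E3)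
    (R : ℝ → VelocityAided.SO3) (v : ℝ → VelocityAided.E3)
    (c k : ℝ) (hc : 0 < c) (hk : 0 < k)
    (htraj : VelocityAided.IsVehicleTrajectory g Ω a R v)
    (hbdd : ∃ B : ℝ, ∀ t, 0 ≤ t → ‖v t‖ ≤ B)
    (huc : UniformContinuousOn (fun t => VelocityAided.act (R t) (a t)) (Ici 0))
    (hpe : VelocityAided.PersistentlyExciting (fun t => VelocityAided.act (R t) (a t))) :
    -- the observer equations are solvable for all initial values
    (∀ z₀ : VelocityAided.E3, ∃ z, VelocityAided.IsAuxiliary g k v z ∧ z 0 = z₀) ∧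
    ∀ z : ℝ → VelocityAided.E3, VelocityAided.IsAuxiliary g k v z →
      (∀ t₀, 0 ≤ t₀ → ∀ (Rh₀ : VelocityAided.SO3) (vh₀ : VelocityAided.E3),
        ∃ Rh vh, VelocityAided.IsEstimate g c k Ω a v z t₀ Rh vh ∧ Rh t₀ = Rh₀ ∧ vh t₀ = vh₀) ∧
      -- (1) regularity of the auxiliary state and convergence of the error
      UniformContinuousOn z (Ici 0) ∧
      (∀ t₀, 0 ≤ t₀ → ∀ E, VelocityAided.IsErrorMotion g c k Ω a R v z t₀ E →
        Tendsto (fun t => Metric.infDist (E t)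
          (VelocityAided.stableSet ∪ VelocityAided.unstableSet)) atTop (𝓝 0)) ∧
      -- (2) the half-turns form an invariant set, and each of them is unstable
      VelocityAided.IsInvariantSet (VelocityAided.IsErrorMotion g c k Ω a R v z)
        VelocityAided.unstableSet ∧
      (∀ p ∈ VelocityAided.unstableSet,
        VelocityAided.EscapesTo (VelocityAided.IsErrorMotion g c k Ω a R v z) p (1, 0)) ∧
      -- (3) stability of the desired error
      VelocityAided.IsAlmostGloballyAsymptoticallyStable VelocityAided.errorMeasure
        (VelocityAided.IsErrorMotion g c k Ω a R v z) (1, 0) ∧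
      VelocityAided.IsLocallyExponentiallyStable
        (VelocityAided.IsErrorMotion g c k Ω a R v z) (1, 0) ∧
      (∀ (P Ph : VelocityAided.SO3) (x xh ζ : VelocityAided.E3),
        VelocityAided.err P x Ph xh ζ ∈ VelocityAided.stableSet ↔ Ph = P ∧ xh = x) := by
  obtain ⟨B, hB⟩ := hbdd
  refine ⟨VelocityAided.IsAuxiliary.exists_solution hk
    (fun t ht => (htraj.vel t ht).continuousWithinAt) hB, fun z hz => ?_⟩
  obtain ⟨Z, hZ⟩ := hz.exists_bound hk hB
  have hX : ∀ t, 0 ≤ t → ‖v t - z t‖ ≤ B + Z := fun t ht =>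
    (norm_sub_le _ _).trans (add_le_add (hB t ht) (hZ t ht))
  obtain ⟨M, m, κ, hκ, hM⟩ := VelocityAided.exists_excitationFilter hk
    (fun t ht => VelocityAided.hasDerivWithinAt_velocity_gap htraj hz ht) hX huc hpe
  have hles := VelocityAided.isLocallyExponentiallyStable hc hk htraj hz hX hκ hM
  exact ⟨fun t₀ ht₀ => VelocityAided.exists_isEstimate hc hk htraj hz hX ht₀,
    hz.uniformContinuousOn hk hX,
    fun t₀ ht₀ E h => h.tendsto_infDist hc hk htraj hz hX hκ hM ht₀,
    VelocityAided.isInvariantSet_unstableSet hc hk htraj hz hX,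
    fun p hp => VelocityAided.escapesTo_of_mem_unstableSet hc hk htraj hz hX hκ hM hp,
    ⟨hles.isStablePoint, fun t₀ ht₀ => VelocityAided.ae_tendsto hc hk htraj hz hX hκ hM ht₀⟩,
    hles, VelocityAided.err_mem_stableSet_iff⟩
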